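/- Let $0<b<1$ and $0<\sigma<\infty$, and let $K:\mathbb R\to\mathbb R$ be an even function that is $C^1$ on $\mathbb R\setminus\{0\}$. A global $H^1$ solution of $$ i\partial_t u+\partial_x^2u=K(x)|u|^{2\sigma}u,\qquad u(0)=u_0\in H^1(\mathbb R), \tag{1}$$ on $\mathbb R\times\mathbb R$ is a function $u\in C(\mathbb R;H^1(\mathbb R))$, complex valued, with $u(0)=u_0$, that satisfies the equation at every time $t\in\mathbb R$ in the sense of distributions in $x$. Consider the conditions ($A\lesssim B$ means $A\le CB$ for all $x\ne0$ with a constant $C$ independent of $x$): - $(K_1)$: $0<K(x)\lesssim|x|^{-b}$, $\ xK'(x)\le 0$, $\ |K'(x)|\lesssim|x|^{-b-1}$ for $x\neq0$; - $(K_4)$: $|K(x)|\lesssim|x|^{-b}(1+|x|)^{-3}$, $\ |K'(x)|\lesssim|x|^{-b-1}(1+|x|)^{-3}$ for $x\neq0$. Theorem 1.2. (1) Suppose $K$ satisfies $(K_1)$. If $u$ is a global $H^1$ solution of (1) with odd initial value $u_0$ and $u(t)$ is odd for every $t$, then for every bounded interval $I\subset\mathbb R$ $$\lim_{t\to\infty}\bigl(\|u(t)\|_{L^2(I)}+\|u(t)\|_{L^\infty(I)}\bigr)=0,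 \tag{2}$$ and $$\int_{-\infty}^{\infty}\int_{\mathbb R}\frac{|xK'(x)|}{1+|x|}\,|u(t,x)|^{2\sigma+2}\,dx\,dt<\infty .$$ (2) Suppose $K$ satisfies $(K_4)$. There is $\epsilon>0$, independent of the solution, such that for every global $H^1$ solution $u$ of (1) with odd initial value $u_0$, $u(t)$ odd for every $t$ and $\|u_0\|_{H^1(\mathbb R)}\le\epsilon$, the limit (2) holds for every bounded interval $I\subset\mathbb R$, and $$\int_{-\infty}^{\infty}\int_{\mathbb R}|x|^{-b}(1+|x|)^{-4}\,|u(t,x)|^{2\sigma+2}\,dx\,dt<\infty .$$ -/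

import Mathlib

open MeasureTheory Filter Topology
open scoped ContDiff ENNReal

namespace INLS

/-- `g` is the weak derivative of `f` on `ℝ`: `∫ f η' = - ∫ g η` for every test function
`η ∈ C_c^∞(ℝ; ℂ)`. -/
def IsWeakDeriv (f g : ℝ → ℂ) : Prop :=
  ∀ η : ℝ → ℂ, ContDiff ℝ ∞ η → HasCompactSupport η →
    ∫ x, f x * deriv η x = -∫ x, g x * η x

theorem integrable_lp_mul (f : Lp ℂ 2 (volume : Measure ℝ)) {η : ℝ → ℂ}
    (hη : Continuous η) (hc : HasCompactSupport η) :
    Integrable (fun x => f x * η x) :=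
  (Lp.memLp f).integrable_mul (hη.memLp_of_hasCompactSupport (p := 2) (μ := volume) hc)

theorem isWeakDeriv_congr {f f' g g' : ℝ → ℂ} (hf : f =ᵐ[volume] f') (hg : g =ᵐ[volume] g')
    (h : IsWeakDeriv f g) : IsWeakDeriv f' g' := by
  intro η hη hc
  have h1 : ∫ x, f' x * deriv η x = ∫ x, f x * deriv η x :=
    integral_congr_ae (by filter_upwards [hf] with x hx; rw [hx])
  have h2 : ∫ x, g' x * η x = ∫ x, g x * η x :=
    integral_congr_ae (by filter_upwards [hg] with x hx; rw [hx])
  rw [h1, h2]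
  exact h η hη hc

/-- The complex Sobolev space `H¹(ℝ)`: the pairs `(f, f')` with `f ∈ L²(ℝ; ℂ)` whose weak
derivative `f'` lies in `L²(ℝ; ℂ)`.  As a subspace of the Hilbert sum `L² ⊕ L²` it carries the
usual norm `‖f‖_{H¹}² = ‖f‖_{L²}² + ‖f'‖_{L²}²`. -/
noncomputable def H1 : Submodule ℂ
    (WithLp 2 (Lp ℂ 2 (volume : Measure ℝ) × Lp ℂ 2 (volume : Measure ℝ))) where
  carrier := {p | IsWeakDeriv p.fst p.snd}
  zero_mem' := by
    refine isWeakDeriv_congr (Lp.coeFn_zero ℂ 2 volume).symm (Lp.coeFn_zero ℂ 2 volume).symm ?_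
    intro η _ _
    simp
  add_mem' := by
    intro p q hp hq
    refine isWeakDeriv_congr (Lp.coeFn_add p.fst q.fst).symm (Lp.coeFn_add p.snd q.snd).symm ?_
    intro η hη hc
    have hη' : Continuous (deriv η) := hη.continuous_deriv (by simp)
    simp only [Pi.add_apply, add_mul]
    rw [integral_add (integrable_lp_mul p.fst hη' hc.deriv) (integrable_lp_mul q.fst hη' hc.deriv),
      integral_add (integrable_lp_mul p.snd hη.continuous hc)
        (integrable_lp_mul q.snd hη.continuous hc), hp η hη hc, hq η hη hc]
    ring
  smul_mem' := by
    intro c p hp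
    refine isWeakDeriv_congr (Lp.coeFn_smul c p.fst).symm (Lp.coeFn_smul c p.snd).symm ?_
    intro η hη hc
    simp only [Pi.smul_apply, smul_eq_mul, mul_assoc]
    rw [integral_const_mul, integral_const_mul, hp η hη hc]
    ring

/-- A function `ℝ → ℂ` representing `f ∈ H¹(ℝ)` (determined almost everywhere). -/
noncomputable def fn (f : H1) : ℝ → ℂ := fun x => f.1.fst x

/-- A function `ℝ → ℂ` representing the weak derivative of `f ∈ H¹(ℝ)`. -/
noncomputable def dfn (f : H1) : ℝ → ℂ := fun x => f.1.snd x

/-- `f ∈ H¹(ℝ)` is odd: `f(-x) = -f(x)` for almost every `x`. -/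
def IsOdd (f : H1) : Prop := ∀ᵐ x : ℝ, fn f (-x) = -fn f x

/-- `u` is a global `H¹` solution, with initial value `u₀`, of
`i ∂ₜu + ∂ₓₓu = K |u|^{2σ} u` on `ℝ × ℝ`: `u ∈ C(ℝ; H¹(ℝ))`, `u(0) = u₀`, and for every time `t`
the equation holds in the sense of distributions in `x`, that is, for every
`η ∈ C_c^∞(ℝ; ℂ)`,
`d/dt ∫ u η dx = -i (∫ uₓ η' dx + ∫ K |u|^{2σ} u η dx)`. -/
structure IsGlobalSolution (σ : ℝ) (K : ℝ → ℝ) (u₀ : H1) (u : ℝ → H1) : Prop where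
  continuous : Continuous u
  initial : u 0 = u₀
  equation : ∀ η : ℝ → ℂ, ContDiff ℝ ∞ η → HasCompactSupport η → ∀ t : ℝ,
    HasDerivAt (fun s => ∫ x, fn (u s) x * η x)
      (-Complex.I * ((∫ x, dfn (u t) x * deriv η x) +
        ∫ x, ((K x * ‖fn (u t) x‖ ^ (2 * σ) : ℝ) : ℂ) * fn (u t) x * η x)) t

/-- Standing assumption on the coefficient: `K` is even and `K ∈ C¹(ℝ ∖ {0})`. -/
def IsCoefficient (K : ℝ → ℝ) : Prop :=
  (∀ x, K (-x) = K x) ∧ ContDiffOn ℝ 1 K {0}ᶜ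

/-- `0 < K(x) ≲ |x|^{-b}`, `x K'(x) ≤ 0`, `|K'(x)| ≲ |x|^{-b-1}` for `x ≠ 0`. -/
def CondK1 (b : ℝ) (K : ℝ → ℝ) : Prop :=
  (∀ x, x ≠ 0 → 0 < K x) ∧
  (∃ C : ℝ, ∀ x, x ≠ 0 → K x ≤ C * |x| ^ (-b)) ∧
  (∀ x, x ≠ 0 → x * deriv K x ≤ 0) ∧
  (∃ C : ℝ, ∀ x, x ≠ 0 → |deriv K x| ≤ C * |x| ^ (-b - 1))

/-- `|K(x)| ≲ |x|^{-b} (1+|x|)^{-3}`, `|K'(x)| ≲ |x|^{-b-1} (1+|x|)^{-3}` for `x ≠ 0`. -/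
def CondK4 (b : ℝ) (K : ℝ → ℝ) : Prop :=
  (∃ C : ℝ, ∀ x, x ≠ 0 → |K x| ≤ C * (|x| ^ (-b) * (1 + |x|) ^ (-3 : ℝ))) ∧
  (∃ C : ℝ, ∀ x, x ≠ 0 → |deriv K x| ≤ C * (|x| ^ (-b - 1) * (1 + |x|) ^ (-3 : ℝ)))

/-- `‖u(t)‖_{L²(I)} + ‖u(t)‖_{L^∞(I)} → 0` as `t → +∞`, for every bounded interval `I`. -/
def LocalDecay (u : ℝ → H1) : Prop :=
  ∀ I : Set ℝ, I.OrdConnected → Bornology.IsBounded I →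
    Tendsto (fun t : ℝ => eLpNorm (fn (u t)) 2 (volume.restrict I) +
      eLpNorm (fn (u t)) ⊤ (volume.restrict I)) atTop (𝓝 0)

/-- The space-time integral `∫_{-∞}^{∞} ∫_ℝ w(x) |u(t,x)|^{2σ+2} dx dt ∈ [0, ∞]` with a
nonnegative weight `w`. -/
noncomputable def morawetz (σ : ℝ) (w : ℝ → ℝ) (u : ℝ → H1) : ℝ≥0∞ :=
  ∫⁻ t : ℝ, ∫⁻ x : ℝ, ENNReal.ofReal (w x * ‖fn (u t) x‖ ^ (2 * σ + 2))

end INLS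

namespace INLS

/-! The proof is a virial (Morawetz) argument with the bounded weight ψ(x) = x/(1+|x|). Put a = 2σ.
The time derivative of the momentum Im ∫ ψ ū u_x is 2∫ψ'|u_x|² + Re∫ψ'' ū u_x plus a nonlinear term
(`IsSol.virial`). Integration by parts turns the nonlinear term into a/(a+2) ∫ψ'K|u|^{a+2} − 2/(a+2)
∫ψK'|u|^{a+2} (`virial_nl_eq`). For odd u the linear part is coercive. Since u vanishes at 0, the
jump of ψ'' there costs nothing, and the ψ'' term equals −3∫|u|²(1+|x|)^{-4}. A weighted Hardy
inequality bounds this by two thirds of the kinetic term (`OddH1.virial_coercive`).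

Under the first condition both nonlinear terms are nonnegative. Under the second they are bounded by
a weighted potential energy, which for small data is at most half of the coercive part
(`abs_virial_nl_le`, `OddH1.integral_weight_rinv_four_le`). The momentum is bounded uniformly in
time by mass and energy, so A(t) = ∫ψ'|u_x|² is integrable over ℝ and the space-time integrals are
finite. The weighted mass ∫|u|²(1+|x|)^{-4} is at most a multiple of A and changes at a rate at most
a multiple of A. Hence it tends to 0 (`IsNLS.norm_rinv_two_sq_le`), and interpolation with the
bounded gradient gives local uniform decay.

What remains is to justify these identities for solutions that are merely continuous in H¹. Oddness
gives |u(x)|² ≤ |x|‖u_x‖², so K|u|^a u lies in L² because b < 1. Virial and mass identities are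
proved for time averages, which do have two spatial derivatives in L², and then passed to the limit
(`IsSol.balance_of_steklov`).

Conservation of energy is harder, since K|u|^a u need not be in H¹ and cannot be paired directly
with ∂ₜu. It is derived from the equation tested against increments u(t+h) − u(t)
(`diagonal_sub_eq_of_increments`). This requires the trapezoidal error of the potential energy,
integrated in time, to be o(h). The delicate contribution comes from the singularity of K at 0. It
is controlled by two local smoothing estimates for the increments: one for their gradients, one for
the increments themselves (`IsNLS.exists_integral_trapezoid_le`). -/

/-! ### Locally absolutely continuous functions on the line. -/

theorem locallyIntegrable_of_intervalIntegrable {E : Type*} [NormedAddCommGroup E] {f : ℝ → E}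
    (hf : ∀ a b, IntervalIntegrable f volume a b) : LocallyIntegrable f volume := fun x =>
  ⟨Set.Ioc (x - 1) (x + 1), Ioc_mem_nhds (by linarith) (by linarith),
    (intervalIntegrable_iff_integrableOn_Ioc_of_le (by linarith)).1 (hf _ _)⟩

/-- `F` is locally absolutely continuous on `ℝ`, with derivative `f` almost everywhere. -/
def ACD (F f : ℝ → ℝ) : Prop :=
  (∀ a b, AbsolutelyContinuousOnInterval F a b) ∧ ∀ᵐ x, HasDerivAt F (f x) x

namespace ACD

variable {F f G g : ℝ → ℝ}

theorem intervalIntegrable (h : ACD F f) (a b : ℝ) : IntervalIntegrable f volume a b := by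
  refine (h.1 a b).intervalIntegrable_deriv.congr_ae ?_
  filter_upwards [ae_restrict_of_ae h.2] with x hx using hx.deriv

theorem integral_eq_sub (h : ACD F f) (a b : ℝ) : ∫ x in a..b, f x = F b - F a := by
  rw [← (h.1 a b).integral_deriv_eq_sub]
  refine intervalIntegral.integral_congr_ae ?_
  filter_upwards [h.2] with x hx _ using hx.deriv.symm

theorem continuous (h : ACD F f) : Continuous F := by
  rw [continuous_iff_continuousAt]
  intro x
  refine (h.1 (x - 1) (x + 1)).continuousOn.continuousAt ?_
  rw [Set.uIcc_of_le (by linarith)]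
  exact Icc_mem_nhds (by linarith) (by linarith)

theorem add (h : ACD F f) (h' : ACD G g) : ACD (fun x => F x + G x) (fun x => f x + g x) :=
  ⟨fun a b => (h.1 a b).fun_add (h'.1 a b), by
    filter_upwards [h.2, h'.2] with x hx hx' using hx.add hx'⟩

theorem mul (h : ACD F f) (h' : ACD G g) :
    ACD (fun x => F x * G x) (fun x => f x * G x + F x * g x) :=
  ⟨fun a b => (h.1 a b).fun_mul (h'.1 a b), by
    filter_upwards [h.2, h'.2] with x hx hx' using hx.mul hx'⟩

theorem of_integral (c : ℝ) (hf : ∀ a b, IntervalIntegrable f volume a b)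
    (hF : ∀ x, F x = c + ∫ y in (0 : ℝ)..x, f y) : ACD F f := by
  have hF' : F = fun x => c + ∫ y in (0 : ℝ)..x, f y := funext hF
  have hloc : LocallyIntegrable f volume := locallyIntegrable_of_intervalIntegrable hf
  refine ⟨fun a b => ?_, ?_⟩
  · rw [hF']
    have h1 : AbsolutelyContinuousOnInterval (fun _ : ℝ => c) a b :=
      (LipschitzWith.const c).lipschitzOnWith.absolutelyContinuousOnInterval
    refine h1.fun_add ?_
    have h2 := (hf (min a (min b 0)) (max a (max b 0))).absolutelyContinuousOnInterval_intervalIntegral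
      (c := 0) (by rw [Set.mem_uIcc]; left; simp)
    refine h2.mono ?_
    rw [Set.uIcc_subset_uIcc_iff_mem, Set.mem_uIcc, Set.mem_uIcc]
    constructor <;> left <;> simp
  · filter_upwards [LocallyIntegrable.ae_hasDerivAt_integral hloc] with x hx
    rw [hF']
    exact (hx 0).const_add c

/-- Chain rule with an outer function of class `C¹`. -/
theorem comp (h : ACD F f) {Φ Φ' : ℝ → ℝ} (hΦ : ∀ y, HasDerivAt Φ (Φ' y) y)
    (hc : Continuous Φ') : ACD (fun x => Φ (F x)) (fun x => Φ' (F x) * f x) := by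
  refine ⟨fun a b => ?_, by filter_upwards [h.2] with x hx using (hΦ _).comp x hx⟩
  obtain ⟨R, hR⟩ := (isCompact_uIcc.image h.continuous : IsCompact (F '' Set.uIcc a b)).isBounded.subset_closedBall 0
  obtain ⟨C, hC⟩ := (isCompact_closedBall (0 : ℝ) R).exists_bound_of_continuousOn hc.continuousOn
  have hL : ∀ x ∈ Set.uIcc a b, ∀ y ∈ Set.uIcc a b, dist (Φ (F x)) (Φ (F y)) ≤ C * dist (F x) (F y) := by
    intro x hx y hy
    rw [dist_eq_norm, dist_eq_norm]
    exact (convex_closedBall (0 : ℝ) R).norm_image_sub_le_of_norm_hasDerivWithin_le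
      (fun z _ => (hΦ z).hasDerivWithinAt) hC (hR ⟨y, hy, rfl⟩) (hR ⟨x, hx, rfl⟩)
  have h1 := h.1 a b
  rw [absolutelyContinuousOnInterval_iff] at h1 ⊢
  intro ε hε
  have hC0 : 0 < |C| + 1 := by positivity
  obtain ⟨δ, hδ, h2⟩ := h1 (ε / (|C| + 1)) (by positivity)
  refine ⟨δ, hδ, fun E hE hE' => ?_⟩
  have h3 := h2 E hE hE'
  rw [lt_div_iff₀ hC0] at h3
  refine lt_of_le_of_lt ?_ h3
  rw [Finset.sum_mul]
  refine Finset.sum_le_sum fun i hi => ?_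
  have h4 := hE.1 i hi
  refine (hL _ h4.1 _ h4.2).trans ?_
  rw [mul_comm]
  exact mul_le_mul_of_nonneg_left ((le_abs_self C).trans (by linarith)) dist_nonneg

/-- Integrability of f gives F limits at ±∞. Integrability of F forces both limits to be 0, because
a nonzero limit would keep |F| away from 0 on a half-line of infinite measure. This is the
boundary-free integration by parts behind every identity below. -/
theorem integral_eq_zero (h : ACD F f) (hF : Integrable F) (hf : Integrable f) :
    ∫ x, f x = 0 := by
  have hF0 : ∀ x, F x = F 0 + ∫ y in (0 : ℝ)..x, f y := fun x => by
    rw [h.integral_eq_sub]; ring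
  have key : ∀ l : Filter ℝ, ∀ L : ℝ, Tendsto F l (𝓝 L) → (∀ s ∈ l, volume s = ⊤) → L = 0 := by
    intro l L hL hl
    by_contra hne
    have h1 : ∀ᶠ x in l, |L| / 2 ≤ ‖F x‖ := by
      have := hL.norm.eventually (lt_mem_nhds (show |L| / 2 < ‖L‖ by
        rw [Real.norm_eq_abs]; linarith [abs_pos.2 hne]))
      exact this.mono fun x hx => le_of_lt hx
    have h2 := hF.measure_norm_ge_lt_top (ε := |L| / 2) (by positivity)
    rw [hl _ h1] at h2
    exact lt_irrefl _ h2
  have hT : Tendsto F atTop (𝓝 (F 0 + ∫ y in Set.Ioi (0 : ℝ), f y)) := by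
    rw [show F = fun x => F 0 + ∫ y in (0 : ℝ)..x, f y from funext hF0]
    simpa using (intervalIntegral_tendsto_integral_Ioi 0 hf.integrableOn tendsto_id).const_add (F 0)
  have hB : Tendsto F atBot (𝓝 (F 0 - ∫ y in Set.Iic (0 : ℝ), f y)) := by
    rw [show F = fun x => F 0 - ∫ y in x..0, f y from funext fun x => by
      rw [hF0 x, intervalIntegral.integral_symm x 0, sub_eq_add_neg]]
    simpa using (intervalIntegral_tendsto_integral_Iic 0 hf.integrableOn tendsto_id).const_sub (F 0)
  have e1 := key _ _ hT (fun s hs => by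
    obtain ⟨a, ha⟩ := mem_atTop_sets.1 hs
    exact top_le_iff.1 (by rw [← Real.volume_Ici (a := a)]; exact measure_mono ha))
  have e2 := key _ _ hB (fun s hs => by
    obtain ⟨a, ha⟩ := mem_atBot_sets.1 hs
    exact top_le_iff.1 (by rw [← Real.volume_Iic (a := a)]; exact measure_mono ha))
  have e3 : (∫ y in Set.Iic (0 : ℝ), f y) + ∫ y in Set.Ioi (0 : ℝ), f y = ∫ y, f y :=
    intervalIntegral.integral_Iic_add_Ioi hf.integrableOn hf.integrableOn
  linarith

/-- The oscillation of F is at most ∫|f|. If |F| exceeded this at one point, it would be bounded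
below by a positive constant everywhere, which contradicts integrability. -/
theorem abs_le_integral_abs (h : ACD F f) (hF : Integrable F) (hf : Integrable f) (x : ℝ) :
    |F x| ≤ ∫ y, |f y| := by
  by_contra! hlt
  set ε := (|F x| - ∫ y, |f y|) with hε
  have hε0 : 0 < ε := by simp only [hε]; linarith
  have h1 : ∀ y, ε ≤ ‖F y‖ := by
    intro y
    have h2 := h.integral_eq_sub y x
    have h3 : ‖∫ t in y..x, f t‖ ≤ ∫ t, |f t| :=
      intervalIntegral.norm_integral_le_integral_norm_uIoc.trans
        (setIntegral_le_integral hf.norm (ae_of_all _ fun _ => norm_nonneg _))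
    rw [h2] at h3
    have h4 := norm_sub_norm_le (F x) (F y)
    simp only [Real.norm_eq_abs] at *
    linarith
  have h2 := hF.measure_norm_ge_lt_top hε0
  rw [Set.eq_univ_of_forall (s := {y | ε ≤ ‖F y‖}) h1] at h2
  simp at h2

theorem locallyIntegrable (h : ACD F f) : LocallyIntegrable f volume :=
  locallyIntegrable_of_intervalIntegrable h.intervalIntegrable

end ACD

/-! ### Weak derivatives and absolutely continuous representatives. -/

theorem exists_primitive_hasCompactSupport {χ : ℝ → ℝ} (hχ : ContDiff ℝ ∞ χ)
    (hc : HasCompactSupport χ) (h0 : ∫ x, χ x = 0) :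
    ∃ η : ℝ → ℝ, ContDiff ℝ ∞ η ∧ HasCompactSupport η ∧ deriv η = χ := by
  obtain ⟨R, hR⟩ := hc.isBounded.subset_closedBall 0
  rw [Real.closedBall_eq_Icc, zero_sub, zero_add] at hR
  have hz : ∀ x, x ∉ Set.Icc (-R) R → χ x = 0 := fun x hx =>
    image_eq_zero_of_notMem_tsupport fun h => hx (hR h)
  have hint : Integrable χ := hχ.continuous.integrable_of_hasCompactSupport hc
  have hd : ∀ x, HasDerivAt (fun x => ∫ y in (-R)..x, χ y) (χ x) x := fun x =>
    intervalIntegral.integral_hasDerivAt_right (hχ.continuous.intervalIntegrable _ _)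
      (hχ.continuous.stronglyMeasurableAtFilter _ _) hχ.continuous.continuousAt
  have hd' : deriv (fun x => ∫ y in (-R)..x, χ y) = χ := funext fun x => (hd x).deriv
  refine ⟨fun x => ∫ y in (-R)..x, χ y, ?_, ?_, hd'⟩
  · rw [contDiff_infty_iff_deriv, hd']
    exact ⟨fun x => (hd x).differentiableAt, hχ⟩
  · refine HasCompactSupport.of_support_subset_isCompact (isCompact_Icc (a := -R) (b := R)) ?_
    intro x hx
    by_contra hxI
    refine hx ?_
    rcases lt_or_ge x (-R) with h | h
    · change ∫ y in (-R)..x, χ y = 0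
      rw [intervalIntegral.integral_symm, intervalIntegral.integral_of_le h.le,
        integral_Ioc_eq_integral_Ioo, neg_eq_zero]
      exact setIntegral_eq_zero_of_forall_eq_zero fun y hy => hz y fun h3 => hy.2.not_ge h3.1
    · have h2 : R < x := by
        by_contra h3
        exact hxI ⟨h, not_lt.1 h3⟩
      change ∫ y in (-R)..x, χ y = 0
      rw [intervalIntegral.integral_of_le h, ← integral_Icc_eq_integral_Ioc,
        setIntegral_eq_integral_of_forall_compl_eq_zero, h0]
      intro y hy
      exact hz y fun h3 => hy ⟨h3.1, h3.2.trans h2.le⟩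

/-- The du Bois-Reymond lemma. For a test function φ and a fixed bump B of integral one, φ − (∫φ)B
has mean zero and so is the derivative of a test function. The constant is therefore forced to be ∫
B k. -/
theorem ae_const_of_integral_mul_deriv_eq_zero {k : ℝ → ℂ} (hk : LocallyIntegrable k)
    (h : ∀ η : ℝ → ℝ, ContDiff ℝ ∞ η → HasCompactSupport η → ∫ x, deriv η x • k x = 0) :
    ∃ c : ℂ, k =ᵐ[volume] fun _ => c := by
  let B : ContDiffBump (0 : ℝ) := ⟨1, 2, by norm_num, by norm_num⟩
  have hBs : ContDiff ℝ ∞ (B.normed volume) := B.contDiff_normed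
  have hBc : HasCompactSupport (B.normed volume) := B.hasCompactSupport_normed
  have hBi : Integrable (B.normed volume) := B.integrable_normed
  refine ⟨∫ x, B.normed volume x • k x, ?_⟩
  set c := ∫ x, B.normed volume x • k x
  have hint : ∀ φ : ℝ → ℝ, ContDiff ℝ ∞ φ → HasCompactSupport φ →
      Integrable (fun x => φ x • k x) := fun φ hφ hφc =>
    hk.integrable_smul_left_of_hasCompactSupport hφ.continuous hφc
  have key := ae_eq_zero_of_integral_contDiff_smul_eq_zero (μ := volume)
    (f := fun x => k x - c) (hk.sub (continuous_const.locallyIntegrable)) ?_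
  · filter_upwards [key] with x hx using sub_eq_zero.1 hx
  intro φ hφ hφc
  have hφi : Integrable φ := hφ.continuous.integrable_of_hasCompactSupport hφc
  obtain ⟨η, hη, hηc, hηd⟩ := exists_primitive_hasCompactSupport
    (χ := fun x => φ x - (∫ y, φ y) * B.normed volume x)
    (hφ.sub (contDiff_const.mul hBs)) (hφc.sub hBc.mul_left) (by
      rw [integral_sub hφi (hBi.const_mul _), integral_const_mul, B.integral_normed, mul_one,
        sub_self])
  have h1 := h η hη hηc
  rw [hηd] at h1
  simp only [sub_smul, mul_smul] at h1
  rw [integral_sub (hint φ hφ hφc) (by exact (hint _ hBs hBc).smul (∫ y, φ y)),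
    integral_smul] at h1
  simp only [smul_sub]
  rw [integral_sub (hint φ hφ hφc) (hφi.smul_const c), integral_smul_const]
  exact h1

theorem ACD.integral_mul_deriv_eq {F f η : ℝ → ℝ} (h : ACD F f) (hη : ContDiff ℝ 1 η)
    (hc : HasCompactSupport η) : ∫ x, F x * deriv η x = -∫ x, f x * η x := by
  have hη' : ACD η (deriv η) :=
    ⟨fun a b => hη.contDiffOn.absolutelyContinuousOnInterval,
      ae_of_all _ fun x => (hη.differentiable one_ne_zero x).hasDerivAt⟩
  have hcd : Continuous (deriv η) := hη.continuous_deriv le_rfl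
  have i1 : Integrable (fun x => f x * η x) := by
    simpa [mul_comm] using h.locallyIntegrable.integrable_smul_left_of_hasCompactSupport hη.continuous hc
  have i2 : Integrable (fun x => F x * deriv η x) :=
    (h.continuous.mul hcd).integrable_of_hasCompactSupport hc.deriv.mul_left
  have i3 : Integrable (fun x => F x * η x) :=
    (h.continuous.mul hη.continuous).integrable_of_hasCompactSupport hc.mul_left
  have := (h.mul hη').integral_eq_zero i3 (i1.add i2)
  rw [integral_add i1 i2] at this
  linarith

/-- The Hilbert space `L²(ℝ; ℂ)`. -/
noncomputable abbrev L2 := Lp ℂ 2 (volume : Measure ℝ)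

theorem L2.locallyIntegrable (f : L2) : LocallyIntegrable f volume :=
  (Lp.memLp f).locallyIntegrable (by norm_num)

theorem L2.intervalIntegrable (f : L2) (a b : ℝ) : IntervalIntegrable f volume a b :=
  (intervalIntegrable_iff.2 ((locallyIntegrable_iff.1 (L2.locallyIntegrable f) _ isCompact_uIcc).mono_set
    Set.uIoc_subset_uIcc))

theorem L2.integrable_mul_norm (f g : L2) : Integrable (fun x => ‖f x‖ * ‖g x‖) :=
  (Lp.memLp f).norm.integrable_mul (Lp.memLp g).norm

theorem L2.integrable_norm_sq (f : L2) : Integrable (fun x => ‖f x‖ ^ 2) := by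
  simpa [sq] using L2.integrable_mul_norm f f

theorem L2.norm_sq_eq_integral (f : L2) : ‖f‖ ^ 2 = ∫ x, ‖f x‖ ^ 2 := by
  have := (L2.inner_def (𝕜 := ℝ) f f)
  rw [real_inner_self_eq_norm_sq] at this
  rw [this]
  simp

theorem L2.integral_mul_norm_le (f g : L2) : ∫ x, ‖f x‖ * ‖g x‖ ≤ ‖f‖ * ‖g‖ := by
  have h := integral_mul_norm_le_Lp_mul_Lq (μ := volume) (f := f) (g := g) (p := 2) (q := 2)
    (by constructor <;> norm_num) (by simpa using Lp.memLp f) (by simpa using Lp.memLp g)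
  refine h.trans_eq ?_
  have e : ∀ f : L2, (∫ x, ‖f x‖ ^ (2 : ℝ)) ^ (1 / (2 : ℝ)) = ‖f‖ := by
    intro f
    have : ∫ x, ‖f x‖ ^ (2 : ℝ) = ‖f‖ ^ 2 := by
      rw [L2.norm_sq_eq_integral]; norm_cast
    rw [this, ← Real.sqrt_eq_rpow, Real.sqrt_sq (norm_nonneg _)]
  rw [e f, e g]

/-- `F` is the absolutely continuous representative of `f`, with derivative `g`. -/
structure IsRep (f g : L2) (F : ℝ → ℂ) : Prop where
  ae_eq : f =ᵐ[volume] F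
  re : ACD (fun x => (F x).re) (fun x => (g x).re)
  im : ACD (fun x => (F x).im) (fun x => (g x).im)
  sub_eq : ∀ x y, F y - F x = ∫ t in x..y, g t

/-- The primitive G of g has the same weak derivative as f, so f − G is almost everywhere constant.
Real and imaginary parts are treated separately because `ACD` is a notion for real functions. -/
theorem exists_isRep {f g : L2} (h : IsWeakDeriv f g) : ∃ F, IsRep f g F := by
  have hre : ∀ a b, IntervalIntegrable (fun x => (g x).re) volume a b := fun a b =>
    ⟨(L2.intervalIntegrable g a b).1.re, (L2.intervalIntegrable g a b).2.re⟩
  have him : ∀ a b, IntervalIntegrable (fun x => (g x).im) volume a b := fun a b =>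
    ⟨(L2.intervalIntegrable g a b).1.im, (L2.intervalIntegrable g a b).2.im⟩
  have hreG : ∀ c : ℂ, ACD (fun x => (c + ∫ t in (0 : ℝ)..x, g t).re) (fun x => (g x).re) :=
    fun c => ACD.of_integral c.re hre fun x => by
      rw [Complex.add_re]
      congr 1
      exact (Complex.reCLM.intervalIntegral_comp_comm (L2.intervalIntegrable g 0 x)).symm
  have himG : ∀ c : ℂ, ACD (fun x => (c + ∫ t in (0 : ℝ)..x, g t).im) (fun x => (g x).im) :=
    fun c => ACD.of_integral c.im him fun x => by
      rw [Complex.add_im]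
      congr 1
      exact (Complex.imCLM.intervalIntegral_comp_comm (L2.intervalIntegrable g 0 x)).symm
  set G : ℝ → ℂ := fun x => ∫ t in (0 : ℝ)..x, g t with hG
  have hGc : Continuous G :=
    intervalIntegral.continuous_primitive (L2.intervalIntegrable g) 0
  obtain ⟨c, hc⟩ := ae_const_of_integral_mul_deriv_eq_zero (k := fun x => f x - G x)
    ((L2.locallyIntegrable f).sub hGc.locallyIntegrable) (by
      intro η hη hηc
      have hη1 : ContDiff ℝ 1 η := hη.of_le (by norm_cast)
      have hcd : Continuous (deriv η) := hη1.continuous_deriv le_rfl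
      have e1 := h (fun x => (η x : ℂ)) (Complex.ofRealCLM.contDiff.comp hη)
        (hηc.comp_left (g := fun x : ℝ => (x : ℂ)) Complex.ofReal_zero)
      have e2 : deriv (fun x => (η x : ℂ)) = fun x => ((deriv η x : ℝ) : ℂ) := funext fun x =>
        ((hη1.differentiable one_ne_zero x).hasDerivAt.ofReal_comp).deriv
      rw [e2] at e1
      have i1 : Integrable (fun x => deriv η x • f x) :=
        (L2.locallyIntegrable f).integrable_smul_left_of_hasCompactSupport hcd hηc.deriv
      have i2 : Integrable (fun x => deriv η x • G x) :=
        hGc.locallyIntegrable.integrable_smul_left_of_hasCompactSupport hcd hηc.deriv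
      have i3 : Integrable (fun x => η x • g x) :=
        (L2.locallyIntegrable g).integrable_smul_left_of_hasCompactSupport hη.continuous hηc
      have e3 : ∫ x, deriv η x • G x = -∫ x, η x • g x := by
        apply Complex.ext
        · have := (hreG 0).integral_mul_deriv_eq hη1 hηc
          have t1 := integral_re i2
          have t2 := integral_re i3
          simp only [RCLike.re_to_complex] at t1 t2
          rw [← t1, Complex.neg_re, ← t2]
          simpa [mul_comm] using this
        · have := (himG 0).integral_mul_deriv_eq hη1 hηc
          have t1 := integral_im i2
          have t2 := integral_im i3
          simp only [RCLike.im_to_complex] at t1 t2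
          rw [← t1, Complex.neg_im, ← t2]
          simpa [mul_comm] using this
      simp only [smul_sub]
      rw [integral_sub i1 i2, e3]
      simp only [Complex.real_smul]
      simp only [mul_comm] at e1 ⊢
      rw [e1]
      ring)
  refine ⟨fun x => c + G x, ?_, hreG c, himG c, fun x y => ?_⟩
  · filter_upwards [hc] with x hx
    rw [← hx]; ring
  · rw [add_sub_add_left_eq_sub, hG]
    exact intervalIntegral.integral_interval_sub_left (L2.intervalIntegrable g _ _)
      (L2.intervalIntegrable g _ _)

namespace IsRep

variable {f g f₁ g₁ : L2} {F F₁ : ℝ → ℂ}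

theorem continuous (h : IsRep f g F) : Continuous F := by
  have : F = fun x => ((F x).re : ℂ) + (F x).im * Complex.I := funext fun x => by simp
  rw [this]
  have h1 := h.re.continuous
  have h2 := h.im.continuous
  fun_prop

/-- Product rule for the real part of `F * conj F₁`. -/
theorem acd_inner (h : IsRep f g F) (h₁ : IsRep f₁ g₁ F₁) :
    ACD (fun x => inner ℝ (F x) (F₁ x)) (fun x => inner ℝ (g x) (F₁ x) + inner ℝ (F x) (g₁ x)) := by
  have := (h.re.mul h₁.re).add (h.im.mul h₁.im)
  convert this using 2
  · simp [Complex.inner, mul_comm]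
  · simp [Complex.inner]; ring

theorem acd_normSq (h : IsRep f g F) :
    ACD (fun x => ‖F x‖ ^ 2) (fun x => 2 * inner ℝ (g x) (F x)) := by
  convert h.acd_inner h using 2
  · rw [real_inner_self_eq_norm_sq]
  · rw [real_inner_comm (g _)]; ring

theorem integrable_normSq (h : IsRep f g F) : Integrable (fun x => ‖F x‖ ^ 2) :=
  (L2.integrable_norm_sq f).congr (by filter_upwards [h.ae_eq] with x hx; rw [hx])

theorem integrable_inner (h : IsRep f g F) (k : L2) : Integrable (fun x => inner ℝ (k x) (F x)) :=
  (L2.integrable_inner (𝕜 := ℝ) k f).congr (by filter_upwards [h.ae_eq] with x hx; rw [hx])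

/-- The one-dimensional Sobolev bound, from integrating the derivative of |F|². The constant 2 is
not optimal but suffices. -/
theorem normSq_le (h : IsRep f g F) (x : ℝ) : ‖F x‖ ^ 2 ≤ 2 * (‖f‖ * ‖g‖) := by
  have h1 := h.acd_normSq.abs_le_integral_abs h.integrable_normSq ((h.integrable_inner g).const_mul 2) x
  rw [abs_of_nonneg (by positivity)] at h1
  refine h1.trans ?_
  have h2 : ∫ y, |2 * inner ℝ (g y) (F y)| ≤ ∫ y, 2 * (‖f y‖ * ‖g y‖) := by
    refine integral_mono_ae ((h.integrable_inner g).const_mul 2).abs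
      ((L2.integrable_mul_norm f g).const_mul 2) ?_
    filter_upwards [h.ae_eq] with y hy
    rw [abs_mul, abs_two, hy, mul_comm ‖F y‖]
    exact mul_le_mul_of_nonneg_left (abs_real_inner_le_norm _ _) (by norm_num)
  rw [integral_const_mul] at h2
  linarith [L2.integral_mul_norm_le f g]

/-- Oddness almost everywhere becomes oddness everywhere for the continuous representative. This is
how the symmetry of the solution enters the proof. -/
theorem eq_zero_of_odd (h : IsRep f g F) (ho : ∀ᵐ x, f (-x) = -f x) : F 0 = 0 := by
  have h1 : (fun x => F (-x)) =ᵐ[volume] fun x => -F x := by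
    have h2 : ∀ᵐ x, f (-x) = F (-x) :=
      (Measure.measurePreserving_neg volume).quasiMeasurePreserving.ae h.ae_eq
    filter_upwards [h.ae_eq, h2, ho] with x a b c
    rw [← b, c, a]
  have h3 := (Continuous.ae_eq_iff_eq volume (h.continuous.comp continuous_neg)
    h.continuous.neg).1 h1
  have h4 := congrFun h3 0
  simp only [neg_zero, Function.comp] at h4
  simpa [self_eq_neg] using h4

/-- Cauchy–Schwarz on the interval between 0 and x. The factor |x| is what compensates the
singularity of the coefficient. -/
theorem normSq_le_abs (h : IsRep f g F) (h0 : F 0 = 0) (x : ℝ) : ‖F x‖ ^ 2 ≤ |x| * ‖g‖ ^ 2 := by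
  have h1 := h.sub_eq 0 x
  rw [h0, sub_zero] at h1
  have h2 : ‖F x‖ ≤ ∫ t in Set.uIoc 0 x, ‖g t‖ := by
    rw [h1]; exact intervalIntegral.norm_integral_le_integral_norm_uIoc
  have hfin : IsFiniteMeasure (volume.restrict (Set.uIoc 0 x)) :=
    ⟨by simp [Set.uIoc]⟩
  have h3 := integral_mul_norm_le_Lp_mul_Lq (μ := volume.restrict (Set.uIoc 0 x))
    (f := fun _ => (1 : ℂ)) (g := g) (p := 2) (q := 2)
    (by constructor <;> norm_num) (memLp_const _) (by simpa using (Lp.memLp g).restrict _)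
  have h4 : (∫ t in Set.uIoc 0 x, ‖g t‖) ^ 2 ≤ |x| * ‖g‖ ^ 2 := by
    simp only [norm_one, one_mul, Real.one_rpow, ← Real.sqrt_eq_rpow] at h3
    refine (pow_le_pow_left₀ (integral_nonneg fun _ => norm_nonneg _) h3 2).trans ?_
    rw [mul_pow, Real.sq_sqrt (by positivity),
      Real.sq_sqrt (integral_nonneg fun _ => by positivity), L2.norm_sq_eq_integral]
    have e1 : ∫ _ in Set.uIoc 0 x, (1 : ℝ) = |x| := by
      simp [Measure.real, Set.uIoc, max_sub_min_eq_abs]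
    rw [e1]
    refine mul_le_mul_of_nonneg_left ?_ (abs_nonneg _)
    norm_cast
    exact setIntegral_le_integral (L2.integrable_norm_sq g) (ae_of_all _ fun _ => by positivity)
  exact (pow_le_pow_left₀ (norm_nonneg _) h2 2).trans h4

/-- Because F vanishes at 0, |F(x)|² is an integral over the interval from 0 to x alone. Any weight
that is at least 1 on [−R, R] may be inserted, so a decaying weight still gives local uniform
control. -/
theorem normSq_le_weighted (h : IsRep f g F) (h0 : F 0 = 0) {R : ℝ} {W : ℝ → ℝ}
    (hW0 : ∀ x, 0 ≤ W x) (hW : ∀ x, |x| ≤ R → 1 ≤ W x)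
    (hi : Integrable (fun x => W x * (‖f x‖ * ‖g x‖))) {x : ℝ} (hx : |x| ≤ R) :
    ‖F x‖ ^ 2 ≤ 2 * ∫ y, W y * (‖f y‖ * ‖g y‖) := by
  have h1 := h.acd_normSq.integral_eq_sub 0 x
  rw [h0] at h1
  have h2 : ‖F x‖ ^ 2 = ∫ y in (0 : ℝ)..x, 2 * inner ℝ (g y) (F y) := by rw [h1]; simp
  rw [h2, ← integral_const_mul]
  refine (Real.le_norm_self _).trans
    (intervalIntegral.norm_integral_le_integral_norm_uIoc.trans ?_)
  refine (setIntegral_mono_on_ae ((h.integrable_inner g).const_mul 2).norm.integrableOn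
    (hi.const_mul 2).integrableOn measurableSet_uIoc ?_).trans
    (setIntegral_le_integral (hi.const_mul 2) (ae_of_all _ fun y => ?_))
  · filter_upwards [h.ae_eq] with y hy hyx
    have hyR : |y| ≤ R := by
      have := Set.abs_sub_left_of_mem_uIcc (Set.uIoc_subset_uIcc hyx)
      simp only [sub_zero] at this
      linarith
    rw [norm_mul, Real.norm_two, hy, mul_comm ‖F y‖]
    refine mul_le_mul_of_nonneg_left ((norm_inner_le_norm _ _).trans ?_) (by norm_num)
    exact le_mul_of_one_le_left (by positivity) (hW y hyR)
  · have := hW0 y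
    positivity

end IsRep

/-! ### Multipliers and multiplication by i on L². -/

/-- Bounded measurable multipliers. -/
def IsMult (m : ℝ → ℝ) : Prop := Measurable m ∧ ∃ C, ∀ x, |m x| ≤ C

theorem IsMult.memLp {m : ℝ → ℝ} (hm : IsMult m) (f : L2) :
    MemLp (fun x => m x • f x) 2 volume := by
  obtain ⟨h, C, hC⟩ := hm
  refine (Lp.memLp f).of_le_mul (c := C)
    (h.aestronglyMeasurable.smul (Lp.memLp f).aestronglyMeasurable) (ae_of_all _ fun x => ?_)
  rw [norm_smul]
  exact mul_le_mul_of_nonneg_right (hC x) (norm_nonneg _)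

open Classical in
/-- Multiplication by a bounded measurable function, as an operator on `L²` (and `0` if the
function is not bounded and measurable). -/
noncomputable def mulL (m : ℝ → ℝ) : L2 →L[ℝ] L2 :=
  if hm : IsMult m then
    LinearMap.mkContinuous
      { toFun := fun f => (hm.memLp f).toLp
        map_add' := fun f g => by
          rw [← MemLp.toLp_add]
          refine (MemLp.toLp_eq_toLp_iff _ _).2 ?_
          filter_upwards [Lp.coeFn_add f g] with x hx
          simp only [hx, Pi.add_apply, smul_add]
        map_smul' := fun c f => by
          rw [RingHom.id_apply, ← MemLp.toLp_const_smul]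
          refine (MemLp.toLp_eq_toLp_iff _ _).2 ?_
          filter_upwards [Lp.coeFn_smul c f] with x hx
          simp only [hx, Pi.smul_apply, smul_comm c] }
      hm.2.choose (fun f => by
        refine Lp.norm_le_mul_norm_of_ae_le_mul ?_
        filter_upwards [(hm.memLp f).coeFn_toLp] with x hx
        simp only [LinearMap.coe_mk, AddHom.coe_mk, hx, norm_smul]
        exact mul_le_mul_of_nonneg_right (hm.2.choose_spec x) (norm_nonneg _))
  else 0

theorem mulL_ae {m : ℝ → ℝ} (hm : IsMult m) (f : L2) : mulL m f =ᵐ[volume] fun x => m x • f x := by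
  simp only [mulL, dif_pos hm]
  exact (hm.memLp f).coeFn_toLp

theorem norm_mulL_le {m : ℝ → ℝ} (hm : IsMult m) {C : ℝ} (hC : ∀ x, |m x| ≤ C) (f : L2) :
    ‖mulL m f‖ ≤ C * ‖f‖ := by
  refine Lp.norm_le_mul_norm_of_ae_le_mul ?_
  filter_upwards [mulL_ae hm f] with x hx
  rw [hx, norm_smul]
  exact mul_le_mul_of_nonneg_right (hC x) (norm_nonneg _)

theorem inner_mulL_eq_integral {m : ℝ → ℝ} (hm : IsMult m) (f g : L2) :
    inner ℝ (mulL m f) g = ∫ x, m x * inner ℝ (f x) (g x) := by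
  rw [L2.inner_def]
  refine integral_congr_ae ?_
  filter_upwards [mulL_ae hm f] with x hx
  rw [hx, real_inner_smul_left]

theorem integrable_mul_inner {m : ℝ → ℝ} (hm : IsMult m) (f g : L2) :
    Integrable (fun x => m x * inner ℝ (f x) (g x)) := by
  refine (L2.integrable_inner (𝕜 := ℝ) (mulL m f) g).congr ?_
  filter_upwards [mulL_ae hm f] with x hx
  rw [hx, real_inner_smul_left]

theorem inner_mulL_left {m : ℝ → ℝ} (hm : IsMult m) (f g : L2) :
    inner ℝ (mulL m f) g = inner ℝ f (mulL m g) := by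
  rw [inner_mulL_eq_integral hm, real_inner_comm, inner_mulL_eq_integral hm]
  simp only [real_inner_comm]

theorem mulL_I_smul (m : ℝ → ℝ) (f : L2) : mulL m (Complex.I • f) = Complex.I • mulL m f := by
  by_cases hm : IsMult m
  · refine Lp.ext ?_
    filter_upwards [mulL_ae hm f, mulL_ae hm (Complex.I • f), Lp.coeFn_smul Complex.I f,
      Lp.coeFn_smul Complex.I (mulL m f)] with x h1 h2 h3 h4
    rw [h2, h4, h3, Pi.smul_apply, Pi.smul_apply, h1, smul_comm]
  · simp [mulL, dif_neg hm]

theorem inner_I_smul_left (f g : L2) :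
    inner ℝ (Complex.I • f) g = -inner ℝ f (Complex.I • g) := by
  rw [L2.inner_def, L2.inner_def, ← integral_neg]
  refine integral_congr_ae ?_
  filter_upwards [Lp.coeFn_smul Complex.I f, Lp.coeFn_smul Complex.I g] with x h1 h2
  rw [h1, h2]
  simp [Complex.inner]
  ring

theorem inner_I_smul_I_smul (f g : L2) :
    inner ℝ (Complex.I • f) (Complex.I • g) = inner ℝ f g := by
  rw [inner_I_smul_left, smul_smul, Complex.I_mul_I, neg_one_smul, inner_neg_right, neg_neg]

theorem inner_I_smul_self (f : L2) : inner ℝ (Complex.I • f) f = (0 : ℝ) := by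
  have h := inner_I_smul_left f f
  rw [real_inner_comm] at h
  linarith [real_inner_comm f (Complex.I • f)]

theorem inner_I_smul_mulL_self {m : ℝ → ℝ} (hm : IsMult m) (f : L2) :
    inner ℝ (Complex.I • f) (mulL m f) = (0 : ℝ) := by
  have h := inner_I_smul_left f (mulL m f)
  rw [← mulL_I_smul] at h
  linarith [inner_mulL_left hm f (Complex.I • f), real_inner_comm (mulL m f) (Complex.I • f)]

/-! ### Weak derivatives in L² and integration by parts against multipliers. -/

/-- The functional `f ↦ ∫ f η` on `L²`. -/
noncomputable def pairing (η : ℝ → ℂ) (hη : Continuous η) (hc : HasCompactSupport η) :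
    L2 →L[ℂ] ℂ :=
  innerSL ℂ ((hη.star.memLp_of_hasCompactSupport (p := 2) (μ := volume)
    (hc.comp_left (g := star) (star_zero _))).toLp)

theorem pairing_apply {η : ℝ → ℂ} (hη : Continuous η) (hc : HasCompactSupport η) (f : L2) :
    pairing η hη hc f = ∫ x, f x * η x := by
  simp only [pairing, innerSL_apply_apply, L2.inner_def]
  refine integral_congr_ae ?_
  filter_upwards [(hη.star.memLp_of_hasCompactSupport (p := 2) (μ := volume)
    (hc.comp_left (g := star) (star_zero _))).coeFn_toLp] with x hx
  rw [hx]
  simp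

/-- `g` is the weak derivative of `f`, for elements of `L²`. -/
def WD (f g : L2) : Prop := IsWeakDeriv f g

theorem wd_iff_mem (f g : L2) : WD f g ↔ WithLp.toLp 2 (f, g) ∈ H1 := Iff.rfl

theorem wd_iff {f g : L2} : WD f g ↔ ∀ (η : ℝ → ℂ) (hη : ContDiff ℝ ∞ η) (hc : HasCompactSupport η),
    pairing (deriv η) (hη.continuous_deriv (by simp)) hc.deriv f =
      -pairing η hη.continuous hc g := by
  simp only [pairing_apply]
  rfl

namespace WD

variable {f g f₁ g₁ : L2}

theorem add (h : WD f g) (h₁ : WD f₁ g₁) : WD (f + f₁) (g + g₁) :=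
  H1.add_mem ((wd_iff_mem _ _).1 h) ((wd_iff_mem _ _).1 h₁)

theorem smul (c : ℂ) (h : WD f g) : WD (c • f) (c • g) :=
  H1.smul_mem c ((wd_iff_mem _ _).1 h)

theorem sub (h : WD f g) (h₁ : WD f₁ g₁) : WD (f - f₁) (g - g₁) :=
  H1.sub_mem ((wd_iff_mem _ _).1 h) ((wd_iff_mem _ _).1 h₁)

theorem real_smul (c : ℝ) (h : WD f g) : WD (c • f) (c • g) := by
  have := h.smul (c : ℂ)
  rwa [Complex.coe_smul, Complex.coe_smul] at this

/-- A weak derivative is characterised by continuous linear functionals, and these commute with the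
integral in time. -/
theorem intervalIntegral {v w : ℝ → L2} (hv : Continuous v) (hw : Continuous w)
    (h : ∀ t, WD (v t) (w t)) (a b : ℝ) : WD (∫ t in a..b, v t) (∫ t in a..b, w t) := by
  rw [wd_iff]
  intro η hη hc
  rw [← ContinuousLinearMap.intervalIntegral_comp_comm _ (hv.intervalIntegrable _ _),
    ← ContinuousLinearMap.intervalIntegral_comp_comm _ (hw.intervalIntegrable _ _),
    ← intervalIntegral.integral_neg]
  exact intervalIntegral.integral_congr fun t _ => wd_iff.1 (h t) η hη hc

/-- Integration by parts against a bounded Lipschitz multiplier. -/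
theorem by_parts (h : WD f g) (h₁ : WD f₁ g₁) {m m' : ℝ → ℝ} (hm : IsMult m) (hm' : IsMult m')
    (hmm' : ACD m m') :
    inner ℝ (mulL m g) f₁ + inner ℝ (mulL m f) g₁ + inner ℝ (mulL m' f) f₁ = (0 : ℝ) := by
  obtain ⟨F, hF⟩ := exists_isRep h
  obtain ⟨F₁, hF₁⟩ := exists_isRep h₁
  have i1 := integrable_mul_inner hm g f₁
  have i2 := integrable_mul_inner hm f g₁
  have i3 := integrable_mul_inner hm' f f₁
  have h4 := hmm'.mul (hF.acd_inner hF₁)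
  have h5 := h4.integral_eq_zero
    ((integrable_mul_inner hm f f₁).congr (by
      filter_upwards [hF.ae_eq, hF₁.ae_eq] with x a b; rw [a, b]))
    (((i1.add i2).add i3).congr (by
      filter_upwards [hF.ae_eq, hF₁.ae_eq] with x a b
      simp only [Pi.add_apply, a, b]; ring))
  rw [inner_mulL_eq_integral hm, inner_mulL_eq_integral hm, inner_mulL_eq_integral hm',
    ← integral_add i1 i2]
  refine (integral_add (i1.add i2) i3).symm.trans (Eq.trans ?_ h5)
  refine integral_congr_ae ?_
  filter_upwards [hF.ae_eq, hF₁.ae_eq] with x a b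
  simp only [Pi.add_apply, a, b]; ring

theorem by_parts_one (h : WD f g) (h₁ : WD f₁ g₁) : inner ℝ g f₁ + inner ℝ f g₁ = (0 : ℝ) := by
  have hm : IsMult (fun _ => (1 : ℝ)) := ⟨measurable_const, 1, fun _ => by simp⟩
  have hm' : IsMult (fun _ => (0 : ℝ)) := ⟨measurable_const, 0, fun _ => by simp⟩
  have := h.by_parts h₁ hm hm' ⟨fun a b =>
    (LipschitzWith.const (1 : ℝ)).lipschitzOnWith.absolutelyContinuousOnInterval,
    ae_of_all _ fun x => hasDerivAt_const x 1⟩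
  rw [inner_mulL_eq_integral hm, inner_mulL_eq_integral hm, inner_mulL_eq_integral hm'] at this
  simpa [L2.inner_def] using this

end WD

/-! ### Balance laws for the time-integrated Schrödinger equation. -/

/-- A multiplier `ψ` with two bounded derivatives, `ψ'` and `ψ''`. -/
structure IsVirialMult (ψ ψ' ψ'' : ℝ → ℝ) : Prop where
  mult : IsMult ψ
  mult' : IsMult ψ'
  mult'' : IsMult ψ''
  acd : ACD ψ ψ'
  acd' : ACD ψ' ψ''

/-- `v` solves `i ∂ₜv + ∂ₓₓv = n`, integrated in time, with `w = ∂ₓv`. -/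
structure IsSol (v w n : ℝ → L2) : Prop where
  cv : Continuous v
  cw : Continuous w
  cn : Continuous n
  wd : ∀ t, WD (v t) (w t)
  eq : ∀ s t, WD (∫ r in s..t, w r) ((∫ r in s..t, n r) - Complex.I • (v t - v s))

/-- Integral over a sliding window of length `h`. -/
noncomputable def window (v : ℝ → L2) (h t : ℝ) : L2 := ∫ r in t..(t + h), v r

/-- Average over a sliding window of length `h`. -/
noncomputable def steklov (v : ℝ → L2) (h t : ℝ) : L2 := ∫ s in (0 : ℝ)..1, v (t + h * s)

theorem hasDerivAt_window {v : ℝ → L2} (hv : Continuous v) (h t : ℝ) :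
    HasDerivAt (window v h) (v (t + h) - v t) t := by
  have h1 : ∀ t, HasDerivAt (fun t => ∫ r in (0 : ℝ)..t, v r) (v t) t := fun t =>
    intervalIntegral.integral_hasDerivAt_right (hv.intervalIntegrable _ _)
      (hv.stronglyMeasurableAtFilter _ _) hv.continuousAt
  have h2 : window v h = fun t => (∫ r in (0 : ℝ)..(t + h), v r) - ∫ r in (0 : ℝ)..t, v r := by
    funext t
    exact (intervalIntegral.integral_interval_sub_left (hv.intervalIntegrable _ _)
      (hv.intervalIntegrable _ _)).symm
  rw [h2]
  exact ((h1 (t + h)).comp_add_const t h).sub (h1 t)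

theorem continuous_window {v : ℝ → L2} (hv : Continuous v) (h : ℝ) : Continuous (window v h) :=
  continuous_iff_continuousAt.2 fun t => (hasDerivAt_window hv h t).continuousAt

theorem steklov_eq (v : ℝ → L2) {h : ℝ} (hh : h ≠ 0) (t : ℝ) :
    steklov v h t = h⁻¹ • window v h t := by
  simp [steklov, window, intervalIntegral.integral_comp_add_mul (f := v) hh]

theorem window_eq (v : ℝ → L2) (h t : ℝ) :
    window v h t = ∫ s in (0 : ℝ)..h, v (t + s) := by
  simp [window]

theorem continuous_steklov {v : ℝ → L2} (hv : Continuous v) :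
    Continuous fun p : ℝ × ℝ => steklov v p.1 p.2 :=
  intervalIntegral.continuous_parametric_intervalIntegral_of_continuous'
    (f := fun (p : ℝ × ℝ) s => v (p.2 + p.1 * s)) (by fun_prop) 0 1

theorem steklov_zero (v : ℝ → L2) (t : ℝ) : steklov v 0 t = v t := by simp [steklov]

theorem hasDerivAt_steklov {v : ℝ → L2} (hv : Continuous v) {h : ℝ} (hh : h ≠ 0) (t : ℝ) :
    HasDerivAt (steklov v h) (h⁻¹ • (v (t + h) - v t)) t := by
  rw [show steklov v h = fun t => h⁻¹ • window v h t from funext (steklov_eq v hh)]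
  exact (hasDerivAt_window hv h t).const_smul h⁻¹

/-- Differentiation of the localized momentum `Im ∫ ψ (∂ₓv) v̄`. -/
theorem hasDerivAt_momentum {ψ ψ' ψ'' : ℝ → ℝ} (hψ : IsVirialMult ψ ψ' ψ'') {v w : ℝ → L2}
    {v' : L2} {t : ℝ} (hv : HasDerivAt v v' t) (hw : ContinuousAt w t)
    (hwd : ∀ s, WD (v s) (w s)) :
    HasDerivAt (fun s => (inner ℝ (Complex.I • v s) (mulL ψ (w s)) : ℝ))
      (2 * inner ℝ (Complex.I • v') (mulL ψ (w t)) + inner ℝ (Complex.I • v') (mulL ψ' (v t))) t := by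
  rw [hasDerivAt_iff_tendsto_slope] at hv ⊢
  have hw' : Tendsto w (𝓝[≠] t) (𝓝 (w t)) := hw.tendsto.mono_left nhdsWithin_le_nhds
  have hv0 : ContinuousAt v t := (hasDerivAt_iff_tendsto_slope.2 hv).continuousAt
  have hv' : Tendsto v (𝓝[≠] t) (𝓝 (v t)) := hv0.tendsto.mono_left nhdsWithin_le_nhds
  -- The slope is symmetrised in s and t, and integration by parts moves the difference w s − w t
  -- onto v s − v t. Thus v has to be differentiable in time, while w needs only continuity.
  have key : ∀ s, slope (fun s => (inner ℝ (Complex.I • v s) (mulL ψ (w s)) : ℝ)) t s =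
      inner ℝ (Complex.I • slope v t s) (mulL ψ (w s + w t)) +
      (1 / 2) * inner ℝ (Complex.I • slope v t s) (mulL ψ' (v s + v t)) := by
    intro s
    have h1 := (((hwd s).add (hwd t)).smul Complex.I).by_parts ((hwd s).sub (hwd t))
      hψ.mult hψ.mult' hψ.acd
    rw [slope_def_module, slope_def_module, smul_comm Complex.I, real_inner_smul_left,
      real_inner_smul_left, smul_eq_mul]
    have h2 : (inner ℝ (mulL ψ (Complex.I • (w s + w t))) (v s - v t) : ℝ) =
        -inner ℝ (Complex.I • (v s - v t)) (mulL ψ (w s + w t)) := by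
      rw [mulL_I_smul, inner_I_smul_left, real_inner_comm]
    have h3 : (inner ℝ (mulL ψ' (Complex.I • (v s + v t))) (v s - v t) : ℝ) =
        -inner ℝ (Complex.I • (v s - v t)) (mulL ψ' (v s + v t)) := by
      rw [mulL_I_smul, inner_I_smul_left, real_inner_comm]
    have h4 : (inner ℝ (mulL ψ (Complex.I • (v s + v t))) (w s - w t) : ℝ) =
        inner ℝ (Complex.I • (v s + v t)) (mulL ψ (w s - w t)) := inner_mulL_left hψ.mult _ _
    rw [h2, h3, h4] at h1
    have h5 : (inner ℝ (Complex.I • (v s + v t)) (mulL ψ (w s - w t)) : ℝ) +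
        inner ℝ (Complex.I • (v s - v t)) (mulL ψ (w s + w t)) =
        2 * (inner ℝ (Complex.I • v s) (mulL ψ (w s)) - inner ℝ (Complex.I • v t) (mulL ψ (w t))) := by
      simp only [smul_add, smul_sub, map_add, map_sub, inner_add_left, inner_add_right,
        inner_sub_left, inner_sub_right]
      ring
    linear_combination (s - t)⁻¹ / 2 * h1 - (s - t)⁻¹ / 2 * h5
  rw [show slope (fun s => (inner ℝ (Complex.I • v s) (mulL ψ (w s)) : ℝ)) t = _ from funext key]
  have e1 := (hv.const_smul Complex.I).inner (𝕜 := ℝ)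
    (((mulL ψ).continuous.tendsto _).comp (hw'.add_const (w t)))
  have e2 := (hv.const_smul Complex.I).inner (𝕜 := ℝ)
    (((mulL ψ').continuous.tendsto _).comp (hv'.add_const (v t)))
  convert e1.add (e2.const_mul (1 / 2)) using 2
  · rfl
  rw [← two_smul ℝ, ← two_smul ℝ, map_smul, map_smul, real_inner_smul_right,
    real_inner_smul_right]
  ring

namespace IsSol

variable {v w n : ℝ → L2}

/-- The equation is linear once the forcing is regarded as given, so the virial estimate also
applies to increments of a solution. -/
theorem sub_shift (H : IsSol v w n) (h : ℝ) :
    IsSol (fun t => v (t + h) - v t) (fun t => w (t + h) - w t) (fun t => n (t + h) - n t) where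
  cv := (H.cv.comp (continuous_add_const h)).sub H.cv
  cw := (H.cw.comp (continuous_add_const h)).sub H.cw
  cn := (H.cn.comp (continuous_add_const h)).sub H.cn
  wd t := (H.wd _).sub (H.wd _)
  eq s t := by
    have h1 := (H.eq (s + h) (t + h)).sub (H.eq s t)
    have hw := H.cw
    have hn := H.cn
    rw [intervalIntegral.integral_sub (Continuous.intervalIntegrable (by fun_prop) _ _)
      (Continuous.intervalIntegrable (by fun_prop) _ _),
      intervalIntegral.integral_sub (Continuous.intervalIntegrable (by fun_prop) _ _)
      (Continuous.intervalIntegrable (by fun_prop) _ _),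
      intervalIntegral.integral_comp_add_right, intervalIntegral.integral_comp_add_right]
    convert h1 using 1
    simp only [smul_sub]
    abel

theorem wd_window (H : IsSol v w n) (h t : ℝ) :
    WD (window w h t) (window n h t - Complex.I • (v (t + h) - v t)) := H.eq t (t + h)

theorem wd_steklov (H : IsSol v w n) (h t : ℝ) : WD (steklov v h t) (steklov w h t) :=
  WD.intervalIntegral (H.cv.comp (by fun_prop)) (H.cw.comp (by fun_prop)) (fun _ => H.wd _) 0 1

/-- This is the purpose of the averages: after averaging, the spatial derivative has itself a weak
derivative in L². The averaged equation therefore holds in L², with no distributional terms left. -/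
theorem wd_steklov' (H : IsSol v w n) {h : ℝ} (hh : h ≠ 0) (t : ℝ) :
    WD (steklov w h t) (steklov n h t - Complex.I • (h⁻¹ • (v (t + h) - v t))) := by
  rw [steklov_eq _ hh, steklov_eq _ hh, smul_comm Complex.I, ← smul_sub]
  exact (H.wd_window h t).real_smul _

/-- Passage from window averages to the curve itself in a balance law. -/
theorem balance_of_steklov (H : IsSol v w n) {Φ : L2 → L2 → ℝ} {Ψ : L2 → L2 → L2 → ℝ}
    (hΦ : Continuous fun p : L2 × L2 => Φ p.1 p.2)
    (hΨ : Continuous fun p : L2 × L2 × L2 => Ψ p.1 p.2.1 p.2.2)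
    (hd : ∀ h, h ≠ 0 → ∀ t, HasDerivAt (fun t => Φ (steklov v h t) (steklov w h t))
      (Ψ (steklov v h t) (steklov w h t) (steklov n h t)) t) (a b : ℝ) :
    Φ (v b) (w b) - Φ (v a) (w a) = ∫ t in a..b, Ψ (v t) (w t) (n t) := by
  have cv := continuous_steklov H.cv
  have cw := continuous_steklov H.cw
  have cn := continuous_steklov H.cn
  have c1 : Continuous fun p : ℝ × ℝ =>
      Ψ (steklov v p.1 p.2) (steklov w p.1 p.2) (steklov n p.1 p.2) :=
    hΨ.comp (cv.prodMk (cw.prodMk cn))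
  have cP : ∀ t, Continuous fun h : ℝ => Φ (steklov v h t) (steklov w h t) := fun t =>
    hΦ.comp ((cv.comp (Continuous.prodMk_left t)).prodMk (cw.comp (Continuous.prodMk_left t)))
  have cL : Continuous fun h : ℝ => Φ (steklov v h b) (steklov w h b) -
      Φ (steklov v h a) (steklov w h a) := (cP b).sub (cP a)
  have cR : Continuous fun h : ℝ => ∫ t in a..b,
      Ψ (steklov v h t) (steklov w h t) (steklov n h t) :=
    intervalIntegral.continuous_parametric_intervalIntegral_of_continuous' (by exact c1) a b
  -- Both sides of the integrated law are continuous in the averaging length h. Agreement for h ≠ 0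
  -- therefore extends to h = 0, where the average is the curve itself.
  have hdense : Dense ({0}ᶜ : Set ℝ) := dense_compl_singleton 0
  have heq := Continuous.ext_on hdense cL cR (fun h hh => by
    refine (intervalIntegral.integral_eq_sub_of_hasDerivAt (fun t _ => hd h hh t) ?_).symm
    exact (c1.comp (Continuous.prodMk_right h)).intervalIntegrable a b)
  simpa only [steklov_zero] using congrFun heq 0

/-- Virial identity. -/
theorem virial (H : IsSol v w n) {ψ ψ' ψ'' : ℝ → ℝ} (hψ : IsVirialMult ψ ψ' ψ'') (a b : ℝ) :
    (inner ℝ (Complex.I • v b) (mulL ψ (w b)) : ℝ) - inner ℝ (Complex.I • v a) (mulL ψ (w a)) =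
    ∫ t in a..b, (2 * inner ℝ (mulL ψ' (w t)) (w t) + inner ℝ (mulL ψ'' (v t)) (w t)
      + 2 * inner ℝ (n t) (mulL ψ (w t)) + inner ℝ (n t) (mulL ψ' (v t)) : ℝ) := by
  refine H.balance_of_steklov (Φ := fun v w => inner ℝ (Complex.I • v) (mulL ψ w))
    (Ψ := fun v w n => 2 * inner ℝ (mulL ψ' w) w + inner ℝ (mulL ψ'' v) w
      + 2 * inner ℝ n (mulL ψ w) + inner ℝ n (mulL ψ' v)) (by fun_prop) (by fun_prop) ?_ a b
  intro h hh t
  have h1 := hasDerivAt_momentum hψ (hasDerivAt_steklov H.cv hh t)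
    ((continuous_steklov H.cw).comp (Continuous.prodMk_right h)).continuousAt
    (fun s => H.wd_steklov h s)
  refine h1.congr_deriv ?_
  have h2 := H.wd_steklov' hh t
  have h3 := H.wd_steklov h t
  -- The time derivative is replaced by forcing minus z, where z is the second spatial derivative of
  -- the averaged solution. The two integrations by parts below remove z.
  have hI : Complex.I • (h⁻¹ • (v (t + h) - v t)) = steklov n h t -
    (steklov n h t - Complex.I • (h⁻¹ • (v (t + h) - v t))) := by abel
  generalize steklov n h t - Complex.I • (h⁻¹ • (v (t + h) - v t)) = z at *
  rw [hI]
  have b1 := h2.by_parts h2 hψ.mult hψ.mult' hψ.acd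
  have b2 := h3.by_parts h2 hψ.mult' hψ.mult'' hψ.acd'
  rw [inner_mulL_left hψ.mult, inner_mulL_left hψ.mult, real_inner_comm] at b1
  have e1 : (inner ℝ (steklov w h t) (mulL ψ z) : ℝ) = inner ℝ z (mulL ψ (steklov w h t)) := by
    rw [← inner_mulL_left hψ.mult, real_inner_comm]
  have e2 : (inner ℝ (mulL ψ' (steklov v h t)) z : ℝ) = inner ℝ z (mulL ψ' (steklov v h t)) :=
    real_inner_comm _ _
  simp only [Function.comp, inner_sub_left]
  have e3 : (inner ℝ (mulL ψ (steklov w h t)) z : ℝ) = inner ℝ z (mulL ψ (steklov w h t)) :=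
    real_inner_comm _ _
  rw [e3, e1] at b1
  rw [e2] at b2
  linear_combination -b1 - b2

/-- Localized mass balance. -/
theorem mass_balance (H : IsSol v w n) {m m' : ℝ → ℝ} (hm : IsMult m) (hm' : IsMult m')
    (hmm' : ACD m m') (a b : ℝ) :
    (inner ℝ (mulL m (v b)) (v b) : ℝ) - inner ℝ (mulL m (v a)) (v a) =
    ∫ t in a..b, (-2 * inner ℝ (mulL m' (v t)) (Complex.I • w t)
      - 2 * inner ℝ (mulL m (v t)) (Complex.I • n t) : ℝ) := by
  refine H.balance_of_steklov (Φ := fun v _ => inner ℝ (mulL m v) v)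
    (Ψ := fun v w n => -2 * inner ℝ (mulL m' v) (Complex.I • w)
      - 2 * inner ℝ (mulL m v) (Complex.I • n)) (by fun_prop) (by fun_prop) ?_ a b
  intro h hh t
  have h0 := hasDerivAt_steklov H.cv hh t
  have h1 := ((mulL m).hasFDerivAt.comp_hasDerivAt t h0).inner ℝ h0
  refine h1.congr_deriv ?_
  have h2 := (H.wd_steklov' hh t).smul Complex.I
  have h3 := H.wd_steklov h t
  have b1 := h3.by_parts h2 hm hm' hmm'
  rw [smul_sub, smul_smul, Complex.I_mul_I, neg_one_smul, sub_neg_eq_add, inner_add_right] at b1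
  generalize h⁻¹ • (v (t + h) - v t) = d at *
  have e1 : (inner ℝ (mulL m (steklov w h t)) (Complex.I • steklov w h t) : ℝ) = 0 := by
    rw [real_inner_comm, inner_I_smul_mulL_self hm]
  have e2 : (inner ℝ (mulL m d) (steklov v h t) : ℝ) = inner ℝ (mulL m (steklov v h t)) d := by
    rw [inner_mulL_left hm, real_inner_comm]
  rw [e1] at b1
  simp only [Function.comp, e2]
  linear_combination 2 * b1

/-- The equation tested against the increment of the solution. -/
theorem inner_window_add (H : IsSol v w n) (h t : ℝ) :
    (inner ℝ (window n h t) (v (t + h) - v t) : ℝ) +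
      inner ℝ (window w h t) (w (t + h) - w t) = 0 := by
  have h1 := (H.wd_window h t).by_parts_one ((H.wd (t + h)).sub (H.wd t))
  rwa [inner_sub_left, inner_I_smul_self, sub_zero] at h1

/-- Testing with i times the increment makes the term i(v(t+h) − v(t)) contribute a full square. The
windows are O(h) and the increments of v and w are o(1), so the squared L² increment is o(h). -/
theorem normSq_increment_le (H : IsSol v w n) (h t : ℝ) :
    ‖v (t + h) - v t‖ ^ 2 ≤ ‖window n h t‖ * ‖v (t + h) - v t‖ +
      ‖window w h t‖ * ‖w (t + h) - w t‖ := by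
  have h1 := (H.wd_window h t).by_parts_one (((H.wd (t + h)).sub (H.wd t)).smul Complex.I)
  rw [inner_sub_left, inner_I_smul_I_smul, real_inner_self_eq_norm_sq] at h1
  have e1 := real_inner_le_norm (window n h t) (Complex.I • (v (t + h) - v t))
  have e2 := real_inner_le_norm (window w h t) (Complex.I • (w (t + h) - w t))
  rw [norm_smul, Complex.norm_I, one_mul] at e1 e2
  linarith

/-- Momentum balance for the window integral of the derivative of the solution. -/
theorem hasDerivAt_momentum_window (H : IsSol v w n) {ψ ψ' ψ'' : ℝ → ℝ}
    (hψ : IsVirialMult ψ ψ' ψ'') (h t : ℝ) :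
    HasDerivAt (fun t => (inner ℝ (Complex.I • window w h t)
        (mulL ψ (window n h t - Complex.I • (v (t + h) - v t))) : ℝ))
      (2 * inner ℝ (mulL ψ' (v (t + h) - v t)) (v (t + h) - v t)
        + 2 * inner ℝ (Complex.I • (w (t + h) - w t)) (mulL ψ (window n h t))
        - inner ℝ (Complex.I • (v (t + h) - v t)) (mulL ψ' (window n h t))
        - inner ℝ (Complex.I • (v (t + h) - v t)) (mulL ψ'' (window w h t))) t := by
  have hn := continuous_window H.cn h
  have hv := H.cv
  -- The role of the solution is played by the window integral of w, whose spatial derivative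
  -- contains −i(v(t+h) − v(t)). Its kinetic term is thus the weighted square of the increment of v,
  -- one derivative below the usual virial identity.
  have h1 := hasDerivAt_momentum hψ (hasDerivAt_window H.cw h t)
    (w := fun t => window n h t - Complex.I • (v (t + h) - v t))
    (Continuous.continuousAt (by fun_prop)) (fun s => H.wd_window h s)
  refine h1.congr_deriv ?_
  have hd := (H.wd (t + h)).sub (H.wd t)
  have b1 := hd.by_parts hd hψ.mult hψ.mult' hψ.acd
  have b2 := (hd.smul Complex.I).by_parts (H.wd_window h t) hψ.mult' hψ.mult'' hψ.acd'
  generalize v (t + h) - v t = d at *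
  generalize w (t + h) - w t = e at *
  rw [inner_mulL_left hψ.mult' (Complex.I • e), inner_mulL_left hψ.mult' (Complex.I • d), map_sub,
    mulL_I_smul, inner_sub_right, inner_I_smul_I_smul,
    inner_mulL_left hψ.mult'' (Complex.I • d)] at b2
  rw [map_sub, mulL_I_smul, inner_sub_right, inner_I_smul_I_smul]
  rw [inner_mulL_left hψ.mult, real_inner_comm e, inner_mulL_left hψ.mult'] at b1
  rw [inner_mulL_left hψ.mult']
  linear_combination b2 - b1

end IsSol

/-! ### The virial weight and singular powers of |x|. -/

theorem ACD.of_hasDerivAt_off_zero {F f : ℝ → ℝ} (hc : Continuous F)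
    (hd : ∀ x, x ≠ 0 → HasDerivAt F (f x) x) (hi : ∀ a b, IntervalIntegrable f volume a b) :
    ACD F f :=
  ACD.of_integral (F 0) hi fun x => by
    rw [integral_eq_of_hasDerivAt_off_countable F f (Set.countable_singleton 0) hc.continuousOn
      (fun y hy => hd y hy.2) (hi 0 x)]
    ring

/-- The sign of `x`, with the value `1` at `0`. -/
noncomputable def sgn (x : ℝ) : ℝ := if x < 0 then -1 else 1

theorem measurable_sgn : Measurable sgn :=
  Measurable.ite measurableSet_Iio measurable_const measurable_const

theorem abs_sgn (x : ℝ) : |sgn x| = 1 := by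
  unfold sgn; split_ifs <;> simp

theorem sgn_mul_abs (x : ℝ) : sgn x * |x| = x := by
  unfold sgn
  split_ifs with h
  · rw [abs_of_neg h]; ring
  · rw [abs_of_nonneg (not_lt.1 h)]; ring

theorem hasDerivAt_abs_sgn {x : ℝ} (hx : x ≠ 0) : HasDerivAt (fun y : ℝ => |y|) (sgn x) x := by
  rcases lt_or_gt_of_ne hx with h | h
  · simpa [sgn, h] using hasDerivAt_abs_neg h
  · simpa [sgn, not_lt.2 h.le] using hasDerivAt_abs_pos h

/-- The virial weight `x / (1 + |x|)`. -/
noncomputable def psi (x : ℝ) : ℝ := x / (1 + |x|)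

/-- The derivative of `psi`. -/
noncomputable def psi₁ (x : ℝ) : ℝ := ((1 + |x|) ^ 2)⁻¹

/-- The second derivative of `psi`, away from the origin. -/
noncomputable def psi₂ (x : ℝ) : ℝ := -2 * sgn x * ((1 + |x|) ^ 3)⁻¹

theorem one_add_abs_pos (x : ℝ) : 0 < 1 + |x| := by positivity

theorem one_le_one_add_abs (x : ℝ) : 1 ≤ 1 + |x| := by linarith [abs_nonneg x]

theorem abs_psi_eq (x : ℝ) : |psi x| = |x| / (1 + |x|) := by
  rw [psi, abs_div, abs_of_pos (one_add_abs_pos x)]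

theorem abs_psi_le (x : ℝ) : |psi x| ≤ 1 := by
  rw [abs_psi_eq, div_le_one (one_add_abs_pos x)]
  linarith

theorem psi₁_pos (x : ℝ) : 0 < psi₁ x := by
  have := one_add_abs_pos x
  unfold psi₁; positivity

theorem psi₁_le (x : ℝ) : psi₁ x ≤ 1 := by
  unfold psi₁
  exact inv_le_one_of_one_le₀ (one_le_pow₀ (one_le_one_add_abs x))

theorem abs_psi₁_le (x : ℝ) : |psi₁ x| ≤ 1 := by
  rw [abs_of_pos (psi₁_pos x)]; exact psi₁_le x

theorem abs_psi₂_eq (x : ℝ) : |psi₂ x| = 2 * ((1 + |x|) ^ 3)⁻¹ := by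
  have := one_add_abs_pos x
  rw [psi₂, abs_mul, abs_mul, abs_sgn, abs_of_pos (inv_pos.2 (pow_pos this 3))]
  norm_num

theorem abs_psi₂_le (x : ℝ) : |psi₂ x| ≤ 2 := by
  rw [abs_psi₂_eq]
  have := inv_le_one_of_one_le₀ (one_le_pow₀ (one_le_one_add_abs x) (n := 3))
  linarith

theorem hasDerivAt_one_add_abs {x : ℝ} (hx : x ≠ 0) :
    HasDerivAt (fun y : ℝ => 1 + |y|) (sgn x) x := (hasDerivAt_abs_sgn hx).const_add 1

theorem isVirialMult_psi : IsVirialMult psi psi₁ psi₂ := by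
  have m1 : Measurable psi₁ := by unfold psi₁; fun_prop
  have m2 : Measurable psi₂ := by
    have := measurable_sgn
    unfold psi₂; fun_prop
  have hne : ∀ x : ℝ, 1 + |x| ≠ 0 := fun x => (one_add_abs_pos x).ne'
  have ii : ∀ {f : ℝ → ℝ} {C : ℝ}, Measurable f → (∀ x, |f x| ≤ C) → ∀ a b,
      IntervalIntegrable f volume a b := by
    intro f C hf hC a b
    exact (intervalIntegrable_const (c := C)).mono_fun hf.aestronglyMeasurable
      (ae_of_all _ fun x => (hC x).trans (le_abs_self C))
  refine ⟨⟨by unfold psi; fun_prop, 1, abs_psi_le⟩, ⟨m1, 1, abs_psi₁_le⟩, ⟨m2, 2, abs_psi₂_le⟩,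
    ACD.of_hasDerivAt_off_zero ?_ ?_ (ii m1 abs_psi₁_le),
    ACD.of_hasDerivAt_off_zero ?_ ?_ (ii m2 abs_psi₂_le)⟩
  · unfold psi
    exact continuous_id.div (by fun_prop) hne
  · intro x hx
    refine ((hasDerivAt_id x).div (hasDerivAt_one_add_abs hx) (hne x)).congr_deriv ?_
    have := sgn_mul_abs x
    have h2 : x * sgn x = |x| := by
      have h3 : sgn x * sgn x = 1 := by rw [← abs_mul_abs_self, abs_sgn, one_mul]
      nth_rw 1 [← this]
      linear_combination |x| * h3
    rw [psi₁, id, h2]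
    field_simp
    ring
  · unfold psi₁
    exact Continuous.inv₀ (by fun_prop) fun x => pow_ne_zero 2 (hne x)
  · intro x hx
    refine (((hasDerivAt_one_add_abs hx).pow 2).inv (pow_ne_zero 2 (hne x))).congr_deriv ?_
    have := hne x
    rw [psi₂]
    simp only [Pi.pow_apply]
    field_simp
    norm_num
    ring

theorem integrableOn_abs_rpow {s : ℝ} (hs : -1 < s) :
    IntegrableOn (fun x : ℝ => |x| ^ s) (Set.Icc (-1) 1) := by
  have h1 : IntervalIntegrable (fun x : ℝ => |x| ^ s) volume 0 1 := by
    refine (intervalIntegral.intervalIntegrable_rpow' (a := 0) (b := 1) hs).congr ?_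
    intro x hx
    rw [Set.uIoc_of_le zero_le_one] at hx
    simp only [abs_of_pos hx.1]
  have h2 : IntervalIntegrable (fun x : ℝ => |x| ^ s) volume (-1) 0 := by
    rw [IntervalIntegrable.iff_comp_neg]
    simpa using h1.symm
  exact (intervalIntegrable_iff_integrableOn_Icc_of_le (by norm_num)).1 (h2.trans h1)

/-- `|x| ^ s` near the origin, `0` elsewhere. -/
noncomputable def nearPow (s : ℝ) : ℝ → ℝ := (Set.Icc (-1) 1).indicator fun x => |x| ^ s

theorem integrable_nearPow {s : ℝ} (hs : -1 < s) : Integrable (nearPow s) :=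
  (integrableOn_abs_rpow hs).integrable_indicator measurableSet_Icc

theorem nearPow_nonneg (s x : ℝ) : 0 ≤ nearPow s x :=
  Set.indicator_nonneg (fun _ _ => by positivity) x

theorem nearPow_of_abs_le {s x : ℝ} (hx : |x| ≤ 1) : nearPow s x = |x| ^ s :=
  Set.indicator_of_mem (show x ∈ Set.Icc (-1 : ℝ) 1 from abs_le.1 hx) _

theorem abs_rpow_neg_le_nearPow_add {b : ℝ} (hb : 0 < b) (x : ℝ) :
    |x| ^ (-b) ≤ nearPow (-b) x + 1 := by
  rcases le_or_gt |x| 1 with h | h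
  · rw [nearPow_of_abs_le h]; linarith
  · have := Real.rpow_le_one_of_one_le_of_nonpos h.le (neg_nonpos.2 hb.le)
    linarith [nearPow_nonneg (-b) x]

theorem psi₁_le_inv_one_add_sq (x : ℝ) : psi₁ x ≤ (1 + x ^ 2)⁻¹ := by
  unfold psi₁
  refine inv_anti₀ (by positivity) ?_
  nlinarith [abs_nonneg x, sq_abs x]

theorem integrable_abs_rpow_mul_psi₁ {b : ℝ} (hb0 : 0 < b) (hb1 : b < 1) :
    Integrable (fun x : ℝ => |x| ^ (-b) * psi₁ x) := by
  have m1 : Measurable psi₁ := isVirialMult_psi.mult'.1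
  refine ((integrable_nearPow (s := -b) (by linarith)).add integrable_inv_one_add_sq).mono'
    (by fun_prop) (ae_of_all _ fun x => ?_)
  have h0 : 0 ≤ |x| ^ (-b) := by positivity
  rw [Real.norm_of_nonneg (mul_nonneg h0 (psi₁_pos x).le)]
  have h1 := abs_rpow_neg_le_nearPow_add hb0 x
  have h2 := psi₁_le_inv_one_add_sq x
  have h3 := nearPow_nonneg (-b) x
  calc |x| ^ (-b) * psi₁ x ≤ (nearPow (-b) x + 1) * psi₁ x :=
        mul_le_mul_of_nonneg_right h1 (psi₁_pos x).le
    _ ≤ nearPow (-b) x * 1 + 1 * (1 + x ^ 2)⁻¹ := by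
        rw [add_mul]
        exact add_le_add (mul_le_mul_of_nonneg_left (psi₁_le x) h3)
          (mul_le_mul_of_nonneg_left h2 zero_le_one)
    _ = _ := by simp

/-- The weight vanishes linearly at the origin and absorbs the singularity there. Away from the
origin both factors are at most 1. -/
theorem abs_psi_mul_abs_rpow_le {b : ℝ} (hb0 : 0 < b) (hb1 : b < 1) (x : ℝ) :
    |psi x| * |x| ^ (-b) ≤ 1 := by
  rcases eq_or_ne x 0 with rfl | hx
  · simp [psi]
  have hx' : 0 < |x| := abs_pos.2 hx
  rw [abs_psi_eq, div_mul_eq_mul_div, div_le_one (one_add_abs_pos x)]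
  have h1 : |x| * |x| ^ (-b) = |x| ^ (1 - b) := by
    rw [sub_eq_add_neg, Real.rpow_add hx', Real.rpow_one]
  rw [h1]
  rcases le_or_gt |x| 1 with h | h
  · have := Real.rpow_le_one hx'.le h (sub_nonneg.2 hb1.le); linarith
  · have := Real.rpow_le_rpow_of_exponent_le h.le (show 1 - b ≤ 1 by linarith)
    rw [Real.rpow_one] at this; linarith

/-! ### Pointwise inequalities for the power nonlinearity. -/

/-- Young's inequality with exponents a+1 and (a+1)/a, cleared of denominators. It yields both the
Lipschitz bound and the convexity inequality for powers. -/
theorem rpow_mul_le_young {a r s : ℝ} (ha : 0 < a) (hr : 0 ≤ r) (hs : 0 ≤ s) :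
    (a + 1) * (r ^ a * s) ≤ a * (r ^ a * r) + s ^ a * s := by
  have hp : (a + 1).HolderConjugate ((a + 1) / a) := by
    rw [Real.holderConjugate_iff]
    refine ⟨by linarith, ?_⟩
    field_simp
    ring
  have h := Real.young_inequality_of_nonneg hs (Real.rpow_nonneg hr a) hp
  rw [← Real.rpow_mul hr, mul_div_cancel₀ _ ha.ne', Real.rpow_add_one' hs (by linarith),
    Real.rpow_add_one' hr (by linarith)] at h
  have ha1 : 0 < a + 1 := by linarith
  have h2 := mul_le_mul_of_nonneg_left h ha1.le
  have h3 : (a + 1) * (s ^ a * s / (a + 1) + r ^ a * r / ((a + 1) / a)) =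
      s ^ a * s + a * (r ^ a * r) := by field_simp
  linarith [mul_comm (r ^ a) s]

/-- The power nonlinearity `z ↦ |z| ^ a z`. -/
noncomputable def pw (a : ℝ) (z : ℂ) : ℂ := ‖z‖ ^ a • z

theorem norm_pw {a : ℝ} (z : ℂ) : ‖pw a z‖ = ‖z‖ ^ a * ‖z‖ := by
  rw [pw, norm_smul, Real.norm_of_nonneg (by positivity)]

theorem inner_pw_self {a : ℝ} (z : ℂ) : inner ℝ (pw a z) z = ‖z‖ ^ a * ‖z‖ ^ 2 := by
  rw [pw, real_inner_smul_left, real_inner_self_eq_norm_sq]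

theorem norm_pw_sub_le {a R : ℝ} (ha : 0 < a) {z w : ℂ} (hz : ‖z‖ ≤ R) (hw : ‖w‖ ≤ R) :
    ‖pw a z - pw a w‖ ≤ (a + 1) * R ^ a * ‖z - w‖ := by
  wlog h : ‖w‖ ≤ ‖z‖ generalizing z w
  · rw [norm_sub_rev, norm_sub_rev z]
    exact this hw hz (not_le.1 h).le
  have h1 : pw a z - pw a w = ‖z‖ ^ a • (z - w) + (‖z‖ ^ a - ‖w‖ ^ a) • w := by
    simp only [pw, smul_sub, sub_smul]; abel
  have h2 : 0 ≤ ‖z‖ ^ a - ‖w‖ ^ a :=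
    sub_nonneg.2 (Real.rpow_le_rpow (norm_nonneg _) h ha.le)
  have h3 := rpow_mul_le_young ha (norm_nonneg z) (norm_nonneg w)
  have h4 := norm_sub_norm_le z w
  have hza : ‖z‖ ^ a ≤ R ^ a := Real.rpow_le_rpow (norm_nonneg _) hz ha.le
  have hza0 : 0 ≤ ‖z‖ ^ a := by positivity
  rw [h1]
  refine (norm_add_le _ _).trans ?_
  rw [norm_smul, norm_smul, Real.norm_of_nonneg hza0, Real.norm_of_nonneg h2]
  have h5 : (‖z‖ ^ a - ‖w‖ ^ a) * ‖w‖ ≤ a * (‖z‖ ^ a * (‖z‖ - ‖w‖)) := by linarith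
  have h6 : a * (‖z‖ ^ a * (‖z‖ - ‖w‖)) ≤ a * (‖z‖ ^ a * ‖z - w‖) := by gcongr
  have h7 : (a + 1) * (‖z‖ ^ a * ‖z - w‖) ≤ (a + 1) * (R ^ a * ‖z - w‖) := by gcongr
  linarith

/-- Convexity of z ↦ |z|^{a+2}, whose gradient is (a+2)|z|^a z. -/
theorem pw_tangent_le {a : ℝ} (ha : 0 < a) (z w : ℂ) :
    (a + 2) * inner ℝ (pw a w) (z - w) ≤ ‖z‖ ^ a * ‖z‖ ^ 2 - ‖w‖ ^ a * ‖w‖ ^ 2 := by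
  have h1 := rpow_mul_le_young (a := a + 1) (by linarith) (norm_nonneg w) (norm_nonneg z)
  rw [Real.rpow_add_one' (norm_nonneg _) (by linarith),
    Real.rpow_add_one' (norm_nonneg _) (by linarith)] at h1
  have h2 : inner ℝ (pw a w) z ≤ ‖w‖ ^ a * ‖w‖ * ‖z‖ :=
    (real_inner_le_norm _ _).trans_eq (by rw [norm_pw])
  rw [inner_sub_right, inner_pw_self]
  have h3 := mul_le_mul_of_nonneg_left h2 (show 0 ≤ a + 2 by linarith)
  linarith

/-- Put A = Re⟨|z|^a z, z−w⟩, B = Re⟨|w|^a w, z−w⟩ and D = |z|^{a+2} − |w|^{a+2}. Convexity gives B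
≤ D/(a+2) ≤ A, so A + B differs from 2D/(a+2) by at most A − B, which the Lipschitz bound makes
quadratic in z − w. No second derivative of the power is used, so every a > 0 is allowed. -/
theorem abs_trapezoid_le {a R : ℝ} (ha : 0 < a) {z w : ℂ} (hz : ‖z‖ ≤ R) (hw : ‖w‖ ≤ R) :
    |inner ℝ (pw a z + pw a w) (z - w) -
      2 / (a + 2) * (inner ℝ (pw a z) z - inner ℝ (pw a w) w)| ≤
      (a + 1) * R ^ a * ‖z - w‖ ^ 2 := by
  have h1 := pw_tangent_le ha z w
  have h2 := pw_tangent_le ha w z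
  have h3 : inner ℝ (pw a z - pw a w) (z - w) ≤ (a + 1) * R ^ a * ‖z - w‖ ^ 2 := by
    refine (real_inner_le_norm _ _).trans ?_
    rw [sq, ← mul_assoc]
    exact mul_le_mul_of_nonneg_right (norm_pw_sub_le ha hz hw) (norm_nonneg _)
  rw [inner_sub_left] at h3
  rw [← neg_sub z w, inner_neg_right] at h2
  rw [inner_pw_self, inner_pw_self, inner_add_left]
  have ha2 : 0 < a + 2 := by linarith
  set A := (inner ℝ (pw a z) (z - w) : ℝ)
  set B := (inner ℝ (pw a w) (z - w) : ℝ)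
  set D := ‖z‖ ^ a * ‖z‖ ^ 2 - ‖w‖ ^ a * ‖w‖ ^ 2 with hD
  have h4 : B ≤ D / (a + 2) := by rw [le_div_iff₀ ha2]; linarith
  have h5 : D / (a + 2) ≤ A := by rw [div_le_iff₀ ha2]; linarith
  rw [div_mul_eq_mul_div, mul_div_assoc, abs_le]
  constructor <;> linarith

/-! ### The nonlinearity on odd H¹ functions. -/

/-- Bounds on the coefficient, common to both parts of the theorem. -/
structure CoeffBound (b C : ℝ) (K : ℝ → ℝ) : Prop where
  b_pos : 0 < b
  b_lt : b < 1
  C_nonneg : 0 ≤ C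
  contDiffOn : ContDiffOn ℝ 1 K {0}ᶜ
  bound : ∀ x, x ≠ 0 → |K x| ≤ C * |x| ^ (-b)
  bound' : ∀ x, x ≠ 0 → |deriv K x| ≤ C * |x| ^ (-b - 1)

theorem ae_ne_zero : ∀ᵐ x : ℝ, x ≠ 0 := by
  rw [ae_iff]; simp

theorem CoeffBound.aestronglyMeasurable {b C : ℝ} {K : ℝ → ℝ} (hK : CoeffBound b C K) :
    AEStronglyMeasurable K volume := by
  have h := hK.contDiffOn.continuousOn.aestronglyMeasurable (μ := volume)
    (measurableSet_singleton (0 : ℝ)).compl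
  rwa [Measure.restrict_eq_self_of_ae_mem (by filter_upwards [ae_ne_zero] with x hx using hx)] at h

/-- `f` is odd and in `H¹`, with weak derivative `g`. -/
structure OddH1 (f g : L2) : Prop where
  wd : WD f g
  odd : ∀ᵐ x, f (-x) = -f x

theorem OddH1.sub {f g f₁ g₁ : L2} (h : OddH1 f g) (h₁ : OddH1 f₁ g₁) :
    OddH1 (f - f₁) (g - g₁) where
  wd := h.wd.sub h₁.wd
  odd := by
    have h2 := (Measure.measurePreserving_neg (volume : Measure ℝ)).quasiMeasurePreserving.ae
      (Lp.coeFn_sub f f₁)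
    filter_upwards [h.odd, h₁.odd, h2, Lp.coeFn_sub f f₁] with x a b c d
    rw [c, d, Pi.sub_apply, Pi.sub_apply, a, b]
    ring

theorem OddH1.exists_rep {f g : L2} (h : OddH1 f g) : ∃ F, IsRep f g F ∧ F 0 = 0 := by
  obtain ⟨F, hF⟩ := exists_isRep h.wd
  exact ⟨F, hF, hF.eq_zero_of_odd h.odd⟩

theorem OddH1.ae_norm_le {f g : L2} (h : OddH1 f g) {R : ℝ} (hf : ‖f‖ ≤ R) (hg : ‖g‖ ≤ R) :
    ∀ᵐ x, ‖f x‖ ≤ 2 * R := by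
  obtain ⟨F, hF, -⟩ := h.exists_rep
  have hR : 0 ≤ R := (norm_nonneg _).trans hf
  filter_upwards [hF.ae_eq] with x hx
  rw [hx]
  have h1 := hF.normSq_le x
  have h2 : ‖f‖ * ‖g‖ ≤ R * R := mul_le_mul hf hg (norm_nonneg _) hR
  nlinarith [norm_nonneg (F x)]

/-- The singular weight is bounded from odd `H¹` functions to `L²`. -/
theorem OddH1.ae_weight_le {f g : L2} (h : OddH1 f g) {b : ℝ} (hb : 0 < b) :
    ∀ᵐ x, (|x| ^ (-b) * ‖f x‖) ^ 2 ≤ nearPow (1 - 2 * b) x * ‖g‖ ^ 2 + ‖f x‖ ^ 2 := by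
  obtain ⟨F, hF, h0⟩ := h.exists_rep
  filter_upwards [hF.ae_eq, ae_ne_zero] with x hx hne
  have hx0 : 0 < |x| := abs_pos.2 hne
  rw [hx, mul_pow]
  have h2 : (|x| ^ (-b)) ^ 2 = |x| ^ (-2 * b) := by
    rw [← Real.rpow_natCast, ← Real.rpow_mul hx0.le]; congr 1; push_cast; ring
  -- Near the origin the bound |F|² ≤ |x|‖g‖² leaves the power 1 − 2b, which exceeds −1 exactly when
  -- b < 1. Far away the weight is at most 1.
  rcases le_or_gt |x| 1 with h1 | h1
  · rw [nearPow_of_abs_le h1, h2]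
    have h3 := hF.normSq_le_abs h0 x
    have h4 : |x| ^ (1 - 2 * b) = |x| ^ (-2 * b) * |x| := by
      rw [← Real.rpow_add_one hx0.ne']; congr 1; ring
    rw [h4, mul_assoc]
    have := mul_le_mul_of_nonneg_left h3 (show 0 ≤ |x| ^ (-2 * b) by positivity)
    nlinarith [sq_nonneg ‖F x‖]
  · have h3 : |x| ^ (-b) ≤ 1 := Real.rpow_le_one_of_one_le_of_nonpos h1.le (neg_nonpos.2 hb.le)
    have h4 : (|x| ^ (-b)) ^ 2 ≤ 1 := pow_le_one₀ (by positivity) h3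
    have h5 := mul_nonneg (nearPow_nonneg (1 - 2 * b) x) (sq_nonneg ‖g‖)
    nlinarith [sq_nonneg ‖F x‖]

theorem OddH1.memLp_weight {f g : L2} (h : OddH1 f g) {b : ℝ} (hb0 : 0 < b) (hb1 : b < 1) :
    MemLp (fun x => |x| ^ (-b) * ‖f x‖) 2 volume := by
  have hm : AEStronglyMeasurable (fun x => |x| ^ (-b) * ‖f x‖) volume :=
    (by fun_prop : Measurable fun x : ℝ => |x| ^ (-b)).aestronglyMeasurable.mul
      (Lp.aestronglyMeasurable f).norm
  rw [memLp_two_iff_integrable_sq hm]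
  refine (((integrable_nearPow (s := 1 - 2 * b) (by linarith)).mul_const (‖g‖ ^ 2)).add
    (L2.integrable_norm_sq f)).mono' (hm.pow 2) ?_
  filter_upwards [h.ae_weight_le hb0] with x hx
  rw [Real.norm_of_nonneg (sq_nonneg _)]
  exact hx

theorem OddH1.integral_weight_le {f g : L2} (h : OddH1 f g) {b : ℝ} (hb0 : 0 < b) (hb1 : b < 1) :
    ∫ x, (|x| ^ (-b) * ‖f x‖) ^ 2 ≤ (∫ x, nearPow (1 - 2 * b) x) * ‖g‖ ^ 2 + ‖f‖ ^ 2 := by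
  have i1 := (integrable_nearPow (s := 1 - 2 * b) (by linarith)).mul_const (‖g‖ ^ 2)
  have i2 := L2.integrable_norm_sq f
  rw [L2.norm_sq_eq_integral f, ← integral_mul_const, ← integral_add i1 i2]
  exact integral_mono_ae (h.memLp_weight hb0 hb1).integrable_sq (i1.add i2) (h.ae_weight_le hb0)

open Classical in
/-- The nonlinearity `K |f| ^ a f`, as an element of `L²`. -/
noncomputable def nl (a : ℝ) (K : ℝ → ℝ) (f : L2) : L2 :=
  if h : MemLp (fun x => K x • pw a (f x)) 2 volume then h.toLp else 0

section

variable {a b C : ℝ} {K : ℝ → ℝ} {f g f₁ g₁ : L2}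

theorem continuous_pw (ha : 0 < a) : Continuous (pw a) := by
  unfold pw
  exact (continuous_norm.rpow_const fun _ => Or.inr ha.le).smul continuous_id

theorem memLp_nl (ha : 0 < a) (hK : CoeffBound b C K) (h : OddH1 f g) :
    MemLp (fun x => K x • pw a (f x)) 2 volume := by
  set R := max ‖f‖ ‖g‖
  refine (h.memLp_weight hK.b_pos hK.b_lt).of_le_mul (c := C * (2 * R) ^ a)
    (hK.aestronglyMeasurable.smul
      ((continuous_pw ha).comp_aestronglyMeasurable (Lp.aestronglyMeasurable f))) ?_
  filter_upwards [h.ae_norm_le (le_max_left _ _) (le_max_right _ _), ae_ne_zero] with x hx hne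
  rw [norm_smul, norm_pw, Real.norm_eq_abs, Real.norm_of_nonneg (by positivity)]
  have h1 := hK.bound x hne
  have h2 : ‖f x‖ ^ a ≤ (2 * R) ^ a := Real.rpow_le_rpow (norm_nonneg _) hx ha.le
  have hC := hK.C_nonneg
  calc |K x| * (‖f x‖ ^ a * ‖f x‖) ≤ (C * |x| ^ (-b)) * ((2 * R) ^ a * ‖f x‖) := by gcongr
    _ = _ := by ring

theorem nl_ae (ha : 0 < a) (hK : CoeffBound b C K) (h : OddH1 f g) :
    nl a K f =ᵐ[volume] fun x => K x • pw a (f x) := by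
  rw [nl, dif_pos (memLp_nl ha hK h)]
  exact MemLp.coeFn_toLp _

theorem nl_sub_ae_le (ha : 0 < a) (hK : CoeffBound b C K) (h : OddH1 f g) (h₁ : OddH1 f₁ g₁)
    {R : ℝ} (hf : ‖f‖ ≤ R) (hg : ‖g‖ ≤ R) (hf₁ : ‖f₁‖ ≤ R) (hg₁ : ‖g₁‖ ≤ R) :
    ∀ᵐ x, ‖(nl a K f - nl a K f₁) x‖ ≤
      C * ((a + 1) * (2 * R) ^ a) * (|x| ^ (-b) * ‖(f - f₁) x‖) := by
  filter_upwards [nl_ae ha hK h, nl_ae ha hK h₁, Lp.coeFn_sub (nl a K f) (nl a K f₁),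
    Lp.coeFn_sub f f₁, h.ae_norm_le hf hg, h₁.ae_norm_le hf₁ hg₁, ae_ne_zero]
    with x e1 e2 e3 e4 e5 e6 hne
  rw [e3, e4, Pi.sub_apply, Pi.sub_apply, e1, e2, ← smul_sub, norm_smul, Real.norm_eq_abs]
  have h1 := hK.bound x hne
  have h2 := norm_pw_sub_le ha e5 e6
  have hC := hK.C_nonneg
  calc |K x| * ‖pw a (f x) - pw a (f₁ x)‖ ≤
      (C * |x| ^ (-b)) * ((a + 1) * (2 * R) ^ a * ‖f x - f₁ x‖) := by gcongr
    _ = _ := by ring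

theorem norm_nl_sub_sq_le (ha : 0 < a) (hK : CoeffBound b C K) (h : OddH1 f g) (h₁ : OddH1 f₁ g₁)
    {R : ℝ} (hf : ‖f‖ ≤ R) (hg : ‖g‖ ≤ R) (hf₁ : ‖f₁‖ ≤ R) (hg₁ : ‖g₁‖ ≤ R) :
    ‖nl a K f - nl a K f₁‖ ^ 2 ≤ (C * ((a + 1) * (2 * R) ^ a)) ^ 2 *
      ((∫ x, nearPow (1 - 2 * b) x) * ‖g - g₁‖ ^ 2 + ‖f - f₁‖ ^ 2) := by
  have hs := h.sub h₁
  rw [L2.norm_sq_eq_integral]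
  refine le_trans ?_ (mul_le_mul_of_nonneg_left (hs.integral_weight_le hK.b_pos hK.b_lt)
    (sq_nonneg _))
  rw [← integral_const_mul]
  refine integral_mono_ae (L2.integrable_norm_sq _)
    ((hs.memLp_weight hK.b_pos hK.b_lt).integrable_sq.const_mul _) ?_
  filter_upwards [nl_sub_ae_le ha hK h h₁ hf hg hf₁ hg₁] with x hx
  rw [← mul_pow]
  exact pow_le_pow_left₀ (norm_nonneg _) hx 2

/-- Multiplication by `psi` cancels |x|^{-b}, so the increment of the nonlinearity is controlled by
the L² increment alone. The gradient increment, which is only o(1) in the time step, does not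
appear, in contrast with `norm_nl_sub_sq_le`. -/
theorem norm_mulL_psi_nl_sub_le (ha : 0 < a) (hK : CoeffBound b C K) (h : OddH1 f g)
    (h₁ : OddH1 f₁ g₁)
    {R : ℝ} (hf : ‖f‖ ≤ R) (hg : ‖g‖ ≤ R) (hf₁ : ‖f₁‖ ≤ R) (hg₁ : ‖g₁‖ ≤ R) :
    ‖mulL psi (nl a K f - nl a K f₁)‖ ≤ C * ((a + 1) * (2 * R) ^ a) * ‖f - f₁‖ := by
  refine Lp.norm_le_mul_norm_of_ae_le_mul ?_
  filter_upwards [nl_sub_ae_le ha hK h h₁ hf hg hf₁ hg₁, mulL_ae isVirialMult_psi.mult _]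
    with x hx e1
  rw [e1, norm_smul, Real.norm_eq_abs]
  have hC := hK.C_nonneg
  have hR : 0 ≤ R := (norm_nonneg _).trans hf
  calc |psi x| * ‖(nl a K f - nl a K f₁) x‖
      ≤ |psi x| * (C * ((a + 1) * (2 * R) ^ a) * (|x| ^ (-b) * ‖(f - f₁) x‖)) := by gcongr
    _ = C * ((a + 1) * (2 * R) ^ a) * ((|psi x| * |x| ^ (-b)) * ‖(f - f₁) x‖) := by ring
    _ ≤ C * ((a + 1) * (2 * R) ^ a) * (1 * ‖(f - f₁) x‖) := by
        gcongr; exact abs_psi_mul_abs_rpow_le hK.b_pos hK.b_lt x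
    _ = _ := by ring

/-- The derivative of the weight does not vanish at 0, but here |x|^{-b} occurs only once and is
integrable against `psi₁`. The two factors f − f₁ are taken in supremum norm, which produces the
product of the L² norms of f − f₁ and g − g₁. -/
theorem abs_inner_nl_sub_psi₁_le (ha : 0 < a) (hK : CoeffBound b C K) (h : OddH1 f g)
    (h₁ : OddH1 f₁ g₁)
    {R : ℝ} (hf : ‖f‖ ≤ R) (hg : ‖g‖ ≤ R) (hf₁ : ‖f₁‖ ≤ R) (hg₁ : ‖g₁‖ ≤ R) :
    |inner ℝ (nl a K f - nl a K f₁) (mulL psi₁ (f - f₁))| ≤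
      C * ((a + 1) * (2 * R) ^ a) * (∫ x, |x| ^ (-b) * psi₁ x) *
        (2 * (‖f - f₁‖ * ‖g - g₁‖)) := by
  have hs := h.sub h₁
  obtain ⟨F, hF, -⟩ := hs.exists_rep
  have hC := hK.C_nonneg
  have hR : 0 ≤ R := (norm_nonneg _).trans hf
  rw [mul_assoc, ← integral_mul_const, ← integral_const_mul, L2.inner_def]
  refine (norm_integral_le_integral_norm _).trans (integral_mono_ae
    (L2.integrable_inner (𝕜 := ℝ) _ _).norm
    (((integrable_abs_rpow_mul_psi₁ hK.b_pos hK.b_lt).mul_const _).const_mul _) ?_)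
  filter_upwards [nl_sub_ae_le ha hK h h₁ hf hg hf₁ hg₁, mulL_ae isVirialMult_psi.mult' (f - f₁),
    hF.ae_eq] with x hx e1 e2
  have h3 := hF.normSq_le x
  have hp := (psi₁_pos x).le
  rw [e1]
  refine (norm_inner_le_norm _ _).trans ?_
  rw [norm_smul, Real.norm_of_nonneg hp]
  calc ‖(nl a K f - nl a K f₁) x‖ * (psi₁ x * ‖(f - f₁) x‖)
      ≤ (C * ((a + 1) * (2 * R) ^ a) * (|x| ^ (-b) * ‖(f - f₁) x‖)) *
        (psi₁ x * ‖(f - f₁) x‖) := by gcongr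
    _ = C * ((a + 1) * (2 * R) ^ a) * (|x| ^ (-b) * psi₁ x * ‖F x‖ ^ 2) := by rw [e2]; ring
    _ ≤ _ := by gcongr

/-- Local control of an odd `H¹` function by weighted `L²` norms. -/
theorem OddH1.ae_normSq_le_local (h : OddH1 f g) {l : ℝ} (hl : 0 < l) :
    ∀ᵐ x, |x| ≤ 1 → ‖f x‖ ^ 2 ≤
      4 * (l⁻¹ * inner ℝ (mulL psi₁ f) f + l * inner ℝ (mulL psi₁ g) g) := by
  obtain ⟨F, hF, h0⟩ := h.exists_rep
  have hm := isVirialMult_psi.mult'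
  have i1 := integrable_mul_inner hm f f
  have i2 := integrable_mul_inner hm g g
  simp only [real_inner_self_eq_norm_sq] at i1 i2
  have hpt : ∀ x, 4 * psi₁ x * (‖f x‖ * ‖g x‖) ≤
      2 * (l⁻¹ * (psi₁ x * ‖f x‖ ^ 2) + l * (psi₁ x * ‖g x‖ ^ 2)) := by
    intro x
    have h1 : 2 * (‖f x‖ * ‖g x‖) ≤ l⁻¹ * ‖f x‖ ^ 2 + l * ‖g x‖ ^ 2 := by
      have h2 := mul_nonneg (inv_pos.2 hl).le (sq_nonneg (‖f x‖ - l * ‖g x‖))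
      have h3 : l⁻¹ * (‖f x‖ - l * ‖g x‖) ^ 2 =
          l⁻¹ * ‖f x‖ ^ 2 + l * ‖g x‖ ^ 2 - 2 * (‖f x‖ * ‖g x‖) := by
        field_simp; ring
      linarith
    have := mul_le_mul_of_nonneg_left h1 (psi₁_pos x).le
    linarith
  have i3 : Integrable fun x => 2 * (l⁻¹ * (psi₁ x * ‖f x‖ ^ 2) + l * (psi₁ x * ‖g x‖ ^ 2)) :=
    ((i1.const_mul _).add (i2.const_mul _)).const_mul 2
  have i4 : Integrable fun x => 4 * psi₁ x * (‖f x‖ * ‖g x‖) := by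
    refine i3.mono' ((hm.1.const_mul 4).aestronglyMeasurable.mul
      (L2.integrable_mul_norm f g).aestronglyMeasurable) (ae_of_all _ fun x => ?_)
    have := psi₁_pos x
    rw [Real.norm_of_nonneg (by positivity)]
    exact hpt x
  filter_upwards [hF.ae_eq] with x hx hx1
  rw [hx]
  -- The factor 4 makes the weight at least 1 on |x| ≤ 1, where (1+|x|)² ≤ 4.
  refine (hF.normSq_le_weighted h0 (W := fun x => 4 * psi₁ x) (R := 1)
    (fun x => by have := psi₁_pos x; positivity) ?_ i4 hx1).trans ?_
  · intro y hy
    rw [psi₁, ← div_eq_mul_inv, le_div_iff₀ (by positivity)]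
    nlinarith [abs_nonneg y]
  · have h5 := integral_mono i4 i3 hpt
    rw [integral_const_mul, integral_add (i1.const_mul _) (i2.const_mul _), integral_const_mul,
      integral_const_mul] at h5
    rw [inner_mulL_eq_integral hm, inner_mulL_eq_integral hm]
    simp only [real_inner_self_eq_norm_sq]
    linarith

/-- Trapezoidal rule for the potential energy along an increment. -/
theorem abs_trapezoid_nl_le (ha : 0 < a) (hK : CoeffBound b C K) (h : OddH1 f g)
    (h₁ : OddH1 f₁ g₁)
    {R : ℝ} (hf : ‖f‖ ≤ R) (hg : ‖g‖ ≤ R) (hf₁ : ‖f₁‖ ≤ R) (hg₁ : ‖g₁‖ ≤ R)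
    {l : ℝ} (hl : 0 < l) :
    |inner ℝ (nl a K f + nl a K f₁) (f - f₁) -
      2 / (a + 2) * (inner ℝ (nl a K f) f - inner ℝ (nl a K f₁) f₁)| ≤
      C * ((a + 1) * (2 * R) ^ a) * (‖f - f₁‖ ^ 2 + (∫ x, nearPow (-b) x) *
        (4 * (l⁻¹ * inner ℝ (mulL psi₁ (f - f₁)) (f - f₁) +
          l * inner ℝ (mulL psi₁ (g - g₁)) (g - g₁)))) := by
  have hs := h.sub h₁
  have hC := hK.C_nonneg
  have hR : 0 ≤ R := (norm_nonneg _).trans hf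
  have inear := integrable_nearPow (s := -b) (by linarith [hK.b_lt])
  have j1 := L2.integrable_inner (𝕜 := ℝ) (nl a K f + nl a K f₁) (f - f₁)
  have j2 := L2.integrable_inner (𝕜 := ℝ) (nl a K f) f
  have j3 := L2.integrable_inner (𝕜 := ℝ) (nl a K f₁) f₁
  have j4 : Integrable fun x => inner ℝ (nl a K f x) (f x) - inner ℝ (nl a K f₁ x) (f₁ x) :=
    j2.sub j3
  have j5 : Integrable fun x => inner ℝ ((nl a K f + nl a K f₁) x) ((f - f₁) x) -
      2 / (a + 2) * (inner ℝ (nl a K f x) (f x) - inner ℝ (nl a K f₁ x) (f₁ x)) :=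
    j1.sub (j4.const_mul _)
  set S := 4 * (l⁻¹ * inner ℝ (mulL psi₁ (f - f₁)) (f - f₁) +
          l * inner ℝ (mulL psi₁ (g - g₁)) (g - g₁)) with hS
  have j6 : Integrable fun x => ‖(f - f₁) x‖ ^ 2 + nearPow (-b) x * S :=
    (L2.integrable_norm_sq _).add (inear.mul_const _)
  have e0 : (inner ℝ (nl a K f + nl a K f₁) (f - f₁) -
      2 / (a + 2) * (inner ℝ (nl a K f) f - inner ℝ (nl a K f₁) f₁) : ℝ) =
      ∫ x, (inner ℝ ((nl a K f + nl a K f₁) x) ((f - f₁) x) -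
        2 / (a + 2) * (inner ℝ (nl a K f x) (f x) - inner ℝ (nl a K f₁ x) (f₁ x))) := by
    rw [integral_sub j1 (j4.const_mul _), integral_const_mul, integral_sub j2 j3]
    rfl
  rw [e0, L2.norm_sq_eq_integral, ← integral_mul_const,
    ← integral_add (L2.integrable_norm_sq _) (inear.mul_const _), ← integral_const_mul]
  refine (norm_integral_le_integral_norm _).trans (integral_mono_ae
    j5.norm (j6.const_mul _) ?_)
  filter_upwards [nl_ae ha hK h, nl_ae ha hK h₁, Lp.coeFn_add (nl a K f) (nl a K f₁),
    Lp.coeFn_sub f f₁, h.ae_norm_le hf hg, h₁.ae_norm_le hf₁ hg₁, ae_ne_zero,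
    hs.ae_normSq_le_local hl] with x e1 e2 e3 e4 e5 e6 hne e7
  have e8 : (inner ℝ ((nl a K f + nl a K f₁) x) ((f - f₁) x) -
        2 / (a + 2) * (inner ℝ (nl a K f x) (f x) - inner ℝ (nl a K f₁ x) (f₁ x)) : ℝ) =
      K x * (inner ℝ (pw a (f x) + pw a (f₁ x)) (f x - f₁ x) -
      2 / (a + 2) * (inner ℝ (pw a (f x)) (f x) - inner ℝ (pw a (f₁ x)) (f₁ x))) := by
    rw [e3, e4, Pi.add_apply, Pi.sub_apply, e1, e2, ← smul_add, real_inner_smul_left,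
      real_inner_smul_left, real_inner_smul_left]
    ring
  rw [e8, norm_mul, Real.norm_eq_abs, Real.norm_eq_abs]
  have h1 := hK.bound x hne
  have h2 := abs_trapezoid_le ha e5 e6
  -- The singular weight matters only for |x| ≤ 1. There the local supremum bound with free
  -- parameter l replaces the square of the increment; elsewhere the plain L² norm suffices.
  have h3 : |x| ^ (-b) * ‖(f - f₁) x‖ ^ 2 ≤ ‖(f - f₁) x‖ ^ 2 + nearPow (-b) x * S := by
    rcases le_or_gt |x| 1 with hx | hx
    · have := e7 hx
      rw [nearPow_of_abs_le hx]
      have := mul_le_mul_of_nonneg_left this (show 0 ≤ |x| ^ (-b) by positivity)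
      nlinarith [sq_nonneg ‖(f - f₁) x‖]
    · have h4 := Real.rpow_le_one_of_one_le_of_nonpos hx.le (neg_nonpos.2 hK.b_pos.le)
      have h5 : nearPow (-b) x = 0 := by
        refine Set.indicator_of_notMem (fun hx' => ?_) _
        exact hx.not_ge (abs_le.2 hx')
      rw [h5, zero_mul, add_zero]
      exact mul_le_of_le_one_left (sq_nonneg _) h4
  calc _ ≤ (C * |x| ^ (-b)) * ((a + 1) * (2 * R) ^ a * ‖f x - f₁ x‖ ^ 2) := by gcongr
    _ = C * ((a + 1) * (2 * R) ^ a) * (|x| ^ (-b) * ‖(f - f₁) x‖ ^ 2) := by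
        rw [e4, Pi.sub_apply]; ring
    _ ≤ _ := by gcongr

/-- Norms of v and w stay bounded near a given time, and there the nonlinearity is Lipschitz from
odd H¹ to L². -/
theorem continuous_nl (ha : 0 < a) (hK : CoeffBound b C K) {v w : ℝ → L2} (hv : Continuous v)
    (hw : Continuous w) (h : ∀ t, OddH1 (v t) (w t)) : Continuous fun t => nl a K (v t) := by
  rw [continuous_iff_continuousAt]
  intro t
  set R := max ‖v t‖ ‖w t‖ + 1
  have h1 : ∀ᶠ s in 𝓝 t, ‖v s‖ ≤ R :=
    (hv.norm.tendsto t).eventually_le_const (lt_of_le_of_lt (le_max_left _ _) (lt_add_one _))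
  have h2 : ∀ᶠ s in 𝓝 t, ‖w s‖ ≤ R :=
    (hw.norm.tendsto t).eventually_le_const (lt_of_le_of_lt (le_max_right _ _) (lt_add_one _))
  have h3 : Tendsto (fun s => (C * ((a + 1) * (2 * R) ^ a)) ^ 2 *
      ((∫ x, nearPow (1 - 2 * b) x) * ‖w s - w t‖ ^ 2 + ‖v s - v t‖ ^ 2)) (𝓝 t) (𝓝 0) := by
    have : Continuous fun s => (C * ((a + 1) * (2 * R) ^ a)) ^ 2 *
      ((∫ x, nearPow (1 - 2 * b) x) * ‖w s - w t‖ ^ 2 + ‖v s - v t‖ ^ 2) := by fun_prop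
    simpa using this.tendsto t
  have h4 : Tendsto (fun s => ‖nl a K (v s) - nl a K (v t)‖ ^ 2) (𝓝 t) (𝓝 0) := by
    refine squeeze_zero' (Eventually.of_forall fun s => sq_nonneg _) ?_ h3
    filter_upwards [h1, h2] with s hs1 hs2
    exact norm_nl_sub_sq_le ha hK (h s) (h t) hs1 hs2 ((le_max_left _ _).trans (by linarith))
      ((le_max_right _ _).trans (by linarith))
  have h5 := h4.sqrt
  simp only [Real.sqrt_sq (norm_nonneg _), Real.sqrt_zero] at h5
  exact tendsto_iff_norm_sub_tendsto_zero.2 h5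

end

/-! ### Local smoothing for increments and the trapezoidal error. -/

theorem abs_inner_mulL_le {m : ℝ → ℝ} (hm : IsMult m) {C x y : ℝ} (hC : ∀ x, |m x| ≤ C)
    {f g : L2} (hf : ‖f‖ ≤ x) (hg : ‖g‖ ≤ y) : |inner ℝ (mulL m f) g| ≤ C * (x * y) := by
  have hC0 : 0 ≤ C := (abs_nonneg _).trans (hC 0)
  calc |inner ℝ (mulL m f) g| ≤ ‖mulL m f‖ * ‖g‖ := abs_real_inner_le_norm _ _
    _ ≤ (C * ‖f‖) * ‖g‖ := by gcongr; exact norm_mulL_le hm hC f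
    _ ≤ (C * x) * y := by
        have : 0 ≤ x := (norm_nonneg _).trans hf
        gcongr
    _ = _ := by ring

theorem norm_I_smul (f : L2) : ‖Complex.I • f‖ = ‖f‖ := by simp [norm_smul]

theorem norm_window_le {v : ℝ → L2} {h t R : ℝ} (hh : 0 ≤ h)
    (hv : ∀ s ∈ Set.Icc t (t + h), ‖v s‖ ≤ R) : ‖window v h t‖ ≤ R * h := by
  have := intervalIntegral.norm_integral_le_of_norm_le_const (a := t) (b := t + h) (f := v) (C := R)
    (fun s hs => by
      rw [Set.uIoc_of_le (by linarith)] at hs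
      exact hv s ⟨hs.1.le, hs.2⟩)
  rwa [add_sub_cancel_left, abs_of_nonneg hh] at this

theorem abs_integral_le_of_abs_le {φ : ℝ → ℝ} {α β M : ℝ} (hαβ : α ≤ β)
    (hφ : ∀ t ∈ Set.Icc α β, |φ t| ≤ M) : |∫ t in α..β, φ t| ≤ M * (β - α) := by
  have := intervalIntegral.norm_integral_le_of_norm_le_const (a := α) (b := β) (f := φ) (C := M)
    (fun s hs => by
      rw [Set.uIoc_of_le hαβ] at hs
      exact hφ s ⟨hs.1.le, hs.2⟩)
  rwa [abs_of_nonneg (sub_nonneg.2 hαβ)] at this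

namespace IsSol

variable {v w n : ℝ → L2}

/-- Local smoothing from the virial identity. -/
theorem integral_psi₁_deriv_le (H : IsSol v w n) {α β e τ L L' : ℝ} (hαβ : α ≤ β)
    (hv : ∀ t ∈ Set.Icc α β, ‖v t‖ ≤ e) (hw : ∀ t ∈ Set.Icc α β, ‖w t‖ ≤ τ)
    (hn : ∀ t ∈ Set.Icc α β, ‖mulL psi (n t)‖ ≤ L * e)
    (hn' : ∀ t ∈ Set.Icc α β, |inner ℝ (n t) (mulL psi₁ (v t))| ≤ L' * (e * τ)) :
    ∫ t in α..β, (inner ℝ (mulL psi₁ (w t)) (w t) : ℝ) ≤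
      (1 + (β - α) * (1 + L + L')) * (e * τ) := by
  have hψ := isVirialMult_psi
  have cv := H.cv
  have cw := H.cw
  have cn := H.cn
  have h1 := H.virial hψ α β
  set rest : ℝ → ℝ := fun t => inner ℝ (mulL psi₂ (v t)) (w t)
      + 2 * inner ℝ (n t) (mulL psi (w t)) + inner ℝ (n t) (mulL psi₁ (v t)) with hrest
  have e1 : ∫ t in α..β, (2 * inner ℝ (mulL psi₁ (w t)) (w t) + inner ℝ (mulL psi₂ (v t)) (w t)
      + 2 * inner ℝ (n t) (mulL psi (w t)) + inner ℝ (n t) (mulL psi₁ (v t)) : ℝ) =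
      2 * (∫ t in α..β, (inner ℝ (mulL psi₁ (w t)) (w t) : ℝ)) + ∫ t in α..β, rest t := by
    rw [← intervalIntegral.integral_const_mul, ← intervalIntegral.integral_add
      (Continuous.intervalIntegrable (by fun_prop) _ _)
      (Continuous.intervalIntegrable (by simp only [hrest]; fun_prop) _ _)]
    refine intervalIntegral.integral_congr fun t _ => ?_
    simp only [hrest]; ring
  have hP : ∀ t ∈ Set.Icc α β, |inner ℝ (Complex.I • v t) (mulL psi (w t))| ≤ e * τ := by
    intro t ht
    rw [← inner_mulL_left hψ.mult]
    have := abs_inner_mulL_le hψ.mult abs_psi_le ((norm_I_smul (v t)).le.trans (hv t ht)) (hw t ht)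
    linarith
  have hr : ∀ t ∈ Set.Icc α β, |rest t| ≤ (2 + 2 * L + L') * (e * τ) := by
    intro t ht
    have r1 := abs_inner_mulL_le hψ.mult'' abs_psi₂_le (hv t ht) (hw t ht)
    have r2 : |inner ℝ (n t) (mulL psi (w t))| ≤ L * (e * τ) := by
      rw [← inner_mulL_left hψ.mult]
      refine (abs_real_inner_le_norm _ _).trans ?_
      rw [← mul_assoc]
      exact mul_le_mul (hn t ht) (hw t ht) (norm_nonneg _) ((norm_nonneg _).trans (hn t ht))
    have r3 := hn' t ht
    simp only [hrest]
    rw [abs_le] at *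
    constructor <;> linarith [r1.1, r1.2, r2.1, r2.2, r3.1, r3.2]
  have h2 := abs_integral_le_of_abs_le hαβ hr
  have h3 := hP α ⟨le_rfl, hαβ⟩
  have h4 := hP β ⟨hαβ, le_rfl⟩
  have h5 : 0 ≤ L' * (e * τ) := (abs_nonneg _).trans (hn' α ⟨le_rfl, hαβ⟩)
  have h6 := mul_nonneg (sub_nonneg.2 hαβ) h5
  rw [e1] at h1
  rw [abs_le] at h2 h3 h4
  nlinarith [h2.1, h3.1, h4.2]

/-- Gain of half a derivative in time for increments of the solution. -/
theorem integral_psi₁_increment_le (H : IsSol v w n) {α β e h L R : ℝ} (hαβ : α ≤ β) (hh : 0 ≤ h)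
    (hh1 : h ≤ 1) (hL0 : 0 ≤ L)
    (hw : ∀ t ∈ Set.Icc α (β + 2), ‖w t‖ ≤ R) (hn : ∀ t ∈ Set.Icc α (β + 2), ‖n t‖ ≤ R)
    (hd : ∀ t ∈ Set.Icc α (β + 1), ‖v (t + h) - v t‖ ≤ e)
    (hdn : ∀ t ∈ Set.Icc α (β + 1), ‖mulL psi (n (t + h) - n t)‖ ≤ L * e) :
    ∫ t in α..β, (inner ℝ (mulL psi₁ (v (t + h) - v t)) (v (t + h) - v t) : ℝ) ≤
      (R + 3 * R ^ 2 + (β - α) * (2 * R + R * L)) * (h * (e + h)) := by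
  have hψ := isVirialMult_psi
  have cv := H.cv
  have cw := H.cw
  have cn := H.cn
  have cN := continuous_window cn h
  have cW := continuous_window cw h
  have hR : 0 ≤ R := (norm_nonneg _).trans (hw α ⟨le_rfl, by linarith⟩)
  have he : 0 ≤ e := (norm_nonneg _).trans (hd α ⟨le_rfl, by linarith⟩)
  have hN : ∀ t ∈ Set.Icc α (β + 1), ‖window n h t‖ ≤ R * h := fun t ht =>
    norm_window_le hh fun s hs => hn s ⟨ht.1.trans hs.1, by linarith [hs.2, ht.2]⟩
  have hW : ∀ t ∈ Set.Icc α (β + 1), ‖window w h t‖ ≤ R * h := fun t ht =>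
    norm_window_le hh fun s hs => hw s ⟨ht.1.trans hs.1, by linarith [hs.2, ht.2]⟩
  have h1 := intervalIntegral.integral_eq_sub_of_hasDerivAt (a := α) (b := β)
    (fun t _ => H.hasDerivAt_momentum_window hψ h t)
    (Continuous.intervalIntegrable (by fun_prop) _ _)
  -- The increment of w is only o(1), so pairing it with the window of n, of size O(h), is too weak.
  -- Summation by parts in time moves the increment onto the window, where `psi` makes it O(eh). The
  -- exact increment of g leaves two boundary integrals over intervals of length h, each O(h²).
  set g : ℝ → ℝ := fun t => inner ℝ (Complex.I • w t) (mulL psi (window n h t)) with hg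
  have cg : Continuous g := by simp only [hg]; fun_prop
  set r₁ : ℝ → ℝ := fun t => inner ℝ (Complex.I • w (t + h))
    (mulL psi (window n h t - window n h (t + h))) with hr₁
  set r₂ : ℝ → ℝ := fun t => inner ℝ (Complex.I • (v (t + h) - v t)) (mulL psi₁ (window n h t))
    + inner ℝ (Complex.I • (v (t + h) - v t)) (mulL psi₂ (window w h t)) with hr₂
  have e1 : ∫ t in α..β, (2 * inner ℝ (mulL psi₁ (v (t + h) - v t)) (v (t + h) - v t)
        + 2 * inner ℝ (Complex.I • (w (t + h) - w t)) (mulL psi (window n h t))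
        - inner ℝ (Complex.I • (v (t + h) - v t)) (mulL psi₁ (window n h t))
        - inner ℝ (Complex.I • (v (t + h) - v t)) (mulL psi₂ (window w h t)) : ℝ) =
      2 * (∫ t in α..β, (inner ℝ (mulL psi₁ (v (t + h) - v t)) (v (t + h) - v t) : ℝ))
      + 2 * (∫ t in α..β, r₁ t) + 2 * ((∫ t in α..β, g (t + h)) - ∫ t in α..β, g t)
      - ∫ t in α..β, r₂ t := by
    rw [← intervalIntegral.integral_sub (Continuous.intervalIntegrable (by fun_prop) _ _)
      (cg.intervalIntegrable _ _), ← intervalIntegral.integral_const_mul,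
      ← intervalIntegral.integral_const_mul, ← intervalIntegral.integral_const_mul,
      ← intervalIntegral.integral_add
      (Continuous.intervalIntegrable (by fun_prop) _ _)
      (Continuous.intervalIntegrable (by simp only [hr₁]; fun_prop) _ _),
      ← intervalIntegral.integral_add
      (Continuous.intervalIntegrable (by simp only [hr₁]; fun_prop) _ _)
      (Continuous.intervalIntegrable (by fun_prop) _ _),
      ← intervalIntegral.integral_sub
      (Continuous.intervalIntegrable (by simp only [hr₁]; fun_prop) _ _)
      (Continuous.intervalIntegrable (by simp only [hr₂]; fun_prop) _ _)]
    refine intervalIntegral.integral_congr fun t _ => ?_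
    simp only [hr₁, hr₂, hg, smul_sub, map_sub, inner_sub_left, inner_sub_right]
    ring
  have b1 : ∀ t ∈ Set.Icc α β, |r₁ t| ≤ R * (L * e * h) := by
    intro t ht
    have k1 : mulL psi (window n h t - window n h (t + h)) =
        ∫ s in (0 : ℝ)..h, -mulL psi (n (t + s + h) - n (t + s)) := by
      rw [window_eq, window_eq, ← intervalIntegral.integral_sub
        (Continuous.intervalIntegrable (by fun_prop) _ _)
        (Continuous.intervalIntegrable (by fun_prop) _ _),
        ← ContinuousLinearMap.intervalIntegral_comp_comm _
        (Continuous.intervalIntegrable (by fun_prop) _ _)]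
      refine intervalIntegral.integral_congr fun s _ => ?_
      simp only [map_sub, neg_sub]
      rw [add_right_comm]
    have k2 : ‖mulL psi (window n h t - window n h (t + h))‖ ≤ L * e * h := by
      rw [k1]
      have := intervalIntegral.norm_integral_le_of_norm_le_const (a := 0) (b := h) (C := L * e)
        (f := fun s => -mulL psi (n (t + s + h) - n (t + s))) (fun s hs => by
          rw [Set.uIoc_of_le hh] at hs
          rw [norm_neg]
          exact hdn _ ⟨by linarith [ht.1, hs.1], by linarith [ht.2, hs.2]⟩)
      rwa [sub_zero, abs_of_nonneg hh] at this
    refine (abs_real_inner_le_norm _ _).trans (mul_le_mul ?_ k2 (norm_nonneg _) hR)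
    rw [norm_I_smul]
    exact hw _ ⟨by linarith [ht.1], by linarith [ht.2]⟩
  have b2 : ∀ t ∈ Set.Icc α β, |r₂ t| ≤ 3 * (e * (R * h)) := by
    intro t ht
    have ht' : t ∈ Set.Icc α (β + 1) := ⟨ht.1, by linarith [ht.2]⟩
    have k1 := abs_inner_mulL_le hψ.mult' abs_psi₁_le
      ((norm_I_smul _).le.trans (hd t ht')) (hN t ht')
    have k2 := abs_inner_mulL_le hψ.mult'' abs_psi₂_le
      ((norm_I_smul _).le.trans (hd t ht')) (hW t ht')
    rw [inner_mulL_left hψ.mult'] at k1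
    rw [inner_mulL_left hψ.mult''] at k2
    simp only [hr₂]
    rw [abs_le] at *
    constructor <;> linarith [k1.1, k1.2, k2.1, k2.2]
  have b3 : ∀ t ∈ Set.Icc α (β + 1), |g t| ≤ R * (R * h) := by
    intro t ht
    have := abs_inner_mulL_le hψ.mult abs_psi_le
      ((norm_I_smul _).le.trans (hw t ⟨ht.1, by linarith [ht.2]⟩)) (hN t ht)
    rw [inner_mulL_left hψ.mult] at this
    simpa [hg] using this
  have b4 : |(∫ t in α..β, g (t + h)) - ∫ t in α..β, g t| ≤ 2 * (R * (R * h) * h) := by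
    rw [intervalIntegral.integral_comp_add_right,
      intervalIntegral.integral_interval_sub_interval_comm (cg.intervalIntegrable _ _)
        (cg.intervalIntegrable _ _) (cg.intervalIntegrable _ _)]
    have k1 := abs_integral_le_of_abs_le (φ := g) (α := α) (β := α + h) (M := R * (R * h))
      (by linarith) (fun t ht => b3 t ⟨ht.1, by linarith [ht.2]⟩)
    have k2 := abs_integral_le_of_abs_le (φ := g) (α := β) (β := β + h) (M := R * (R * h))
      (by linarith) (fun t ht => b3 t ⟨by linarith [ht.1], by linarith [ht.2]⟩)
    rw [add_sub_cancel_left] at k1 k2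
    rw [intervalIntegral.integral_symm α (α + h), intervalIntegral.integral_symm β (β + h)]
    rw [abs_le] at *
    constructor <;> linarith [k1.1, k1.2, k2.1, k2.2]
  have b5 : ∀ t ∈ Set.Icc α β, |inner ℝ (Complex.I • window w h t)
        (mulL psi (window n h t - Complex.I • (v (t + h) - v t)))| ≤ R * h * (R * h + e) := by
    intro t ht
    have ht' : t ∈ Set.Icc α (β + 1) := ⟨ht.1, by linarith [ht.2]⟩
    have := abs_inner_mulL_le hψ.mult abs_psi_le
      ((norm_I_smul _).le.trans (hW t ht')) (y := R * h + e)
      (g := window n h t - Complex.I • (v (t + h) - v t))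
      ((norm_sub_le _ _).trans (add_le_add (hN t ht') ((norm_I_smul _).le.trans (hd t ht'))))
    rwa [inner_mulL_left hψ.mult, one_mul] at this
  have c1 := abs_integral_le_of_abs_le hαβ b1
  have c2 := abs_integral_le_of_abs_le hαβ b2
  have c3 := b5 α ⟨le_rfl, hαβ⟩
  have c4 := b5 β ⟨hαβ, le_rfl⟩
  rw [e1] at h1
  rw [abs_le] at b4 c1 c2 c3 c4
  have hba : 0 ≤ β - α := sub_nonneg.2 hαβ
  have p1 : 0 ≤ (β - α) * (R * h * e) := by positivity
  have p2 : 0 ≤ (β - α) * (R * h * h) := by positivity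
  have p3 : 0 ≤ R ^ 2 * (h * e) := by positivity
  have p4 : 0 ≤ R * (h * h) := by positivity
  have p6 : 0 ≤ R ^ 2 * (h * h) := by positivity
  have p5 : 0 ≤ (β - α) * (R * h * e) := by positivity
  have hL : 0 ≤ (β - α) * (R * (L * h * h)) := by
    positivity
  nlinarith [c1.1, c2.1, c2.2, c3.1, c4.2, b4.1]

end IsSol

theorem exists_common_bound {v w n : ℝ → L2} (cv : Continuous v) (cw : Continuous w)
    (cn : Continuous n) (α β : ℝ) :
    ∃ R, 0 ≤ R ∧ ∀ t ∈ Set.Icc α β, ‖v t‖ ≤ R ∧ ‖w t‖ ≤ R ∧ ‖n t‖ ≤ R := by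
  obtain ⟨R, hR⟩ := (isCompact_Icc (a := α) (b := β)).exists_bound_of_continuousOn
    (f := fun t => ‖v t‖ + ‖w t‖ + ‖n t‖) (by fun_prop)
  refine ⟨max R 0, le_max_right _ _, fun t ht => ?_⟩
  have h := (hR t ht).trans (le_max_left R 0)
  rw [Real.norm_of_nonneg (by positivity)] at h
  have h1 := norm_nonneg (v t)
  have h2 := norm_nonneg (w t)
  have h3 := norm_nonneg (n t)
  exact ⟨by linarith, by linarith, by linarith⟩

theorem exists_increment_le {v : ℝ → L2} (cv : Continuous v) (α β : ℝ) {τ : ℝ} (hτ : 0 < τ) :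
    ∃ δ > 0, ∀ h, 0 < h → h < δ → ∀ t ∈ Set.Icc α β, ‖v (t + h) - v t‖ ≤ τ := by
  have hu := (isCompact_Icc (a := α) (b := β + 1)).uniformContinuousOn_of_continuous
    cv.continuousOn
  obtain ⟨δ, hδ, h1⟩ := Metric.uniformContinuousOn_iff.1 hu τ hτ
  refine ⟨min δ 1, lt_min hδ one_pos, fun h hh hhδ t ht => ?_⟩
  have h2 := hhδ.trans_le (min_le_left δ 1)
  have h3 := hhδ.trans_le (min_le_right δ 1)
  rw [← dist_eq_norm]
  refine (h1 _ ⟨by linarith [ht.1], by linarith [ht.2]⟩ _ ⟨ht.1, by linarith [ht.2]⟩ ?_).le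
  rw [Real.dist_eq, add_sub_cancel_left, abs_of_pos hh]
  exact h2

/-- An odd global solution of the nonlinear equation, as a curve in `L²` with its derivative. -/
structure IsNLS (a b C : ℝ) (K : ℝ → ℝ) (v w : ℝ → L2) : Prop where
  a_pos : 0 < a
  coeff : CoeffBound b C K
  sol : IsSol v w (fun t => nl a K (v t))
  odd : ∀ t, OddH1 (v t) (w t)

/-- Error of the trapezoidal rule for the potential energy between two times. -/
noncomputable def trapezoid (a : ℝ) (K : ℝ → ℝ) (v : ℝ → L2) (h t : ℝ) : ℝ :=
  inner ℝ (nl a K (v (t + h)) + nl a K (v t)) (v (t + h) - v t) -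
    2 / (a + 2) * (inner ℝ (nl a K (v (t + h))) (v (t + h)) - inner ℝ (nl a K (v t)) (v t))

namespace IsNLS

variable {a b C : ℝ} {K : ℝ → ℝ} {v w : ℝ → L2}

theorem continuous_trapezoid (H : IsNLS a b C K v w) (h : ℝ) :
    Continuous (trapezoid a K v h) := by
  have cv := H.sol.cv
  have cn : Continuous fun t => nl a K (v (t + h)) := H.sol.cn.comp (continuous_add_const h)
  have cn' := H.sol.cn
  unfold trapezoid
  fun_prop

/-- The trapezoidal error is of smaller order than the time step, by local smoothing. -/
theorem exists_integral_trapezoid_le (H : IsNLS a b C K v w) {α β : ℝ} (hαβ : α ≤ β) {ε : ℝ}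
    (hε : 0 < ε) : ∃ δ > 0, ∀ h, 0 < h → h < δ → ∫ t in α..β, |trapezoid a K v h t| ≤ ε * h := by
  have cv := H.sol.cv
  have cw := H.sol.cw
  have cn := H.sol.cn
  have ha := H.a_pos
  have hC := H.coeff.C_nonneg
  have hψ := isVirialMult_psi
  obtain ⟨R, hR0, hR⟩ := exists_common_bound cv cw cn α (β + 2)
  set L := C * ((a + 1) * (2 * R) ^ a) with hLdef
  have hL : 0 ≤ L := by positivity
  set θ := ∫ x, |x| ^ (-b) * psi₁ x
  have hθ : 0 ≤ θ := integral_nonneg fun x => mul_nonneg (by positivity) (psi₁_pos x).le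
  set c := ∫ x, nearPow (-b) x
  have hc : 0 ≤ c := integral_nonneg (nearPow_nonneg _)
  have hba : 0 ≤ β - α := sub_nonneg.2 hαβ
  set M₁ := 1 + (β - α) * (1 + L + 2 * L * θ) with hM₁
  set M₂ := R + 3 * R ^ 2 + (β - α) * (2 * R + R * L) with hM₂
  have hM₁0 : 0 ≤ M₁ := by positivity
  have hM₂0 : 0 ≤ M₂ := by positivity
  -- This is the final bound divided by h, with τ bounding the increments of v and w and η standing
  -- for √h. It is continuous and vanishes at τ = η = 0, so one s small enough for both arguments
  -- exists.
  set κ : ℝ → ℝ → ℝ := fun τ η => L * ((β - α) * (2 * R * τ) + c * (4 * (M₂ * (√(2 * R * τ) + η) +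
    M₁ * (√(2 * R * τ) * τ)))) with hκ
  obtain ⟨s, hs, hs0⟩ : ∃ s, κ s s ≤ ε ∧ 0 < s := by
    have hcont : Continuous fun s => κ s s := by simp only [hκ]; fun_prop
    have h0 : κ 0 0 = 0 := by simp [hκ]
    have h1 : ∀ᶠ s in 𝓝 (0 : ℝ), κ s s ≤ ε :=
      (hcont.tendsto 0).eventually_le_const (by rw [h0]; exact hε)
    exact ((h1.filter_mono nhdsWithin_le_nhds).and self_mem_nhdsWithin : ∀ᶠ s in 𝓝[>] (0 : ℝ),
      κ s s ≤ ε ∧ 0 < s).exists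
  obtain ⟨δ₁, hδ₁, hinc₁⟩ := exists_increment_le cv α (β + 1) hs0
  obtain ⟨δ₂, hδ₂, hinc₂⟩ := exists_increment_le cw α (β + 1) hs0
  refine ⟨min (min δ₁ δ₂) (min 1 (s ^ 2)), lt_min (lt_min hδ₁ hδ₂) (lt_min one_pos (by positivity)),
    fun h hh hhδ => ?_⟩
  have hh1 : h < δ₁ := hhδ.trans_le ((min_le_left _ _).trans (min_le_left _ _))
  have hh2 : h < δ₂ := hhδ.trans_le ((min_le_left _ _).trans (min_le_right _ _))
  have hh3 : h < 1 := hhδ.trans_le ((min_le_right _ _).trans (min_le_left _ _))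
  have hh4 : h < s ^ 2 := hhδ.trans_le ((min_le_right _ _).trans (min_le_right _ _))
  -- The choice √h balances the two smoothing terms. The increments of v are at most e = √(2Rs)·√h,
  -- so l⁻¹·h(e+h) and l·e·s are both h times a quantity that is small with s and √h.
  set l := √h with hl
  have hl0 : 0 < l := Real.sqrt_pos.2 hh
  have hll : l * l = h := Real.mul_self_sqrt hh.le
  have hls : l ≤ s := by
    rw [hl, ← Real.sqrt_sq hs0.le]; exact Real.sqrt_le_sqrt hh4.le
  set e := √(2 * R * s) * l with he
  have he2 : e ^ 2 = 2 * R * s * h := by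
    rw [he, mul_pow, Real.sq_sqrt (by positivity), sq, hll]
  have he0 : 0 ≤ e := by positivity
  have hd : ∀ t ∈ Set.Icc α (β + 1), ‖v (t + h) - v t‖ ^ 2 ≤ 2 * R * s * h := by
    intro t ht
    refine (H.sol.normSq_increment_le h t).trans ?_
    have k1 : ‖window (fun t => nl a K (v t)) h t‖ ≤ R * h := norm_window_le hh.le fun r hr =>
      (hR r ⟨ht.1.trans hr.1, by linarith [hr.2, ht.2]⟩).2.2
    have k2 : ‖window w h t‖ ≤ R * h := norm_window_le hh.le fun r hr =>
      (hR r ⟨ht.1.trans hr.1, by linarith [hr.2, ht.2]⟩).2.1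
    have k3 := mul_le_mul k1 (hinc₁ h hh hh1 t ht) (norm_nonneg _) (by positivity)
    have k4 := mul_le_mul k2 (hinc₂ h hh hh2 t ht) (norm_nonneg _) (by positivity)
    linarith
  have hd' : ∀ t ∈ Set.Icc α (β + 1), ‖v (t + h) - v t‖ ≤ e := fun t ht =>
    (le_abs_self _).trans (abs_le_of_sq_le_sq (by rw [he2]; exact hd t ht) he0)
  have hsub : ∀ t ∈ Set.Icc α β, t ∈ Set.Icc α (β + 1) := fun t ht => ⟨ht.1, by linarith [ht.2]⟩
  have hR₀ : ∀ t ∈ Set.Icc α (β + 1), ‖v t‖ ≤ R ∧ ‖w t‖ ≤ R := fun t ht =>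
    ⟨(hR t ⟨ht.1, by linarith [ht.2]⟩).1, (hR t ⟨ht.1, by linarith [ht.2]⟩).2.1⟩
  have hR₁ : ∀ t ∈ Set.Icc α (β + 1), ‖v (t + h)‖ ≤ R ∧ ‖w (t + h)‖ ≤ R := fun t ht =>
    ⟨(hR (t + h) ⟨by linarith [ht.1], by linarith [ht.2]⟩).1,
      (hR (t + h) ⟨by linarith [ht.1], by linarith [ht.2]⟩).2.1⟩
  have hdn : ∀ t ∈ Set.Icc α (β + 1),
      ‖mulL psi (nl a K (v (t + h)) - nl a K (v t))‖ ≤ L * e := fun t ht =>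
    (norm_mulL_psi_nl_sub_le ha H.coeff (H.odd _) (H.odd _) (hR₁ t ht).1 (hR₁ t ht).2 (hR₀ t ht).1
      (hR₀ t ht).2).trans (mul_le_mul_of_nonneg_left (hd' t ht) hL)
  -- The virial estimate is applied to the increment, itself a solution whose forcing is the
  -- increment of the nonlinearity.
  have hB := (H.sol.sub_shift h).integral_psi₁_deriv_le (e := e) (τ := s) (L := L) (L' := 2 * L * θ)
    hαβ (fun t ht => hd' t (hsub t ht)) (fun t ht => hinc₂ h hh hh2 t (hsub t ht))
    (fun t ht => hdn t (hsub t ht)) (fun t ht => by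
      have ht' := hsub t ht
      refine (abs_inner_nl_sub_psi₁_le ha H.coeff (H.odd _) (H.odd _) (hR₁ t ht').1 (hR₁ t ht').2
        (hR₀ t ht').1 (hR₀ t ht').2).trans ?_
      have k := mul_le_mul (hd' t ht') (hinc₂ h hh hh2 t ht') (norm_nonneg _) he0
      calc _ ≤ L * θ * (2 * (e * s)) := by gcongr
        _ = _ := by ring)
  have hA := H.sol.integral_psi₁_increment_le (e := e) (L := L) (R := R) hαβ hh.le hh3.le hL
    (fun t ht => (hR t ht).2.1) (fun t ht => (hR t ht).2.2) hd' hdn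
  rw [← hM₁] at hB
  rw [← hM₂] at hA
  have iA : IntervalIntegrable (fun t => (inner ℝ (mulL psi₁ (v (t + h) - v t))
      (v (t + h) - v t) : ℝ)) volume α β := Continuous.intervalIntegrable (by fun_prop) _ _
  have iB : IntervalIntegrable (fun t => (inner ℝ (mulL psi₁ (w (t + h) - w t))
      (w (t + h) - w t) : ℝ)) volume α β := Continuous.intervalIntegrable (by fun_prop) _ _
  have hT : ∫ t in α..β, |trapezoid a K v h t| ≤ ∫ t in α..β, L * (2 * R * s * h + c *
      (4 * (l⁻¹ * inner ℝ (mulL psi₁ (v (t + h) - v t)) (v (t + h) - v t) +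
        l * inner ℝ (mulL psi₁ (w (t + h) - w t)) (w (t + h) - w t)))) := by
    refine intervalIntegral.integral_mono_on hαβ
      ((H.continuous_trapezoid h).abs.intervalIntegrable _ _)
      (Continuous.intervalIntegrable (by fun_prop) _ _) fun t ht => ?_
    have ht' := hsub t ht
    refine (abs_trapezoid_nl_le ha H.coeff (H.odd (t + h)) (H.odd t) (hR₁ t ht').1 (hR₁ t ht').2
        (hR₀ t ht').1 (hR₀ t ht').2 hl0).trans ?_
    have := hd t ht'
    gcongr
  refine hT.trans ?_
  rw [intervalIntegral.integral_const_mul, intervalIntegral.integral_add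
    (intervalIntegrable_const) ((((iA.const_mul _).add (iB.const_mul _)).const_mul _).const_mul _),
    intervalIntegral.integral_const, intervalIntegral.integral_const_mul,
    intervalIntegral.integral_const_mul,
    intervalIntegral.integral_add (iA.const_mul _) (iB.const_mul _),
    intervalIntegral.integral_const_mul, intervalIntegral.integral_const_mul, smul_eq_mul]
  have k1 : κ s l ≤ ε := by
    refine le_trans ?_ hs
    simp only [hκ]
    gcongr
  refine le_trans ?_ (mul_le_mul_of_nonneg_right k1 hh.le)
  have k2 : l⁻¹ * (M₂ * (h * (e + h))) = M₂ * (√(2 * R * s) + l) * h := by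
    rw [he, ← hll]; field_simp
  have k3 : l * (M₁ * (e * s)) = M₁ * (√(2 * R * s) * s) * h := by
    rw [he, ← hll]; ring
  have k4 := mul_le_mul_of_nonneg_left hA (inv_nonneg.2 hl0.le)
  have k5 := mul_le_mul_of_nonneg_left hB hl0.le
  rw [k2] at k4
  rw [k3] at k5
  calc _ ≤ L * ((β - α) * (2 * R * s * h) + c * (4 * (M₂ * (√(2 * R * s) + l) * h +
        M₁ * (√(2 * R * s) * s) * h))) := by gcongr
    _ = κ s l * h := by simp only [hκ]; ring

end IsNLS

/-! ### Conservation of energy from increments. -/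

theorem intervalIntegral_swap {φ : ℝ → ℝ → ℝ} (hφ : Continuous (Function.uncurry φ)) {a b c d : ℝ}
    (hab : a ≤ b) (hcd : c ≤ d) :
    ∫ x in a..b, ∫ y in c..d, φ x y = ∫ y in c..d, ∫ x in a..b, φ x y := by
  simp only [intervalIntegral.integral_of_le hab, intervalIntegral.integral_of_le hcd]
  refine integral_integral_swap ?_
  rw [Measure.prod_restrict]
  exact (hφ.continuousOn.integrableOn_compact (isCompact_Icc.prod isCompact_Icc)).mono_set
    (Set.prod_mono Set.Ioc_subset_Icc_self Set.Ioc_subset_Icc_self)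

theorem abs_integral_sub_const_mul_le {φ : ℝ → ℝ} (hφ : Continuous φ) {α β c ε : ℝ} (hαβ : α ≤ β)
    (h : ∀ t ∈ Set.Icc α β, |φ t - c| ≤ ε) :
    |(∫ t in α..β, φ t) - (β - α) * c| ≤ ε * (β - α) := by
  have := abs_integral_le_of_abs_le hαβ h
  rwa [intervalIntegral.integral_sub (hφ.intervalIntegrable _ _) intervalIntegrable_const,
    intervalIntegral.integral_const, smul_eq_mul] at this

/-- A kernel `k` whose increments integrate to zero and whose antisymmetric part is, up to a small
error, an exact increment of `Γ`, satisfies a conservation law on the diagonal. -/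
theorem diagonal_sub_eq_of_increments {k : ℝ → ℝ → ℝ} {Γ : ℝ → ℝ} {T : ℝ → ℝ → ℝ} {c α β : ℝ}
    (ck : Continuous (Function.uncurry k)) (cΓ : Continuous Γ) (cT : ∀ h, Continuous (T h))
    (hc0 : 0 ≤ c) (hc1 : c ≤ 1) (hαβ : α ≤ β)
    (hzero : ∀ h, ∫ t in α..β, ∫ s in (0 : ℝ)..h, (k (t + s) (t + h) - k (t + s) t) = 0)
    (hanti : ∀ p q, k p q - k q p = T (q - p) p - c * (Γ q - Γ p))
    (hsmall : ∀ ε, 0 < ε → ∃ δ > 0, ∀ h, 0 < h → h < δ → ∫ t in α..(β + 1), |T h t| ≤ ε * h) :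
    k β β - k α α - c * (Γ β - Γ α) = 0 := by
  have ck2 : ∀ {f g : ℝ → ℝ}, Continuous f → Continuous g → Continuous fun t => k (f t) (g t) :=
    fun hf hg => ck.comp (hf.prodMk hg)
  set X := k β β - k α α - c * (Γ β - Γ α) with hX
  have hbound : ∀ ε, 0 < ε → |X| ≤ 10 * ε := by
    intro ε hε
    obtain ⟨δ₁, hδ₁, hT⟩ := hsmall ε hε
    have nearΓ : ∀ t₀, ∃ δ > 0, ∀ t, |t - t₀| ≤ δ → |Γ t - Γ t₀| ≤ ε := by
      intro t₀
      obtain ⟨δ, hδ, h⟩ := Metric.continuous_iff.1 cΓ t₀ ε hε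
      exact ⟨δ / 2, by positivity, fun t ht => (h t (by rw [Real.dist_eq]; linarith)).le⟩
    have nearK : ∀ t₀, ∃ δ > 0, ∀ p q, |p - t₀| ≤ δ → |q - t₀| ≤ δ →
        |k p q - k t₀ t₀| ≤ ε := by
      intro t₀
      obtain ⟨δ, hδ, h⟩ := Metric.continuous_iff.1 ck (t₀, t₀) ε hε
      refine ⟨δ / 2, by positivity, fun p q hp hq => (h (p, q) ?_).le⟩
      rw [Prod.dist_eq]
      exact max_lt (by simp only [Real.dist_eq]; linarith) (by simp only [Real.dist_eq]; linarith)
    obtain ⟨δ₂, hδ₂, hΓα⟩ := nearΓ α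
    obtain ⟨δ₃, hδ₃, hΓβ⟩ := nearΓ β
    obtain ⟨δ₄, hδ₄, hkα⟩ := nearK α
    obtain ⟨δ₅, hδ₅, hkβ⟩ := nearK β
    obtain ⟨h, hh, hhlt⟩ : ∃ h, 0 < h ∧ h < min (min (min δ₁ δ₂) (min δ₃ δ₄)) (min δ₅ 1) :=
      exists_between (by simp [hδ₁, hδ₂, hδ₃, hδ₄, hδ₅])
    simp only [lt_min_iff] at hhlt
    obtain ⟨⟨⟨h1, h2⟩, h3, h4⟩, h5, h6⟩ := hhlt
    -- In the second part of the double integral the inner variable is reflected, s ↦ h − s. The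
    -- integral of Ξ over [0, h] is still 0, and after a translation the kernels in its two terms
    -- have swapped arguments.
    set Ξ : ℝ → ℝ := fun s => (∫ t in α..β, k (t + s) (t + h)) - ∫ t in α..β, k (t + (h - s)) t
      with hΞ
    have cI : ∀ (f : ℝ → ℝ → ℝ), Continuous (Function.uncurry f) →
        Continuous fun s => ∫ t in α..β, f s t := fun f hf =>
      intervalIntegral.continuous_parametric_intervalIntegral_of_continuous' hf α β
    have c1 : Continuous fun s => ∫ t in α..β, k (t + s) (t + h) :=
      cI (fun s t => k (t + s) (t + h))
        (ck.comp (by fun_prop : Continuous fun p : ℝ × ℝ => (p.2 + p.1, p.2 + h)))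
    have c2 : Continuous fun s => ∫ t in α..β, k (t + s) t :=
      cI (fun s t => k (t + s) t) (ck.comp (by fun_prop : Continuous fun p : ℝ × ℝ => (p.2 + p.1, p.2)))
    have c3 : Continuous fun s => ∫ t in α..β, k (t + (h - s)) t :=
      c2.comp (continuous_const.sub continuous_id)
    have hint : ∫ s in (0 : ℝ)..h, Ξ s = 0 := by
      simp only [hΞ]
      rw [intervalIntegral.integral_sub (c1.intervalIntegrable _ _) (c3.intervalIntegrable _ _),
        intervalIntegral.integral_comp_sub_left (fun s => ∫ t in α..β, k (t + s) t) h, sub_self,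
        sub_zero, ← intervalIntegral.integral_sub (c1.intervalIntegrable _ _)
          (c2.intervalIntegrable _ _)]
      refine Eq.trans ?_ (hzero h)
      rw [intervalIntegral_swap (φ := fun t s => k (t + s) (t + h) - k (t + s) t)
        ((ck.comp (by fun_prop : Continuous fun p : ℝ × ℝ => (p.1 + p.2, p.1 + h))).sub
          (ck.comp (by fun_prop : Continuous fun p : ℝ × ℝ => (p.1 + p.2, p.1)))) hαβ hh.le]
      refine intervalIntegral.integral_congr fun s _ => ?_
      exact (intervalIntegral.integral_sub
        ((ck2 (by fun_prop) (by fun_prop)).intervalIntegrable _ _)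
        ((ck2 (by fun_prop) (by fun_prop)).intervalIntegrable _ _)).symm
    -- Translating by s makes the antisymmetric part of k appear over [α, β]. The leftover
    -- intervals, of length s, produce the increment of the diagonal of k. The increments of Γ
    -- telescope to intervals of length h − s at the two ends.
    have hΞb : ∀ s ∈ Set.Ioo 0 h,
        |Ξ s - (s * (k β β - k α α) - (h - s) * (c * (Γ β - Γ α)))| ≤ 5 * ε * h := by
      intro s hs
      have hs0 := hs.1
      have hsh := hs.2
      have cks : Continuous fun r => k (r + h) (r + s) := ck2 (by fun_prop) (by fun_prop)
      have e1 : ∫ t in α..β, k (t + (h - s)) t = ∫ r in (α - s)..(β - s), k (r + h) (r + s) := by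
        have := intervalIntegral.integral_comp_sub_right (a := α) (b := β)
          (fun r => k (r + h) (r + s)) s
        rw [← this]
        refine intervalIntegral.integral_congr fun t _ => ?_
        simp only [sub_add_cancel]
        congr 1; ring
      have e2 : ∫ r in (α - s)..(β - s), k (r + h) (r + s) =
          (∫ r in α..β, k (r + h) (r + s)) + (∫ r in (α - s)..α, k (r + h) (r + s)) -
            ∫ r in (β - s)..β, k (r + h) (r + s) := by
        have i := fun x y => cks.intervalIntegrable (μ := volume) x y
        have j1 := intervalIntegral.integral_add_adjacent_intervals (i (α - s) α) (i α β)
        have j2 := intervalIntegral.integral_add_adjacent_intervals (i (α - s) (β - s)) (i (β - s) β)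
        linarith
      have e3 : (∫ t in α..β, k (t + s) (t + h)) - ∫ r in α..β, k (r + h) (r + s) =
          (∫ r in (α + s)..(β + s), T (h - s) r) -
            c * ((∫ t in (β + s)..(β + h), Γ t) - ∫ t in (α + s)..(α + h), Γ t) := by
        have iT : IntervalIntegrable (fun t => T (h - s) (t + s)) volume α β :=
          ((cT (h - s)).comp (continuous_add_const s)).intervalIntegrable _ _
        have iG : ∀ r, IntervalIntegrable (fun t => Γ (t + r)) volume α β := fun r =>
          (cΓ.comp (continuous_add_const r)).intervalIntegrable _ _
        have j1 : (∫ t in (β + s)..(β + h), Γ t) - ∫ t in (α + s)..(α + h), Γ t =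
            ∫ t in α..β, (Γ (t + h) - Γ (t + s)) := by
          rw [intervalIntegral.integral_sub (iG h) (iG s),
            intervalIntegral.integral_comp_add_right, intervalIntegral.integral_comp_add_right]
          have i := fun x y => cΓ.intervalIntegrable (μ := volume) x y
          have j2 := intervalIntegral.integral_add_adjacent_intervals (i (α + s) (β + s))
            (i (β + s) (β + h))
          have j3 := intervalIntegral.integral_add_adjacent_intervals (i (α + s) (α + h))
            (i (α + h) (β + h))
          linarith
        rw [j1, ← intervalIntegral.integral_comp_add_right (fun r => T (h - s) r),
          ← intervalIntegral.integral_const_mul, ← intervalIntegral.integral_sub iT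
            (((iG h).sub (iG s)).const_mul c),
          ← intervalIntegral.integral_sub
            ((ck2 (by fun_prop) (by fun_prop)).intervalIntegrable _ _)
            (cks.intervalIntegrable _ _)]
        refine intervalIntegral.integral_congr fun t _ => ?_
        have := hanti (t + s) (t + h)
        rw [add_sub_add_left_eq_sub] at this
        exact this
      -- As h < 1, the shifted interval stays inside [α, β+1], which is why smallness is assumed on
      -- the longer interval.
      have b1 : |∫ r in (α + s)..(β + s), T (h - s) r| ≤ ε * (h - s) := by
        refine (intervalIntegral.abs_integral_le_integral_abs (by linarith)).trans ?_
        refine le_trans ?_ (hT (h - s) (by linarith) (by linarith))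
        refine intervalIntegral.integral_mono_interval (by linarith) (by linarith) (by linarith)
          (ae_of_all _ fun _ => abs_nonneg _)
          ((cT (h - s)).abs.intervalIntegrable _ _)
      have b2 := abs_integral_sub_const_mul_le cΓ (α := β + s) (β := β + h) (c := Γ β) (ε := ε)
        (by linarith) (fun t ht => hΓβ t (by
          rw [abs_of_nonneg (by linarith [ht.1])]; linarith [ht.2]))
      have b3 := abs_integral_sub_const_mul_le cΓ (α := α + s) (β := α + h) (c := Γ α) (ε := ε)
        (by linarith) (fun t ht => hΓα t (by
          rw [abs_of_nonneg (by linarith [ht.1])]; linarith [ht.2]))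
      have b4 := abs_integral_sub_const_mul_le cks (α := β - s) (β := β) (c := k β β) (ε := ε)
        (by linarith) (fun t ht => hkβ _ _ (by
          rw [abs_le]; constructor <;> linarith [ht.1, ht.2]) (by
          rw [abs_le]; constructor <;> linarith [ht.1, ht.2]))
      have b5 := abs_integral_sub_const_mul_le cks (α := α - s) (β := α) (c := k α α) (ε := ε)
        (by linarith) (fun t ht => hkα _ _ (by
          rw [abs_le]; constructor <;> linarith [ht.1, ht.2]) (by
          rw [abs_le]; constructor <;> linarith [ht.1, ht.2]))
      rw [add_sub_add_left_eq_sub] at b2 b3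
      rw [sub_sub_cancel] at b4 b5
      have b6 : |c * (((∫ t in (β + s)..(β + h), Γ t) - (h - s) * Γ β) -
          ((∫ t in (α + s)..(α + h), Γ t) - (h - s) * Γ α))| ≤ 2 * (ε * (h - s)) := by
        rw [abs_mul, abs_of_nonneg hc0]
        refine (mul_le_of_le_one_left (abs_nonneg _) hc1).trans ((abs_sub _ _).trans ?_)
        linarith
      have e4 : Ξ s = (∫ r in (α + s)..(β + s), T (h - s) r) -
            c * ((∫ t in (β + s)..(β + h), Γ t) - ∫ t in (α + s)..(α + h), Γ t) -
            (∫ r in (α - s)..α, k (r + h) (r + s)) + ∫ r in (β - s)..β, k (r + h) (r + s) := by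
        simp only [hΞ]
        rw [e1, e2]
        linarith
      rw [e4]
      have hεs : ε * s ≤ ε * h := by gcongr
      have hεs0 : 0 ≤ ε * s := by positivity
      rw [abs_le] at *
      constructor <;> linarith [b1.1, b1.2, b4.1, b4.2, b5.1, b5.2, b6.1, b6.2]
    have cΞ : Continuous Ξ := c1.sub c3
    have hfin : |∫ s in (0 : ℝ)..h, (Ξ s - (s * (k β β - k α α) - (h - s) * (c * (Γ β - Γ α))))| ≤
        5 * ε * h * h := by
      -- Smallness of T needs a positive step h − s, so the bound was proved on the open interval;
      -- continuity extends it to the endpoints.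
      have hcl : ∀ s ∈ Set.Icc 0 h,
          |Ξ s - (s * (k β β - k α α) - (h - s) * (c * (Γ β - Γ α)))| ≤ 5 * ε * h := by
        rw [← closure_Ioo hh.ne]
        intro s hs
        have hclosed : IsClosed {s | |Ξ s - (s * (k β β - k α α) - (h - s) * (c * (Γ β - Γ α)))| ≤
          5 * ε * h} := isClosed_le (by fun_prop) continuous_const
        exact closure_minimal (t := {s | |Ξ s - (s * (k β β - k α α) - (h - s) * (c * (Γ β - Γ α)))| ≤
          5 * ε * h}) hΞb hclosed hs
      have := abs_integral_le_of_abs_le hh.le hcl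
      rwa [sub_zero] at this
    -- The weights s and h − s have the same integral h²/2, so the two main terms combine into a
    -- multiple of X. The error 5εh² then gives |X| ≤ 10ε.
    have i1 : ∫ s in (0 : ℝ)..h, (s * (k β β - k α α) - (h - s) * (c * (Γ β - Γ α))) =
        h ^ 2 / 2 * X := by
      rw [intervalIntegral.integral_sub (Continuous.intervalIntegrable (by fun_prop) _ _)
        (Continuous.intervalIntegrable (by fun_prop) _ _), intervalIntegral.integral_mul_const,
        intervalIntegral.integral_mul_const, integral_id, intervalIntegral.integral_comp_sub_left
        (fun x => x), integral_id, hX]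
      ring
    rw [intervalIntegral.integral_sub (cΞ.intervalIntegrable _ _)
      (Continuous.intervalIntegrable (by fun_prop) _ _), hint, i1, zero_sub, abs_neg, abs_mul,
      abs_of_pos (by positivity)] at hfin
    have hh2 : 0 < h ^ 2 := by positivity
    have : h ^ 2 * |X| ≤ h ^ 2 * (10 * ε) := by linarith
    exact le_of_mul_le_mul_left this hh2
  have hle : |X| ≤ 0 := by
    refine le_of_forall_pos_le_add fun ε hε => ?_
    have := hbound (ε / 10) (by positivity)
    linarith
  exact abs_nonpos_iff.1 hle

namespace IsNLS

variable {a b C : ℝ} {K : ℝ → ℝ} {v w : ℝ → L2}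

/-- Conservation of energy. -/
theorem energy_eq (H : IsNLS a b C K v w) (α β : ℝ) :
    ‖w β‖ ^ 2 + 2 / (a + 2) * inner ℝ (nl a K (v β)) (v β) =
      ‖w α‖ ^ 2 + 2 / (a + 2) * inner ℝ (nl a K (v α)) (v α) := by
  wlog hαβ : α ≤ β generalizing α β
  · exact (this β α (not_le.1 hαβ).le).symm
  have cv := H.sol.cv
  have cw := H.sol.cw
  have cn := H.sol.cn
  have ha := H.a_pos
  set n : ℝ → L2 := fun t => nl a K (v t) with hn
  -- The gradient part of k is symmetric, so only the potential part contributes to k p q − k q p.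
  -- The trapezoidal rule identifies that contribution with −a/(a+2) times the increment of Γ. On
  -- the diagonal k is Γ plus the squared gradient norm, and 1 − a/(a+2) = 2/(a+2) is the
  -- coefficient of the potential energy.
  set k : ℝ → ℝ → ℝ := fun p q => inner ℝ (n p) (v q) + inner ℝ (w p) (w q) with hk
  have ck : Continuous (Function.uncurry k) := by
    simp only [hk, Function.uncurry_def]; fun_prop
  set Γ : ℝ → ℝ := fun t => inner ℝ (n t) (v t) with hΓ
  have cΓ : Continuous Γ := by simp only [hΓ]; fun_prop
  set c := a / (a + 2) with hc
  have hc0 : 0 ≤ c := by positivity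
  have hc1 : c ≤ 1 := by rw [hc, div_le_one (by linarith)]; linarith
  have hzero : ∀ h, ∫ t in α..β, ∫ s in (0 : ℝ)..h, (k (t + s) (t + h) - k (t + s) t) = 0 := by
    intro h
    refine Eq.trans (intervalIntegral.integral_congr fun t _ => ?_)
      (intervalIntegral.integral_zero (a := α) (b := β))
    have h1 := H.sol.inner_window_add h t
    rw [window_eq, window_eq, real_inner_comm, real_inner_comm (w (t + h) - w t)] at h1
    have e1 := (innerSL ℝ (v (t + h) - v t)).intervalIntegral_comp_comm (μ := volume)
      (a := 0) (b := h) (f := fun s => n (t + s))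
      (Continuous.intervalIntegrable (by fun_prop) _ _)
    have e2 := (innerSL ℝ (w (t + h) - w t)).intervalIntegral_comp_comm (μ := volume)
      (a := 0) (b := h) (f := fun s => w (t + s))
      (Continuous.intervalIntegrable (by fun_prop) _ _)
    simp only [innerSL_apply_apply] at e1 e2
    rw [← e1, ← e2, ← intervalIntegral.integral_add
      (Continuous.intervalIntegrable (by fun_prop) _ _)
      (Continuous.intervalIntegrable (by fun_prop) _ _)] at h1
    refine Eq.trans ?_ h1
    refine intervalIntegral.integral_congr fun s _ => ?_
    simp only [hk]
    rw [real_inner_comm (n (t + s)), real_inner_comm (w (t + s)), inner_sub_right, inner_sub_right]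
    ring
  have hanti : ∀ p q, k p q - k q p = trapezoid a K v (q - p) p - c * (Γ q - Γ p) := by
    intro p q
    simp only [trapezoid, add_sub_cancel]
    simp only [hk, hΓ, hn, inner_sub_right, inner_add_left, hc]
    rw [real_inner_comm (w q) (w p)]
    field_simp
    ring
  have hX0 := diagonal_sub_eq_of_increments ck cΓ H.continuous_trapezoid hc0 hc1 hαβ hzero hanti
    fun ε hε => H.exists_integral_trapezoid_le (by linarith) hε
  have e1 : k β β = Γ β + ‖w β‖ ^ 2 := by simp only [hk, hΓ, real_inner_self_eq_norm_sq]
  have e2 : k α α = Γ α + ‖w α‖ ^ 2 := by simp only [hk, hΓ, real_inner_self_eq_norm_sq]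
  have e3 : c = 1 - 2 / (a + 2) := by rw [hc]; field_simp; ring
  have e4 : ‖w β‖ ^ 2 + 2 / (a + 2) * Γ β = ‖w α‖ ^ 2 + 2 / (a + 2) * Γ α := by
    rw [e1, e2, e3] at hX0
    linear_combination hX0
  exact e4

end IsNLS

/-! ### Weighted Hardy inequality and coercivity on odd functions. -/

/-- The weight `(1 + |x|) ^ (-k)`. -/
noncomputable def rinv (k : ℕ) (x : ℝ) : ℝ := ((1 + |x|) ^ k)⁻¹

theorem rinv_pos (k : ℕ) (x : ℝ) : 0 < rinv k x := inv_pos.2 (pow_pos (one_add_abs_pos x) k)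

theorem rinv_le_one (k : ℕ) (x : ℝ) : rinv k x ≤ 1 :=
  inv_le_one_of_one_le₀ (one_le_pow₀ (one_le_one_add_abs x))

theorem abs_rinv_le_one (k : ℕ) (x : ℝ) : |rinv k x| ≤ 1 := by
  rw [abs_of_pos (rinv_pos k x)]; exact rinv_le_one k x

theorem rinv_add (k l : ℕ) (x : ℝ) : rinv (k + l) x = rinv k x * rinv l x := by
  rw [rinv, rinv, rinv, pow_add, mul_inv]

theorem rinv_anti {k l : ℕ} (h : k ≤ l) (x : ℝ) : rinv l x ≤ rinv k x :=
  inv_anti₀ (pow_pos (one_add_abs_pos x) k) (pow_le_pow_right₀ (one_le_one_add_abs x) h)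

theorem psi₁_eq_rinv : psi₁ = rinv 2 := rfl

theorem psi₂_eq (x : ℝ) : psi₂ x = -2 * sgn x * rinv 3 x := rfl

theorem continuous_rinv (k : ℕ) : Continuous (rinv k) := by
  unfold rinv
  exact Continuous.inv₀ (by fun_prop) fun x => pow_ne_zero k (one_add_abs_pos x).ne'

theorem isMult_rinv (k : ℕ) : IsMult (rinv k) :=
  ⟨(continuous_rinv k).measurable, 1, abs_rinv_le_one k⟩

theorem isMult_sgn_mul_rinv (c : ℝ) (k : ℕ) : IsMult (fun x => c * sgn x * rinv k x) := by
  refine ⟨((measurable_sgn.const_mul c).mul (continuous_rinv k).measurable), |c|, fun x => ?_⟩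
  rw [abs_mul, abs_mul, abs_sgn, mul_one]
  exact mul_le_of_le_one_right (abs_nonneg _) (abs_rinv_le_one k x)

theorem IsMult.intervalIntegrable {m : ℝ → ℝ} (hm : IsMult m) (a b : ℝ) :
    IntervalIntegrable m volume a b := by
  obtain ⟨h, C, hC⟩ := hm
  exact (intervalIntegrable_const (c := C)).mono_fun h.aestronglyMeasurable
    (ae_of_all _ fun x => (hC x).trans (le_abs_self C))

theorem acd_rinv (k : ℕ) : ACD (rinv k) (fun x => -(k : ℝ) * sgn x * rinv (k + 1) x) := by
  refine ACD.of_hasDerivAt_off_zero (continuous_rinv k) (fun x hx => ?_)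
    (isMult_sgn_mul_rinv _ _).intervalIntegrable
  have hne := (one_add_abs_pos x).ne'
  refine (((hasDerivAt_one_add_abs hx).pow k).inv (pow_ne_zero k hne)).congr_deriv ?_
  simp only [Pi.pow_apply, rinv]
  rcases Nat.eq_zero_or_pos k with rfl | hk
  · simp
  · obtain ⟨j, rfl⟩ : ∃ j, k = j + 1 := ⟨k - 1, by omega⟩
    simp only [Nat.add_sub_cancel]
    push_cast
    field_simp
    ring

theorem sgn_mul_self (x : ℝ) : sgn x * sgn x = 1 := by
  rw [← abs_mul_abs_self, abs_sgn, one_mul]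

/-- Vanishing at 0 removes the jump of the sign. For squares of odd H¹ functions this is what lets
both half-lines be integrated at once without a boundary term. -/
theorem ACD.sgn_mul {F f : ℝ → ℝ} (h : ACD F f) (h0 : F 0 = 0) :
    ACD (fun x => sgn x * F x) (fun x => sgn x * f x) := by
  have hi : ∀ a b, IntervalIntegrable (fun x => sgn x * f x) volume a b := fun a b =>
    (h.intervalIntegrable a b).mono_fun
      (measurable_sgn.aestronglyMeasurable.mul
        h.locallyIntegrable.aestronglyMeasurable.restrict)
      (ae_of_all _ fun x => by simp only [norm_mul, Real.norm_eq_abs, abs_sgn, one_mul]; exact le_rfl)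
  refine ACD.of_integral 0 hi fun x => ?_
  have h1 := h.integral_eq_sub 0 x
  rw [h0, sub_zero] at h1
  rw [← h1, zero_add, ← intervalIntegral.integral_const_mul]
  refine intervalIntegral.integral_congr_ae ?_
  filter_upwards [ae_ne_zero] with y hy0 hy
  congr 1
  unfold sgn
  rcases le_or_gt 0 x with hx | hx
  · rw [Set.uIoc_of_le hx] at hy
    rw [if_neg (not_lt.2 hx), if_neg (not_lt.2 hy.1.le)]
  · rw [Set.uIoc_of_ge hx.le] at hy
    rw [if_pos hx, if_pos (lt_of_le_of_ne hy.2 hy0)]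

section

variable {f g : L2}

theorem norm_mulL_sq_eq {m : ℝ → ℝ} (hm : IsMult m) (f : L2) :
    ‖mulL m f‖ ^ 2 = ∫ x, m x ^ 2 * ‖f x‖ ^ 2 := by
  rw [L2.norm_sq_eq_integral]
  refine integral_congr_ae ?_
  filter_upwards [mulL_ae hm f] with x hx
  rw [hx, norm_smul, mul_pow, Real.norm_eq_abs, sq_abs]

theorem integrable_mulL_sq {m : ℝ → ℝ} (hm : IsMult m) (f : L2) :
    Integrable fun x => m x ^ 2 * ‖f x‖ ^ 2 := by
  refine (L2.integrable_norm_sq (mulL m f)).congr ?_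
  filter_upwards [mulL_ae hm f] with x hx
  rw [hx, norm_smul, mul_pow, Real.norm_eq_abs, sq_abs]

theorem inner_mulL_psi₁_eq (g : L2) : (inner ℝ (mulL psi₁ g) g : ℝ) = ‖mulL (rinv 1) g‖ ^ 2 := by
  rw [norm_mulL_sq_eq (isMult_rinv 1), inner_mulL_eq_integral isVirialMult_psi.mult']
  refine integral_congr_ae (ae_of_all _ fun x => ?_)
  simp only [real_inner_self_eq_norm_sq, psi₁_eq_rinv]
  rw [sq (rinv 1 x), ← rinv_add]

theorem integrable_rinv_three (f g : L2) : Integrable fun x => rinv 3 x * (‖f x‖ * ‖g x‖) := by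
  refine (L2.integrable_mul_norm f g).mono'
    ((continuous_rinv 3).aestronglyMeasurable.mul (L2.integrable_mul_norm f g).aestronglyMeasurable)
    (ae_of_all _ fun x => ?_)
  rw [norm_mul, Real.norm_eq_abs, Real.norm_of_nonneg (by positivity)]
  exact mul_le_of_le_one_left (by positivity) (abs_rinv_le_one 3 x)

/-- Cauchy–Schwarz with the weight split as 3 = 2 + 1: decay 2 on the function and 1 on its
derivative, the pair that the Hardy inequality relates. -/
theorem integral_rinv_three_le (f g : L2) :
    ∫ x, rinv 3 x * (‖f x‖ * ‖g x‖) ≤ ‖mulL (rinv 2) f‖ * ‖mulL (rinv 1) g‖ := by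
  refine le_trans (le_of_eq ?_) (L2.integral_mul_norm_le _ _)
  refine integral_congr_ae ?_
  filter_upwards [mulL_ae (isMult_rinv 2) f, mulL_ae (isMult_rinv 1) g] with x h1 h2
  rw [h1, h2, norm_smul, norm_smul, Real.norm_of_nonneg (rinv_pos _ x).le,
    Real.norm_of_nonneg (rinv_pos _ x).le, rinv_add 2 1]
  ring

/-- Weighted Hardy identity for odd functions. -/
theorem OddH1.inner_psi₂_eq (h : OddH1 f g) :
    (inner ℝ (mulL psi₂ f) g : ℝ) = -3 * ‖mulL (rinv 2) f‖ ^ 2 := by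
  obtain ⟨F, hF, h0⟩ := h.exists_rep
  have hψ := isVirialMult_psi
  -- The identity says that the derivative of sgn(x)(1+|x|)^{-3}|F|² integrates to 0. The two sign
  -- factors cancel through sgn² = 1.
  have h1 := (acd_rinv 3).mul (hF.acd_normSq.sgn_mul (by simp [h0]))
  have i1 := integrable_mul_inner hψ.mult'' f g
  have i2 := (integrable_mulL_sq (isMult_rinv 2) f).const_mul (-3)
  have h2 := h1.integral_eq_zero ?_ ((i2.sub i1).congr ?_)
  · rw [inner_mulL_eq_integral hψ.mult'', norm_mulL_sq_eq (isMult_rinv 2), ← integral_const_mul]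
    have h3 := integral_sub i2 i1
    have h4 : ∫ x, (-3 * (rinv 2 x ^ 2 * ‖f x‖ ^ 2) - psi₂ x * inner ℝ (f x) (g x)) = 0 := by
      rw [← h2]
      refine integral_congr_ae ?_
      filter_upwards [hF.ae_eq] with x hx
      rw [psi₂_eq, rinv_add 2 2 x, hx, real_inner_comm (g x)]
      push_cast
      linear_combination (3 * rinv 2 x ^ 2 * ‖F x‖ ^ 2) * sgn_mul_self x
    rw [h4] at h3
    linarith
  · refine hF.integrable_normSq.mono' ((h1.continuous).aestronglyMeasurable)
      (ae_of_all _ fun x => ?_)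
    rw [norm_mul, norm_mul, Real.norm_eq_abs, Real.norm_eq_abs, abs_sgn, one_mul,
      Real.norm_of_nonneg (by positivity)]
    exact mul_le_of_le_one_left (by positivity) (abs_rinv_le_one 3 x)
  · filter_upwards [hF.ae_eq] with x hx
    simp only [Pi.sub_apply]
    rw [psi₂_eq, rinv_add 2 2 x, hx, real_inner_comm (g x)]
    push_cast
    linear_combination (3 * rinv 2 x ^ 2 * ‖F x‖ ^ 2) * sgn_mul_self x

/-- Weighted Hardy inequality for odd functions. -/
theorem OddH1.norm_rinv_two_le (h : OddH1 f g) :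
    ‖mulL (rinv 2) f‖ ≤ 2 / 3 * ‖mulL (rinv 1) g‖ := by
  have h1 := h.inner_psi₂_eq
  have hψ := isVirialMult_psi
  have h2 : -(inner ℝ (mulL psi₂ f) g : ℝ) ≤ 2 * (‖mulL (rinv 2) f‖ * ‖mulL (rinv 1) g‖) := by
    refine le_trans ?_ (mul_le_mul_of_nonneg_left (integral_rinv_three_le f g) zero_le_two)
    rw [inner_mulL_eq_integral hψ.mult'', ← integral_neg, ← integral_const_mul]
    refine integral_mono (integrable_mul_inner hψ.mult'' f g).neg
      ((integrable_rinv_three f g).const_mul 2) fun x => ?_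
    refine (neg_le_abs _).trans ?_
    rw [abs_mul, abs_psi₂_eq]
    have := abs_real_inner_le_norm (f x) (g x)
    have h3 := (rinv_pos 3 x).le
    calc 2 * ((1 + |x|) ^ 3)⁻¹ * |inner ℝ (f x) (g x)|
        ≤ 2 * rinv 3 x * (‖f x‖ * ‖g x‖) := by unfold rinv; gcongr
      _ = _ := by ring
  rw [h1] at h2
  have h3 := norm_nonneg (mulL (rinv 2) f)
  rcases h3.eq_or_lt with h4 | h4
  · rw [← h4]; positivity
  · have : ‖mulL (rinv 2) f‖ * (3 * ‖mulL (rinv 2) f‖) ≤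
      ‖mulL (rinv 2) f‖ * (2 * ‖mulL (rinv 1) g‖) := by nlinarith
    have := le_of_mul_le_mul_left this h4
    linarith

/-- Coercivity of the linear part of the virial identity on odd functions. -/
theorem OddH1.virial_coercive (h : OddH1 f g) :
    2 / 3 * inner ℝ (mulL psi₁ g) g ≤
      2 * inner ℝ (mulL psi₁ g) g + (inner ℝ (mulL psi₂ f) g : ℝ) := by
  have h1 := h.norm_rinv_two_le
  rw [h.inner_psi₂_eq, inner_mulL_psi₁_eq]
  have := pow_le_pow_left₀ (norm_nonneg _) h1 2
  rw [mul_pow] at this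
  linarith

/-- The weight (1+R)³(1+|x|)^{-3} is at least 1 on [−R, R]. In the product on the right one factor
will decay in time while the other merely stays bounded. -/
theorem OddH1.ae_normSq_le_of_abs_le (h : OddH1 f g) {R : ℝ} (hR : 0 ≤ R) :
    ∀ᵐ x, |x| ≤ R → ‖f x‖ ^ 2 ≤
      2 * (1 + R) ^ 3 * (‖mulL (rinv 2) f‖ * ‖mulL (rinv 1) g‖) := by
  obtain ⟨F, hF, h0⟩ := h.exists_rep
  filter_upwards [hF.ae_eq] with x hx hxR
  rw [hx]
  have h1 := hF.normSq_le_weighted h0 (R := R) (W := fun x => (1 + R) ^ 3 * rinv 3 x)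
    (fun x => mul_nonneg (by positivity) (rinv_pos 3 x).le) (fun y hy => by
      rw [rinv, ← div_eq_mul_inv, one_le_div (pow_pos (one_add_abs_pos y) 3)]
      have := one_add_abs_pos y
      gcongr)
    (((integrable_rinv_three f g).const_mul ((1 + R) ^ 3)).congr
      (ae_of_all _ fun x => by simp only []; ring)) hxR
  refine h1.trans ?_
  simp only [mul_assoc]
  rw [integral_const_mul]
  have := integral_rinv_three_le f g
  gcongr

end

/-! ### The nonlinear part of the virial identity. -/

section Nonlinear

variable {a b C : ℝ} {K : ℝ → ℝ} {f g : L2}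

theorem CoeffBound.differentiableAt (hK : CoeffBound b C K) {x : ℝ} (hx : x ≠ 0) :
    DifferentiableAt ℝ K x :=
  (hK.contDiffOn.contDiffAt (isOpen_compl_singleton.mem_nhds hx)).differentiableAt one_ne_zero

theorem CoeffBound.abs_psi_mul_deriv_le (hK : CoeffBound b C K) {x : ℝ} (hx : x ≠ 0) :
    |psi x * deriv K x| ≤ C * |x| ^ (-b) := by
  have hx0 := abs_pos.2 hx
  have hC := hK.C_nonneg
  have h1 : |psi x| ≤ |x| := by
    rw [abs_psi_eq]; exact div_le_self hx0.le (one_le_one_add_abs x)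
  rw [abs_mul]
  calc |psi x| * |deriv K x| ≤ |x| * (C * |x| ^ (-b - 1)) := by
        gcongr; exact hK.bound' x hx
    _ = C * (|x| ^ (-b - 1) * |x|) := by ring
    _ = C * |x| ^ (-b) := by rw [← Real.rpow_add_one hx0.ne']; norm_num

theorem CoeffBound.abs_psi₁_mul_le (hK : CoeffBound b C K) {x : ℝ} (hx : x ≠ 0) :
    |psi₁ x * K x| ≤ C * |x| ^ (-b) := by
  rw [abs_mul]
  exact (mul_le_of_le_one_left (abs_nonneg _) (abs_psi₁_le x)).trans (hK.bound x hx)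

/-- The product is O(|x|^{1−b}) at the origin, hence continuous there, and its derivative is
O(|x|^{-b}), hence locally integrable. Both facts use b < 1; together they allow integration by
parts across the singularity. -/
theorem CoeffBound.acd_psi_mul (hK : CoeffBound b C K) :
    ACD (fun x => psi x * K x) (fun x => psi₁ x * K x + psi x * deriv K x) := by
  have hψ := isVirialMult_psi
  have hb := hK.b_lt
  refine ACD.of_hasDerivAt_off_zero ?_ ?_ ?_
  · rw [continuous_iff_continuousAt]
    intro x
    rcases eq_or_ne x 0 with rfl | hx
    · have h0 : psi 0 * K 0 = 0 := by simp [psi]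
      rw [ContinuousAt, h0]
      have hlim : Tendsto (fun x : ℝ => C * |x| ^ (1 - b)) (𝓝 0) (𝓝 0) := by
        have : Continuous fun x : ℝ => C * |x| ^ (1 - b) :=
          continuous_const.mul (continuous_abs.rpow_const fun _ => Or.inr (by linarith))
        have h := this.tendsto 0
        rwa [abs_zero, Real.zero_rpow (by linarith), mul_zero] at h
      refine squeeze_zero_norm (fun x => ?_) hlim
      rcases eq_or_ne x 0 with rfl | hx
      · rw [h0, norm_zero, abs_zero, Real.zero_rpow (by linarith), mul_zero]
      · have hx0 := abs_pos.2 hx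
        have hC := hK.C_nonneg
        have h1 : |psi x| ≤ |x| := by
          rw [abs_psi_eq]; exact div_le_self hx0.le (one_le_one_add_abs x)
        rw [norm_mul, Real.norm_eq_abs, Real.norm_eq_abs]
        calc |psi x| * |K x| ≤ |x| * (C * |x| ^ (-b)) := by gcongr; exact hK.bound x hx
          _ = C * (|x| ^ (-b) * |x|) := by ring
          _ = C * |x| ^ (1 - b) := by
              rw [← Real.rpow_add_one hx0.ne', neg_add_eq_sub]
    · exact hψ.acd.continuous.continuousAt.mul (hK.differentiableAt hx).continuousAt
  · intro x hx
    have h1 : HasDerivAt psi (psi₁ x) x := by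
      have hne := (one_add_abs_pos x).ne'
      refine ((hasDerivAt_id x).div (hasDerivAt_one_add_abs hx) hne).congr_deriv ?_
      have h2 : x * sgn x = |x| := by
        nth_rw 1 [← sgn_mul_abs x]
        linear_combination |x| * sgn_mul_self x
      rw [psi₁, id, h2]
      field_simp
      ring
    exact h1.mul (hK.differentiableAt hx).hasDerivAt
  · intro p q
    have hloc : LocallyIntegrable (fun x : ℝ => 2 * C * (nearPow (-b) x + 1)) volume :=
      (((integrable_nearPow (by linarith)).locallyIntegrable).add
        (locallyIntegrable_const 1)).smul (2 * C)
    have hint : IntervalIntegrable (fun x : ℝ => 2 * C * (nearPow (-b) x + 1)) volume p q :=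
      intervalIntegrable_iff.2 ((locallyIntegrable_iff.1 hloc _ isCompact_uIcc).mono_set
        Set.uIoc_subset_uIcc)
    refine hint.mono_fun ?_ ?_
    · exact ((hψ.mult'.1.aestronglyMeasurable.mul hK.aestronglyMeasurable).add
        (hψ.mult.1.aestronglyMeasurable.mul (measurable_deriv K).aestronglyMeasurable)).restrict
    · refine ae_restrict_of_ae ?_
      filter_upwards [ae_ne_zero] with x hx
      have h1 := hK.abs_psi_mul_deriv_le hx
      have h2 := hK.abs_psi₁_mul_le hx
      have h3 := abs_rpow_neg_le_nearPow_add hK.b_pos x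
      have h4 := mul_le_mul_of_nonneg_left h3 hK.C_nonneg
      refine (abs_add_le _ _).trans (le_trans ?_ (le_abs_self _))
      linarith

/-- The chain rule is applied to |F|² with the exponent (a+2)/2, which exceeds 1; the outer function
is thus C¹ even where F vanishes. -/
theorem IsRep.acd_rpow {F : ℝ → ℂ} (ha : 0 < a) (hF : IsRep f g F) :
    ACD (fun x => ‖F x‖ ^ (a + 2)) (fun x => (a + 2) * (‖F x‖ ^ a * inner ℝ (g x) (F x))) := by
  have h1 := hF.acd_normSq.comp (Φ := fun y => y ^ ((a + 2) / 2))
    (Φ' := fun y => (a + 2) / 2 * y ^ ((a + 2) / 2 - 1))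
    (fun y => Real.hasDerivAt_rpow_const (Or.inr (by linarith)))
    (continuous_const.mul (continuous_id.rpow_const fun _ => Or.inr (by linarith)))
  have e : ∀ (z : ℂ) (s : ℝ), (‖z‖ ^ 2) ^ s = ‖z‖ ^ (2 * s) := fun z s => by
    rw [Real.rpow_mul (norm_nonneg _)]; norm_cast
  have e1 : 2 * ((a + 2) / 2) = a + 2 := by ring
  have e2 : 2 * ((a + 2) / 2 - 1) = a := by ring
  simp only [e, e1, e2] at h1
  convert h1 using 2
  ring

theorem norm_rpow_add_two {a : ℝ} (ha : 0 < a) (z : ℂ) : ‖z‖ ^ (a + 2) = ‖z‖ ^ a * ‖z‖ ^ 2 := by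
  rw [Real.rpow_add' (norm_nonneg _) (by linarith)]; norm_cast

theorem OddH1.integrable_weight_mul_rpow (h : OddH1 f g) (ha : 0 < a) (hb0 : 0 < b) (hb1 : b < 1) :
    Integrable fun x => |x| ^ (-b) * ‖f x‖ ^ (a + 2) := by
  have h1 : Integrable fun x => |x| ^ (-b) * ‖f x‖ * ‖f x‖ :=
    (h.memLp_weight hb0 hb1).integrable_mul (Lp.memLp f).norm
  set R := max ‖f‖ ‖g‖
  refine (h1.const_mul ((2 * R) ^ a)).mono' ?_ ?_
  · exact (by fun_prop : Measurable fun x : ℝ => |x| ^ (-b)).aestronglyMeasurable.mul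
      ((continuous_norm.rpow_const fun _ => Or.inr (by linarith)).comp_aestronglyMeasurable
        (Lp.aestronglyMeasurable f))
  · filter_upwards [h.ae_norm_le (le_max_left _ _) (le_max_right _ _)] with x hx
    rw [Real.norm_of_nonneg (by positivity), norm_rpow_add_two ha]
    have h2 : ‖f x‖ ^ a ≤ (2 * R) ^ a := Real.rpow_le_rpow (norm_nonneg _) hx ha.le
    calc |x| ^ (-b) * (‖f x‖ ^ a * ‖f x‖ ^ 2) = ‖f x‖ ^ a * (|x| ^ (-b) * ‖f x‖ * ‖f x‖) := by ring
      _ ≤ _ := by gcongr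

theorem OddH1.integrable_mul_rpow (h : OddH1 f g) (ha : 0 < a) (hK : CoeffBound b C K)
    {m : ℝ → ℝ} (hm : AEStronglyMeasurable m volume)
    (hmb : ∀ x, x ≠ 0 → |m x| ≤ C * |x| ^ (-b)) :
    Integrable fun x => m x * ‖f x‖ ^ (a + 2) := by
  refine ((h.integrable_weight_mul_rpow ha hK.b_pos hK.b_lt).const_mul C).mono' ?_ ?_
  · exact hm.mul ((continuous_norm.rpow_const fun _ => Or.inr (by linarith)).comp_aestronglyMeasurable
        (Lp.aestronglyMeasurable f))
  · filter_upwards [ae_ne_zero] with x hx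
    rw [norm_mul, Real.norm_eq_abs, Real.norm_of_nonneg (by positivity), ← mul_assoc]
    exact mul_le_mul_of_nonneg_right (hmb x hx) (by positivity)

theorem OddH1.integrable_psi₁_mul_rpow (h : OddH1 f g) (ha : 0 < a) (hK : CoeffBound b C K) :
    Integrable fun x => psi₁ x * K x * ‖f x‖ ^ (a + 2) :=
  h.integrable_mul_rpow ha hK
    (isVirialMult_psi.mult'.1.aestronglyMeasurable.mul hK.aestronglyMeasurable)
    fun _ hx => hK.abs_psi₁_mul_le hx

theorem OddH1.integrable_psi_deriv_mul_rpow (h : OddH1 f g) (ha : 0 < a) (hK : CoeffBound b C K) :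
    Integrable fun x => psi x * deriv K x * ‖f x‖ ^ (a + 2) :=
  h.integrable_mul_rpow ha hK
    (isVirialMult_psi.mult.1.aestronglyMeasurable.mul (measurable_deriv K).aestronglyMeasurable)
    fun _ hx => hK.abs_psi_mul_deriv_le hx

theorem OddH1.inner_nl_psi₁ (h : OddH1 f g) (ha : 0 < a) (hK : CoeffBound b C K) :
    (inner ℝ (nl a K f) (mulL psi₁ f) : ℝ) = ∫ x, psi₁ x * K x * ‖f x‖ ^ (a + 2) := by
  rw [L2.inner_def]
  refine integral_congr_ae ?_
  filter_upwards [nl_ae ha hK h, mulL_ae isVirialMult_psi.mult' f] with x h1 h2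
  rw [h1, h2, real_inner_smul_left, real_inner_smul_right, inner_pw_self, norm_rpow_add_two ha]
  ring

/-- The nonlinear part of the virial identity, after integration by parts. -/
theorem OddH1.inner_nl_psi (h : OddH1 f g) (ha : 0 < a) (hK : CoeffBound b C K) :
    (a + 2) * (inner ℝ (nl a K f) (mulL psi g) : ℝ) =
      -((∫ x, psi₁ x * K x * ‖f x‖ ^ (a + 2)) + ∫ x, psi x * deriv K x * ‖f x‖ ^ (a + 2)) := by
  obtain ⟨F, hF, h0⟩ := h.exists_rep
  have hψ := isVirialMult_psi
  have i1 := h.integrable_psi₁_mul_rpow ha hK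
  have i2 := h.integrable_psi_deriv_mul_rpow ha hK
  have i3 := (L2.integrable_inner (𝕜 := ℝ) (nl a K f) (mulL psi g)).const_mul (a + 2)
  have h1 := hK.acd_psi_mul.mul (hF.acd_rpow ha)
  have hae : ∀ᵐ x, psi₁ x * K x * ‖f x‖ ^ (a + 2) + psi x * deriv K x * ‖f x‖ ^ (a + 2) +
      (a + 2) * inner ℝ (nl a K f x) (mulL psi g x) =
      (psi₁ x * K x + psi x * deriv K x) * ‖F x‖ ^ (a + 2) +
      psi x * K x * ((a + 2) * (‖F x‖ ^ a * inner ℝ (g x) (F x))) := by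
    filter_upwards [nl_ae ha hK h, mulL_ae hψ.mult g, hF.ae_eq] with x e1 e2 e3
    rw [e1, e2, e3, real_inner_smul_left, real_inner_smul_right, pw, real_inner_smul_left,
      real_inner_comm (g x)]
    ring
  have h2 := h1.integral_eq_zero ?_ (((i1.add i2).add i3).congr hae)
  · have h3 := integral_add (i1.add i2) i3
    have h4 := integral_add i1 i2
    rw [integral_const_mul] at h3
    have h5 := integral_congr_ae hae
    rw [L2.inner_def]
    have h6 : ∫ x, (psi₁ x * K x * ‖f x‖ ^ (a + 2) + psi x * deriv K x * ‖f x‖ ^ (a + 2) +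
      (a + 2) * inner ℝ (nl a K f x) (mulL psi g x)) =
      ((∫ x, psi₁ x * K x * ‖f x‖ ^ (a + 2)) + ∫ x, psi x * deriv K x * ‖f x‖ ^ (a + 2)) +
      (a + 2) * ∫ x, inner ℝ (nl a K f x) (mulL psi g x) := by
      rw [← h4]; exact h3
    linarith
  · have i4 := h.integrable_mul_rpow (m := fun x => psi x * K x) ha hK
      (hψ.mult.1.aestronglyMeasurable.mul hK.aestronglyMeasurable) (fun x hx => by
        rw [abs_mul]
        exact (mul_le_of_le_one_left (abs_nonneg _) (abs_psi_le x)).trans (hK.bound x hx))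
    refine i4.congr ?_
    filter_upwards [hF.ae_eq] with x hx
    rw [hx]

/-- The nonlinearity is pointwise a real multiple of f, so i times it is orthogonal to f. The mass
laws therefore have no source term. -/
theorem inner_mulL_I_nl (h : OddH1 f g) (ha : 0 < a) (hK : CoeffBound b C K) {m : ℝ → ℝ}
    (hm : IsMult m) : (inner ℝ (mulL m f) (Complex.I • nl a K f) : ℝ) = 0 := by
  rw [L2.inner_def, ← integral_zero ℝ ℝ]
  refine integral_congr_ae ?_
  filter_upwards [nl_ae ha hK h, mulL_ae hm f, Lp.coeFn_smul Complex.I (nl a K f)] with x e1 e2 e3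
  rw [e2, e3, Pi.smul_apply, e1, pw, smul_comm Complex.I, smul_comm Complex.I,
    real_inner_smul_left, real_inner_smul_right, real_inner_smul_right]
  have : inner ℝ (f x) (Complex.I • f x) = 0 := by
    simp [Complex.inner]; ring
  rw [this]; simp

end Nonlinear

/-! ### The integrated equation, conservation of mass, and local mass. -/

theorem isMult_const (c : ℝ) : IsMult fun _ => c := ⟨measurable_const, |c|, fun _ => le_rfl⟩

theorem acd_const (c : ℝ) : ACD (fun _ => c) (fun _ => 0) :=
  ⟨fun _ _ => (LipschitzWith.const c).lipschitzOnWith.absolutelyContinuousOnInterval,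
    ae_of_all _ fun x => hasDerivAt_const x c⟩

theorem mulL_one (f : L2) : mulL (fun _ => 1) f = f := by
  refine Lp.ext ?_
  filter_upwards [mulL_ae (isMult_const 1) f] with x hx
  rw [hx, one_smul]

theorem mulL_zero_left (f : L2) : mulL (fun _ => 0) f = 0 := by
  refine Lp.ext ?_
  filter_upwards [mulL_ae (isMult_const 0) f, Lp.coeFn_zero ℂ 2 (volume : Measure ℝ)] with x hx h0
  rw [hx, zero_smul, h0, Pi.zero_apply]

/-- The `H¹` curve of a global odd solution satisfies the time-integrated equation in `L²`. -/
theorem IsGlobalSolution.isNLS {σ b C : ℝ} {K : ℝ → ℝ} {u₀ : H1} {u : ℝ → H1} (hσ : 0 < σ)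
    (hK : CoeffBound b C K) (hu : IsGlobalSolution σ K u₀ u) (ho : ∀ t, IsOdd (u t)) :
    IsNLS (2 * σ) b C K (fun t => (u t).1.fst) (fun t => (u t).1.snd) := by
  have ha : 0 < 2 * σ := by linarith
  have cu : Continuous fun t => (u t).1 := continuous_subtype_val.comp hu.continuous
  have cv : Continuous fun t => (u t).1.fst := (WithLp.continuous_fst 2 L2 L2).comp cu
  have cw : Continuous fun t => (u t).1.snd := (WithLp.continuous_snd 2 L2 L2).comp cu
  have odd : ∀ t, OddH1 (u t).1.fst (u t).1.snd := fun t => ⟨(u t).2, ho t⟩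
  have cn := continuous_nl ha hK cv cw odd
  refine ⟨ha, hK, ⟨cv, cw, cn, fun t => (odd t).wd, fun s t => ?_⟩, odd⟩
  rw [wd_iff]
  intro η hη hc
  have cη := hη.continuous
  have cη' : Continuous (deriv η) := hη.continuous_deriv (by simp)
  have hd : ∀ r, HasDerivAt (fun r => pairing η cη hc (u r).1.fst)
      (-Complex.I * (pairing (deriv η) cη' hc.deriv (u r).1.snd +
        pairing η cη hc (nl (2 * σ) K (u r).1.fst))) r := by
    intro r
    have h := hu.equation η hη hc r
    have e1 : (fun s => ∫ x, fn (u s) x * η x) = fun r => pairing η cη hc (u r).1.fst := by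
      funext s; rw [pairing_apply]; rfl
    have e2 : ∫ x, ((K x * ‖fn (u r) x‖ ^ (2 * σ) : ℝ) : ℂ) * fn (u r) x * η x =
        pairing η cη hc (nl (2 * σ) K (u r).1.fst) := by
      rw [pairing_apply]
      refine integral_congr_ae ?_
      filter_upwards [nl_ae ha hK (odd r)] with x hx
      rw [hx, pw, smul_smul, Complex.real_smul]
      rfl
    have e3 : ∫ x, dfn (u r) x * deriv η x = pairing (deriv η) cη' hc.deriv (u r).1.snd := by
      rw [pairing_apply]; rfl
    rwa [e1, e2, e3] at h
  have c1 : Continuous fun r => pairing (deriv η) cη' hc.deriv (u r).1.snd := by fun_prop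
  have c2 : Continuous fun r => pairing η cη hc (nl (2 * σ) K (u r).1.fst) := by fun_prop
  -- The pairing with each test function is C¹ in time. The fundamental theorem of calculus, with
  -- pairings pulled out of the time integrals, gives the equation integrated between s and t.
  have hF := intervalIntegral.integral_eq_sub_of_hasDerivAt (a := s) (b := t) (fun r _ => hd r)
    ((continuous_const.mul (c1.add c2)).intervalIntegrable s t)
  rw [intervalIntegral.integral_const_mul, intervalIntegral.integral_add
    (c1.intervalIntegrable _ _) (c2.intervalIntegrable _ _),
    ContinuousLinearMap.intervalIntegral_comp_comm _ (cw.intervalIntegrable _ _),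
    ContinuousLinearMap.intervalIntegral_comp_comm _ (cn.intervalIntegrable _ _)] at hF
  rw [map_sub, map_smul, map_sub, smul_eq_mul, ← hF]
  linear_combination (pairing (deriv η) cη' hc.deriv (∫ r in s..t, (u r).1.snd) +
    pairing η cη hc (∫ r in s..t, nl (2 * σ) K (u r).1.fst)) * Complex.I_mul_I

namespace IsNLS

variable {a b C : ℝ} {K : ℝ → ℝ} {v w : ℝ → L2}

theorem inner_mulL_sub_eq (H : IsNLS a b C K v w) {m m' : ℝ → ℝ} (hm : IsMult m) (hm' : IsMult m')
    (hmm' : ACD m m') (α β : ℝ) :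
    (inner ℝ (mulL m (v β)) (v β) : ℝ) - inner ℝ (mulL m (v α)) (v α) =
    ∫ t in α..β, (-2 * inner ℝ (mulL m' (v t)) (Complex.I • w t) : ℝ) := by
  rw [H.sol.mass_balance hm hm' hmm']
  simp only [inner_mulL_I_nl (H.odd _) H.a_pos H.coeff hm, mul_zero, sub_zero]

/-- Conservation of the `L²` norm. -/
theorem norm_eq (H : IsNLS a b C K v w) (α β : ℝ) : ‖v β‖ = ‖v α‖ := by
  have h := H.inner_mulL_sub_eq (isMult_const 1) (isMult_const 0) (acd_const 1) α β
  simp only [mulL_one, mulL_zero_left, inner_zero_left, mul_zero, intervalIntegral.integral_zero,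
    real_inner_self_eq_norm_sq, sub_eq_zero] at h
  exact (pow_left_inj₀ (norm_nonneg _) (norm_nonneg _) two_ne_zero).1 h

theorem continuous_inner_psi₁ (H : IsNLS a b C K v w) :
    Continuous fun t => (inner ℝ (mulL psi₁ (w t)) (w t) : ℝ) := by
  have := H.sol.cw
  fun_prop

theorem continuous_virial_nl (H : IsNLS a b C K v w) :
    Continuous fun t => (2 * inner ℝ (nl a K (v t)) (mulL psi (w t)) +
      inner ℝ (nl a K (v t)) (mulL psi₁ (v t)) : ℝ) := by
  have := H.sol.cw
  have := H.sol.cv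
  have := H.sol.cn
  fun_prop

/-- Integrated virial estimate. -/
theorem integral_virial_le (H : IsNLS a b C K v w) {M : ℝ} (hv : ∀ t, ‖v t‖ ≤ M)
    (hw : ∀ t, ‖w t‖ ≤ M) {α β : ℝ} (hαβ : α ≤ β) :
    ∫ t in α..β, (2 / 3 * inner ℝ (mulL psi₁ (w t)) (w t) +
      (2 * inner ℝ (nl a K (v t)) (mulL psi (w t)) +
        inner ℝ (nl a K (v t)) (mulL psi₁ (v t))) : ℝ) ≤ 2 * M ^ 2 := by
  have cv := H.sol.cv
  have cw := H.sol.cw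
  have cn := H.sol.cn
  have hb : ∀ t, |(inner ℝ (Complex.I • v t) (mulL psi (w t)) : ℝ)| ≤ M ^ 2 := fun t => by
    refine (abs_real_inner_le_norm _ _).trans ?_
    have h1 := norm_mulL_le isVirialMult_psi.mult abs_psi_le (w t)
    rw [norm_I_smul, sq]
    exact mul_le_mul (hv t) (h1.trans (by rw [one_mul]; exact hw t)) (norm_nonneg _)
      ((norm_nonneg _).trans (hv t))
  have h := H.sol.virial isVirialMult_psi α β
  have h1 := (abs_le.1 (hb α)).1
  have h2 := (abs_le.1 (hb β)).2
  refine le_trans (intervalIntegral.integral_mono_on hαβ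
    (Continuous.intervalIntegrable (by fun_prop) _ _)
    (Continuous.intervalIntegrable (by fun_prop) _ _) fun t _ => ?_) (h.symm.le.trans (by linarith))
  have := (H.odd t).virial_coercive
  linarith

/-- Almost monotonicity of the weighted local mass. -/
theorem norm_rinv_two_sq_sub_le (H : IsNLS a b C K v w) {s t : ℝ} (hst : s ≤ t) :
    ‖mulL (rinv 2) (v s)‖ ^ 2 - ‖mulL (rinv 2) (v t)‖ ^ 2 ≤
      16 / 3 * ∫ r in s..t, (inner ℝ (mulL psi₁ (w r)) (w r) : ℝ) := by
  have cv := H.sol.cv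
  have cw := H.sol.cw
  have e : ∀ f : L2, (inner ℝ (mulL (rinv 4) f) f : ℝ) = ‖mulL (rinv 2) f‖ ^ 2 := fun f => by
    rw [norm_mulL_sq_eq (isMult_rinv 2), inner_mulL_eq_integral (isMult_rinv 4)]
    refine integral_congr_ae (ae_of_all _ fun x => ?_)
    simp only [real_inner_self_eq_norm_sq]
    rw [sq (rinv 2 x), ← rinv_add]
  -- Differentiating (1+|x|)^{-4} produces decay 5, of which only 3 is used. Hardy then gives the
  -- rate 2·4·(2/3) = 16/3.
  have hm' := isMult_sgn_mul_rinv (-((4 : ℕ) : ℝ)) (4 + 1)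
  have h := H.inner_mulL_sub_eq (isMult_rinv 4) hm' (acd_rinv 4) s t
  rw [e, e] at h
  have h1 : ∫ r in s..t, -(16 / 3 * inner ℝ (mulL psi₁ (w r)) (w r)) ≤
      ∫ r in s..t, (-2 * inner ℝ (mulL (fun x => -((4 : ℕ) : ℝ) * sgn x * rinv (4 + 1) x) (v r))
        (Complex.I • w r) : ℝ) := by
    refine intervalIntegral.integral_mono_on hst (Continuous.intervalIntegrable (by fun_prop) _ _)
      (Continuous.intervalIntegrable (by fun_prop) _ _) fun r _ => ?_
    have h2 : |(inner ℝ (mulL (fun x => -((4 : ℕ) : ℝ) * sgn x * rinv (4 + 1) x) (v r))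
        (Complex.I • w r) : ℝ)| ≤ 4 * ∫ x, rinv 3 x * (‖v r x‖ * ‖w r x‖) := by
      rw [inner_mulL_eq_integral hm', ← integral_const_mul]
      refine (abs_integral_le_integral_abs).trans (integral_mono_ae
        (integrable_mul_inner hm' _ _).abs ((integrable_rinv_three _ _).const_mul 4) ?_)
      filter_upwards [Lp.coeFn_smul Complex.I (w r)] with x hx
      simp only [hx, Pi.smul_apply]
      rw [abs_mul, abs_mul, abs_mul, abs_sgn, mul_one, abs_of_pos (rinv_pos 5 x), mul_assoc]
      have h3 := abs_real_inner_le_norm (v r x) (Complex.I • w r x)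
      rw [norm_smul, Complex.norm_I, one_mul] at h3
      have h4 := rinv_anti (show 3 ≤ 5 by norm_num) x
      have h5 := (rinv_pos 3 x).le
      rw [abs_neg, Nat.abs_cast, Nat.cast_ofNat]
      gcongr
    have h3 := integral_rinv_three_le (v r) (w r)
    have h4 := (H.odd r).norm_rinv_two_le
    have h5 := mul_le_mul_of_nonneg_right h4 (norm_nonneg (mulL (rinv 1) (w r)))
    rw [inner_mulL_psi₁_eq]
    refine le_trans ?_ (mul_le_mul_of_nonpos_left ((le_abs_self _).trans h2) (by norm_num))
    linarith
  rw [← h, intervalIntegral.integral_neg, intervalIntegral.integral_const_mul] at h1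
  linarith

theorem inner_psi₁_nonneg (f : L2) : 0 ≤ (inner ℝ (mulL psi₁ f) f : ℝ) := by
  rw [inner_mulL_psi₁_eq]; positivity

/-- The weighted mass at a later time s is at most 4/9 of A(s) by Hardy, and almost monotonicity
carries this back to t. Averaging over s in [t, t+1] gives 4/9 + 16/3 = 52/9 < 6 times the integral
of A. -/
theorem norm_rinv_two_sq_le (H : IsNLS a b C K v w) (t : ℝ) :
    ‖mulL (rinv 2) (v t)‖ ^ 2 ≤
      6 * ∫ r in t..(t + 1), (inner ℝ (mulL psi₁ (w r)) (w r) : ℝ) := by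
  have cA := H.continuous_inner_psi₁
  set A := fun r => (inner ℝ (mulL psi₁ (w r)) (w r) : ℝ) with hA
  have h1 : ∀ s ∈ Set.Icc t (t + 1), ‖mulL (rinv 2) (v t)‖ ^ 2 ≤
      4 / 9 * A s + 16 / 3 * ∫ r in t..(t + 1), A r := by
    intro s hs
    have h2 := H.norm_rinv_two_sq_sub_le hs.1
    have h3 := pow_le_pow_left₀ (norm_nonneg _) (H.odd s).norm_rinv_two_le 2
    rw [mul_pow, ← inner_mulL_psi₁_eq] at h3
    have h4 : ∫ r in t..s, A r ≤ ∫ r in t..(t + 1), A r :=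
      intervalIntegral.integral_mono_interval le_rfl hs.1 hs.2
        (ae_of_all _ fun r => inner_psi₁_nonneg _) (cA.intervalIntegrable _ _)
    simp only [hA] at h4 ⊢
    linarith
  have h2 := intervalIntegral.integral_mono_on (by linarith : t ≤ t + 1)
    (intervalIntegrable_const (μ := volume))
    (Continuous.intervalIntegrable (by fun_prop) _ _) h1
  rw [intervalIntegral.integral_add ((cA.intervalIntegrable _ _).const_mul _)
    intervalIntegrable_const, intervalIntegral.integral_const, intervalIntegral.integral_const,
    intervalIntegral.integral_const_mul, add_sub_cancel_left, one_smul, one_smul] at h2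
  have h3 : 0 ≤ ∫ r in t..(t + 1), A r :=
    intervalIntegral.integral_nonneg (by linarith) fun r _ => inner_psi₁_nonneg _
  linarith

end IsNLS

/-! ### From integrability in time to local decay. -/

/-- The sliding integral of a nonnegative function with bounded integrals tends to zero. -/
theorem tendsto_integral_window_zero {A : ℝ → ℝ} (cA : Continuous A) (hA : ∀ t, 0 ≤ A t) {B : ℝ}
    (hB : ∀ α β, α ≤ β → ∫ t in α..β, A t ≤ B) :
    Tendsto (fun t => ∫ r in t..(t + 1), A r) atTop (𝓝 0) := by
  have hi := fun α β => cA.intervalIntegrable (μ := volume) α β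
  have hmono : Monotone fun t => ∫ r in (0 : ℝ)..t, A r := fun s t hst => by
    beta_reduce
    have := intervalIntegral.integral_nonneg (μ := volume) hst fun r _ => hA r
    rw [← intervalIntegral.integral_add_adjacent_intervals (hi 0 s) (hi s t)]
    linarith
  have hbdd : BddAbove (Set.range fun t => ∫ r in (0 : ℝ)..t, A r) := by
    refine ⟨B, ?_⟩
    rintro _ ⟨t, rfl⟩
    refine (hmono (le_max_right 0 t)).trans (hB 0 _ (le_max_left 0 t))
  have h1 := tendsto_atTop_ciSup hmono hbdd
  have h2 := h1.comp (tendsto_atTop_add_const_right atTop (1 : ℝ) tendsto_id)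
  have h3 := h2.sub h1
  rw [sub_self] at h3
  refine h3.congr fun t => ?_
  simp only [Function.comp, id]
  rw [intervalIntegral.integral_interval_sub_left (hi _ _) (hi _ _)]

/-- A nonnegative function of time with bounded integrals over bounded intervals has finite
integral over the line. -/
theorem lintegral_ofReal_lt_top {A : ℝ → ℝ} (cA : Continuous A) (hA : ∀ t, 0 ≤ A t) {B : ℝ}
    (hB : ∀ α β, α ≤ β → ∫ t in α..β, A t ≤ B) : ∫⁻ t, ENNReal.ofReal (A t) < ⊤ := by
  have hU : (⋃ n : ℕ, Set.Ioc (-(n : ℝ)) n) = Set.univ := by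
    refine Set.eq_univ_of_forall fun x => Set.mem_iUnion.2 ?_
    obtain ⟨n, hn⟩ := exists_nat_gt |x|
    exact ⟨n, (abs_lt.1 hn).1, (abs_lt.1 hn).2.le⟩
  have hd : Directed (· ⊆ ·) fun n : ℕ => Set.Ioc (-(n : ℝ)) n :=
    Monotone.directed_le fun m n hmn => Set.Ioc_subset_Ioc
      (neg_le_neg (Nat.cast_le.2 hmn)) (Nat.cast_le.2 hmn)
  rw [← setLIntegral_univ, ← hU, setLIntegral_iUnion_of_directed _ hd]
  refine lt_of_le_of_lt (iSup_le fun n => ?_) (ENNReal.ofReal_lt_top (r := B))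
  have hn : -(n : ℝ) ≤ n := by have := n.cast_nonneg (α := ℝ); linarith
  rw [← ofReal_integral_eq_lintegral_ofReal (cA.intervalIntegrable _ _).1 (ae_of_all _ hA),
    ← intervalIntegral.integral_of_le hn]
  exact ENNReal.ofReal_le_ofReal (hB _ _ hn)

/-- The gradient factor in the local supremum bound need only be bounded. Decay comes entirely from
the weighted mass, so pointwise decay in time of the local kinetic energy is not required. -/
theorem IsNLS.ae_norm_le {a b C : ℝ} {K : ℝ → ℝ} {v w : ℝ → L2} (H : IsNLS a b C K v w) {M : ℝ}
    (hw : ∀ t, ‖w t‖ ≤ M) {R : ℝ} (hR : 0 ≤ R) (t : ℝ) :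
    ∀ᵐ x, |x| ≤ R → ‖v t x‖ ≤ √(2 * (1 + R) ^ 3 *
      (√(6 * ∫ r in t..(t + 1), (inner ℝ (mulL psi₁ (w r)) (w r) : ℝ)) * M)) := by
  filter_upwards [(H.odd t).ae_normSq_le_of_abs_le hR] with x hx hxR
  refine Real.le_sqrt_of_sq_le ((hx hxR).trans ?_)
  have h1 := Real.le_sqrt_of_sq_le (H.norm_rinv_two_sq_le t)
  have h2 := norm_mulL_le (isMult_rinv 1) (abs_rinv_le_one 1) (w t)
  rw [one_mul] at h2
  have h3 := h2.trans (hw t)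
  gcongr

theorem localDecay_of_isNLS {a b C : ℝ} {K : ℝ → ℝ} {u : ℝ → H1}
    (H : IsNLS a b C K (fun t => (u t).1.fst) (fun t => (u t).1.snd)) {M : ℝ}
    (hw : ∀ t, ‖(u t).1.snd‖ ≤ M) {B : ℝ}
    (hB : ∀ α β, α ≤ β →
      ∫ t in α..β, (inner ℝ (mulL psi₁ (u t).1.snd) (u t).1.snd : ℝ) ≤ B) : LocalDecay u := by
  intro I hI' hI
  obtain ⟨R, hR⟩ := hI.subset_closedBall 0
  have hR' : ∀ x ∈ I, |x| ≤ max R 0 := fun x hx => by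
    have := mem_closedBall_zero_iff.1 (hR hx)
    exact this.trans (le_max_left _ _)
  have hfin : volume I ≠ ⊤ := hI.measure_lt_top.ne
  have h0 := tendsto_integral_window_zero H.continuous_inner_psi₁
    (fun t => IsNLS.inner_psi₁_nonneg _) hB
  set D := fun t : ℝ => √(2 * (1 + max R 0) ^ 3 *
    (√(6 * ∫ r in t..(t + 1), (inner ℝ (mulL psi₁ (u r).1.snd) (u r).1.snd : ℝ)) * M)) with hD
  have hD0 : Tendsto D atTop (𝓝 0) := by
    have := (((h0.const_mul 6).sqrt.mul_const M).const_mul (2 * (1 + max R 0) ^ 3)).sqrt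
    simpa [hD] using this
  -- One bound serves p = 2 and p = ∞: in Lean `(⊤ : ℝ≥0∞).toReal` is 0 and has inverse 0, so for p
  -- = ∞ the volume factor is 1.
  have hb : ∀ (p : ℝ≥0∞) (t : ℝ), eLpNorm (fn (u t)) p (volume.restrict I) ≤
      (volume I) ^ p.toReal⁻¹ * ENNReal.ofReal (D t) := fun p t => by
    have h1 : ∀ᵐ x ∂(volume.restrict I), ‖fn (u t) x‖ ≤ D t := by
      rw [ae_restrict_iff' hI'.measurableSet]
      filter_upwards [H.ae_norm_le hw (le_max_right R 0) t] with x hx hxI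
      exact hx (hR' x hxI)
    have := eLpNorm_le_of_ae_bound (p := p) h1
    rwa [Measure.restrict_apply_univ] at this
  have hlim : ∀ p : ℝ≥0∞,
      Tendsto (fun t => eLpNorm (fn (u t)) p (volume.restrict I)) atTop (𝓝 0) := fun p => by
    refine tendsto_of_tendsto_of_tendsto_of_le_of_le tendsto_const_nhds ?_ (fun _ => bot_le)
      (hb p)
    have h1 := ENNReal.tendsto_ofReal hD0
    rw [ENNReal.ofReal_zero] at h1
    have h2 := ENNReal.Tendsto.const_mul (a := (volume I) ^ p.toReal⁻¹) h1
      (Or.inr (ENNReal.rpow_ne_top_of_nonneg (by positivity) hfin))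
    rwa [mul_zero] at h2
  simpa using (hlim 2).add (hlim ⊤)

/-! ### Consequences of the conditions on the coefficient. -/

theorem CondK1.exists_coeffBound {b : ℝ} {K : ℝ → ℝ} (hb0 : 0 < b) (hb1 : b < 1)
    (hK : ContDiffOn ℝ 1 K {0}ᶜ) (h : CondK1 b K) : ∃ C, CoeffBound b C K := by
  obtain ⟨hpos, ⟨C, hC⟩, -, ⟨D, hD⟩⟩ := h
  refine ⟨max (max C D) 0, hb0, hb1, le_max_right _ _, hK, fun x hx => ?_, fun x hx => ?_⟩
  · rw [abs_of_pos (hpos x hx)]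
    refine (hC x hx).trans ?_
    gcongr
    exact (le_max_left _ _).trans (le_max_left _ _)
  · refine (hD x hx).trans ?_
    gcongr
    exact (le_max_right _ _).trans (le_max_left _ _)

theorem one_add_abs_rpow_neg (k : ℕ) (x : ℝ) : (1 + |x|) ^ (-(k : ℝ)) = rinv k x := by
  rw [Real.rpow_neg (one_add_abs_pos x).le, Real.rpow_natCast, rinv]

/-- The decay condition with a common constant and integer powers of the weight. -/
theorem CondK4.exists_bound {b : ℝ} {K : ℝ → ℝ} (h : CondK4 b K) : ∃ C, 0 ≤ C ∧
    (∀ x, x ≠ 0 → |K x| ≤ C * (|x| ^ (-b) * rinv 3 x)) ∧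
    (∀ x, x ≠ 0 → |deriv K x| ≤ C * (|x| ^ (-b - 1) * rinv 3 x)) := by
  obtain ⟨⟨C, hC⟩, ⟨D, hD⟩⟩ := h
  have e : ∀ x : ℝ, (1 + |x|) ^ (-3 : ℝ) = rinv 3 x := fun x => by
    have := one_add_abs_rpow_neg 3 x
    rwa [Nat.cast_ofNat] at this
  simp only [e] at hC hD
  have hr : ∀ x, 0 ≤ rinv 3 x := fun x => (rinv_pos 3 x).le
  refine ⟨max (max C D) 0, le_max_right _ _, fun x hx => (hC x hx).trans ?_,
    fun x hx => (hD x hx).trans ?_⟩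
  · have := hr x
    gcongr
    exact (le_max_left _ _).trans (le_max_left _ _)
  · have := hr x
    gcongr
    exact (le_max_right _ _).trans (le_max_left _ _)

section

variable {a b C : ℝ} {K : ℝ → ℝ} {f g : L2}

theorem inner_nl_self (h : OddH1 f g) (ha : 0 < a) (hK : CoeffBound b C K) :
    (inner ℝ (nl a K f) f : ℝ) = ∫ x, K x * ‖f x‖ ^ (a + 2) := by
  rw [L2.inner_def]
  refine integral_congr_ae ?_
  filter_upwards [nl_ae ha hK h] with x h1
  rw [h1, real_inner_smul_left, inner_pw_self, norm_rpow_add_two ha]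

/-- The nonlinear contribution to the virial identity. -/
theorem virial_nl_eq (h : OddH1 f g) (ha : 0 < a) (hK : CoeffBound b C K) :
    (2 * inner ℝ (nl a K f) (mulL psi g) + inner ℝ (nl a K f) (mulL psi₁ f) : ℝ) =
      a / (a + 2) * (∫ x, psi₁ x * K x * ‖f x‖ ^ (a + 2)) -
        2 / (a + 2) * ∫ x, psi x * deriv K x * ‖f x‖ ^ (a + 2) := by
  have h1 := h.inner_nl_psi ha hK
  rw [h.inner_nl_psi₁ ha hK]
  have h2 : a + 2 ≠ 0 := by linarith
  field_simp
  linear_combination 2 * h1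

/-- The inequality 2xy ≤ x² + y² trades |x|^{-b}|f|² for (|x|^{-b}|f|)² and |f|², whose integrals
are already controlled. The surplus factor R^a makes the potential energy subordinate to the squared
H¹ norm for small data. -/
theorem abs_inner_nl_self_le (h : OddH1 f g) (ha : 0 < a) (hK : CoeffBound b C K) {R : ℝ}
    (hf : ‖f‖ ≤ R) (hg : ‖g‖ ≤ R) :
    |(inner ℝ (nl a K f) f : ℝ)| ≤
      C * (2 * R) ^ a * (((∫ x, nearPow (1 - 2 * b) x) + 1) * R ^ 2) := by
  have hR : 0 ≤ R := (norm_nonneg f).trans hf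
  have hC := hK.C_nonneg
  have h1 := h.integral_weight_le hK.b_pos hK.b_lt
  have i1 := (h.memLp_weight hK.b_pos hK.b_lt).integrable_sq
  have i2 := L2.integrable_norm_sq f
  have hN : 0 ≤ ∫ x, nearPow (1 - 2 * b) x := integral_nonneg fun x => nearPow_nonneg _ x
  rw [inner_nl_self h ha hK]
  have h2 : ∀ᵐ x, |K x * ‖f x‖ ^ (a + 2)| ≤
      C * (2 * R) ^ a * (2⁻¹ * ((|x| ^ (-b) * ‖f x‖) ^ 2 + ‖f x‖ ^ 2)) := by
    filter_upwards [h.ae_norm_le hf hg, ae_ne_zero] with x hx hne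
    have h3 : ‖f x‖ ^ a ≤ (2 * R) ^ a := Real.rpow_le_rpow (norm_nonneg _) hx ha.le
    have h4 := hK.bound x hne
    have h5 : |x| ^ (-b) * ‖f x‖ * ‖f x‖ ≤ 2⁻¹ * ((|x| ^ (-b) * ‖f x‖) ^ 2 + ‖f x‖ ^ 2) := by
      linarith [two_mul_le_add_sq (|x| ^ (-b) * ‖f x‖) ‖f x‖]
    rw [norm_rpow_add_two ha, abs_mul, abs_of_nonneg (by positivity : 0 ≤ ‖f x‖ ^ a * ‖f x‖ ^ 2)]
    calc |K x| * (‖f x‖ ^ a * ‖f x‖ ^ 2)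
        ≤ C * |x| ^ (-b) * ((2 * R) ^ a * ‖f x‖ ^ 2) := by gcongr
      _ = C * (2 * R) ^ a * (|x| ^ (-b) * ‖f x‖ * ‖f x‖) := by ring
      _ ≤ _ := by gcongr
  have h3 : |∫ x, K x * ‖f x‖ ^ (a + 2)| ≤
      ∫ x, C * (2 * R) ^ a * (2⁻¹ * ((|x| ^ (-b) * ‖f x‖) ^ 2 + ‖f x‖ ^ 2)) := by
    rw [← Real.norm_eq_abs]
    exact norm_integral_le_of_norm_le (((i1.add i2).const_mul _).const_mul _) h2
  refine h3.trans ?_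
  rw [integral_const_mul, integral_const_mul, integral_add i1 i2, ← L2.norm_sq_eq_integral]
  have h4 := pow_le_pow_left₀ (norm_nonneg f) hf 2
  have h5 := mul_le_mul_of_nonneg_left (pow_le_pow_left₀ (norm_nonneg g) hg 2) hN
  refine mul_le_mul_of_nonneg_left ?_ (by positivity)
  linarith [mul_nonneg hN (sq_nonneg R)]

theorem OddH1.integrable_weight_rinv_four (h : OddH1 f g) (ha : 0 < a) (hb0 : 0 < b)
    (hb1 : b < 1) : Integrable fun x => |x| ^ (-b) * rinv 4 x * ‖f x‖ ^ (a + 2) := by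
  have h1 := h.integrable_weight_mul_rpow ha hb0 hb1
  refine (h1.bdd_mul (c := 1) (continuous_rinv 4).aestronglyMeasurable
    (ae_of_all _ fun x => abs_rinv_le_one 4 x)).congr (ae_of_all _ fun x => ?_)
  ring

/-- The weighted potential energy is controlled by the local kinetic energy. -/
theorem OddH1.integral_weight_rinv_four_le (h : OddH1 f g) (ha : 0 < a) (hb0 : 0 < b)
    (hb1 : b < 1) {R : ℝ} (hf : ‖f‖ ≤ R) (hg : ‖g‖ ≤ R) :
    ∫ x, |x| ^ (-b) * rinv 4 x * ‖f x‖ ^ (a + 2) ≤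
      (2 * R) ^ a * (11 * (∫ x, nearPow (-b) x) + 1) * inner ℝ (mulL psi₁ g) g := by
  have hR : 0 ≤ R := (norm_nonneg f).trans hf
  set A := (inner ℝ (mulL psi₁ g) g : ℝ) with hA
  have hA0 : 0 ≤ A := IsNLS.inner_psi₁_nonneg g
  have hAe : A = ‖mulL (rinv 1) g‖ ^ 2 := inner_mulL_psi₁_eq g
  have hN : 0 ≤ ∫ x, nearPow (-b) x := integral_nonneg fun x => nearPow_nonneg _ x
  have h1 := h.norm_rinv_two_le
  have i1 := (integrable_nearPow (s := -b) (by linarith)).mul_const (11 * A)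
  have i2 := integrable_mulL_sq (isMult_rinv 2) f
  have h2 : ∀ᵐ x, |x| ^ (-b) * rinv 4 x * ‖f x‖ ^ (a + 2) ≤
      (2 * R) ^ a * (nearPow (-b) x * (11 * A) + rinv 2 x ^ 2 * ‖f x‖ ^ 2) := by
    filter_upwards [h.ae_norm_le hf hg, h.ae_normSq_le_of_abs_le zero_le_one] with x hx h3
    have h4 : ‖f x‖ ^ a ≤ (2 * R) ^ a := Real.rpow_le_rpow (norm_nonneg _) hx ha.le
    have hr := (rinv_pos 4 x).le
    have h5 : |x| ^ (-b) * rinv 4 x * ‖f x‖ ^ 2 ≤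
        nearPow (-b) x * (11 * A) + rinv 2 x ^ 2 * ‖f x‖ ^ 2 := by
      rw [sq (rinv 2 x), ← rinv_add]
      rcases le_or_gt |x| 1 with h6 | h6
      -- At R = 1 the local bound has constant 2·2³ = 16, and Hardy contributes 2/3; the product
      -- 32/3 is rounded up to 11.
      · have h7 : ‖f x‖ ^ 2 ≤ 11 * A := by
          have := mul_le_mul_of_nonneg_right h1 (norm_nonneg (mulL (rinv 1) g))
          have := h3 h6
          nlinarith
        rw [nearPow_of_abs_le h6]
        have h8 : rinv 4 x * ‖f x‖ ^ 2 ≤ 11 * A :=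
          (mul_le_of_le_one_left (by positivity) (rinv_le_one 4 x)).trans h7
        have h9 : 0 ≤ rinv (2 + 2) x * ‖f x‖ ^ 2 := by positivity
        calc |x| ^ (-b) * rinv 4 x * ‖f x‖ ^ 2 = |x| ^ (-b) * (rinv 4 x * ‖f x‖ ^ 2) := by ring
          _ ≤ |x| ^ (-b) * (11 * A) := by gcongr
          _ ≤ _ := le_add_of_nonneg_right h9
      · have h7 := Real.rpow_le_one_of_one_le_of_nonpos h6.le (neg_nonpos.2 hb0.le)
        have h8 := mul_nonneg (nearPow_nonneg (-b) x) (by positivity : 0 ≤ 11 * A)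
        calc |x| ^ (-b) * rinv 4 x * ‖f x‖ ^ 2 ≤ 1 * rinv 4 x * ‖f x‖ ^ 2 := by gcongr
          _ = rinv (2 + 2) x * ‖f x‖ ^ 2 := by rw [one_mul]
          _ ≤ _ := le_add_of_nonneg_left h8
    rw [norm_rpow_add_two ha]
    calc |x| ^ (-b) * rinv 4 x * (‖f x‖ ^ a * ‖f x‖ ^ 2)
        = ‖f x‖ ^ a * (|x| ^ (-b) * rinv 4 x * ‖f x‖ ^ 2) := by ring
      _ ≤ _ := by gcongr
  refine (integral_mono_ae (h.integrable_weight_rinv_four ha hb0 hb1)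
    ((i1.add i2).const_mul _) h2).trans ?_
  rw [integral_const_mul, mul_assoc]
  refine mul_le_mul_of_nonneg_left ?_ (by positivity)
  have h3 := integral_add i1 i2
  simp only [Pi.add_apply]
  rw [h3, integral_mul_const, ← norm_mulL_sq_eq (isMult_rinv 2)]
  have h4 := pow_le_pow_left₀ (norm_nonneg _) h1 2
  rw [mul_pow, ← hAe] at h4
  nlinarith

/-- For the K' term, `psi` has modulus |x|(1+|x|)^{-1}: it turns |x|^{-b−1} into |x|^{-b} and raises
the decay from 3 to exactly 4. For the K term the decay 2 + 3 is more than enough. The coefficients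
a/(a+2) and 2/(a+2) add up to 1. -/
theorem abs_virial_nl_le (h : OddH1 f g) (ha : 0 < a) {C₁ : ℝ} (hK : CoeffBound b C₁ K)
    (hC : 0 ≤ C) (hK₀ : ∀ x, x ≠ 0 → |K x| ≤ C * (|x| ^ (-b) * rinv 3 x))
    (hK₁ : ∀ x, x ≠ 0 → |deriv K x| ≤ C * (|x| ^ (-b - 1) * rinv 3 x)) :
    |(2 * inner ℝ (nl a K f) (mulL psi g) + inner ℝ (nl a K f) (mulL psi₁ f) : ℝ)| ≤
      C * ∫ x, |x| ^ (-b) * rinv 4 x * ‖f x‖ ^ (a + 2) := by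
  have i := (h.integrable_weight_rinv_four ha hK.b_pos hK.b_lt).const_mul C
  have h1 : |∫ x, psi₁ x * K x * ‖f x‖ ^ (a + 2)| ≤
      ∫ x, C * (|x| ^ (-b) * rinv 4 x * ‖f x‖ ^ (a + 2)) := by
    rw [← Real.norm_eq_abs]
    refine norm_integral_le_of_norm_le i ?_
    filter_upwards [ae_ne_zero] with x hx
    have h3 := hK₀ x hx
    have hr := (rinv_pos 2 x).le
    have hr3 := (rinv_pos 3 x).le
    rw [norm_mul, norm_mul, psi₁_eq_rinv, Real.norm_of_nonneg hr, Real.norm_eq_abs,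
      Real.norm_of_nonneg (by positivity)]
    have h4 : rinv 2 x * rinv 3 x ≤ rinv 4 x := by
      rw [← rinv_add]; exact rinv_anti (by norm_num) x
    calc rinv 2 x * |K x| * ‖f x‖ ^ (a + 2)
        ≤ rinv 2 x * (C * (|x| ^ (-b) * rinv 3 x)) * ‖f x‖ ^ (a + 2) := by gcongr
      _ = C * (|x| ^ (-b) * (rinv 2 x * rinv 3 x) * ‖f x‖ ^ (a + 2)) := by ring
      _ ≤ _ := by gcongr
  have h2 : |∫ x, psi x * deriv K x * ‖f x‖ ^ (a + 2)| ≤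
      ∫ x, C * (|x| ^ (-b) * rinv 4 x * ‖f x‖ ^ (a + 2)) := by
    rw [← Real.norm_eq_abs]
    refine norm_integral_le_of_norm_le i ?_
    filter_upwards [ae_ne_zero] with x hx
    have h3 := hK₁ x hx
    have hr := (rinv_pos 1 x).le
    have e1 : |psi x| = |x| * rinv 1 x := by rw [abs_psi_eq, rinv, pow_one, div_eq_mul_inv]
    have e2 : |x| ^ (-b - 1) * |x| = |x| ^ (-b) := by
      rw [← Real.rpow_add_one (abs_pos.2 hx).ne']; norm_num
    rw [norm_mul, norm_mul, Real.norm_eq_abs, e1, Real.norm_eq_abs,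
      Real.norm_of_nonneg (by positivity)]
    calc |x| * rinv 1 x * |deriv K x| * ‖f x‖ ^ (a + 2)
        ≤ |x| * rinv 1 x * (C * (|x| ^ (-b - 1) * rinv 3 x)) * ‖f x‖ ^ (a + 2) := by gcongr
      _ = C * ((|x| ^ (-b - 1) * |x|) * (rinv 3 x * rinv 1 x) * ‖f x‖ ^ (a + 2)) := by ring
      _ = _ := by rw [e2, ← rinv_add]
  rw [integral_const_mul] at h1 h2
  rw [virial_nl_eq h ha hK]
  generalize (∫ x, psi₁ x * K x * ‖f x‖ ^ (a + 2)) = I₁ at h1 ⊢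
  generalize (∫ x, psi x * deriv K x * ‖f x‖ ^ (a + 2)) = I₂ at h2 ⊢
  generalize (C * ∫ x, |x| ^ (-b) * rinv 4 x * ‖f x‖ ^ (a + 2)) = I at h1 h2 ⊢
  have ha2 : 0 < a + 2 := by linarith
  calc |a / (a + 2) * I₁ - 2 / (a + 2) * I₂|
      ≤ |a / (a + 2) * I₁| + |2 / (a + 2) * I₂| := abs_sub _ _
    _ = a / (a + 2) * |I₁| + 2 / (a + 2) * |I₂| := by
        rw [abs_mul, abs_mul, abs_of_nonneg (by positivity : 0 ≤ a / (a + 2)),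
          abs_of_nonneg (by positivity : 0 ≤ 2 / (a + 2))]
    _ ≤ a / (a + 2) * I + 2 / (a + 2) * I := by gcongr
    _ = I := by field_simp

end

/-! ### The repulsive case and the small-data case. -/

theorem norm_sq_eq (f : H1) : ‖f‖ ^ 2 = ‖f.1.fst‖ ^ 2 + ‖f.1.snd‖ ^ 2 :=
  WithLp.prod_norm_sq_eq_of_L2 f.1

theorem norm_fst_le (f : H1) : ‖f.1.fst‖ ≤ ‖f‖ := by
  refine (pow_le_pow_iff_left₀ (norm_nonneg _) (norm_nonneg _) two_ne_zero).1 ?_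
  rw [norm_sq_eq]; exact le_add_of_nonneg_right (by positivity)

theorem norm_snd_le (f : H1) : ‖f.1.snd‖ ≤ ‖f‖ := by
  refine (pow_le_pow_iff_left₀ (norm_nonneg _) (norm_nonneg _) two_ne_zero).1 ?_
  rw [norm_sq_eq]; exact le_add_of_nonneg_left (by positivity)

/-- Decay of solutions with repulsive coefficient. -/
theorem localDecay_and_morawetz_of_condK1 {σ b : ℝ} {K : ℝ → ℝ} {u₀ : H1} {u : ℝ → H1}
    (hσ : 0 < σ) (hb0 : 0 < b) (hb1 : b < 1) (hKd : ContDiffOn ℝ 1 K {0}ᶜ) (hK : CondK1 b K)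
    (hu : IsGlobalSolution σ K u₀ u) (ho : ∀ t, IsOdd (u t)) :
    LocalDecay u ∧ morawetz σ (fun x => |x * deriv K x| / (1 + |x|)) u < ⊤ := by
  obtain ⟨C, hC⟩ := hK.exists_coeffBound hb0 hb1 hKd
  obtain ⟨hpos, -, hmono, -⟩ := hK
  have H := hu.isNLS hσ hC ho
  have ha := H.a_pos
  set a := 2 * σ with hadef
  have ha2 : 0 < a + 2 := by linarith
  set v := fun t => (u t).1.fst with hv
  set w := fun t => (u t).1.snd with hw
  have hE : ∀ t, 0 ≤ (inner ℝ (nl a K (v t)) (v t) : ℝ) := fun t => by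
    rw [inner_nl_self (H.odd t) ha hC]
    refine integral_nonneg_of_ae ?_
    filter_upwards [ae_ne_zero] with x hx
    exact mul_nonneg (hpos x hx).le (by positivity)
  set E := ‖w 0‖ ^ 2 + 2 / (a + 2) * inner ℝ (nl a K (v 0)) (v 0)
  set M := max ‖v 0‖ √E
  have hvM : ∀ t, ‖v t‖ ≤ M := fun t => (H.norm_eq 0 t).le.trans (le_max_left _ _)
  have hwM : ∀ t, ‖w t‖ ≤ M := fun t => by
    refine (Real.le_sqrt_of_sq_le ?_).trans (le_max_right _ _)
    have h1 := H.energy_eq 0 t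
    have h2 := mul_nonneg (by positivity : 0 ≤ 2 / (a + 2)) (hE t)
    linarith
  have cA := H.continuous_inner_psi₁
  have cS := H.continuous_virial_nl
  set A := fun t => (inner ℝ (mulL psi₁ (w t)) (w t) : ℝ) with hA
  set S := fun t => (2 * inner ℝ (nl a K (v t)) (mulL psi (w t)) +
    inner ℝ (nl a K (v t)) (mulL psi₁ (v t)) : ℝ) with hS
  have hA0 : ∀ t, 0 ≤ A t := fun t => IsNLS.inner_psi₁_nonneg _
  have hKx : ∀ x, x ≠ 0 → psi x * deriv K x = -(|x * deriv K x| / (1 + |x|)) := fun x hx => by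
    rw [abs_of_nonpos (hmono x hx), psi]; ring
  have hQ0 : ∀ t, 0 ≤ ∫ x, -(psi x * deriv K x * ‖v t x‖ ^ (a + 2)) := fun t => by
    refine integral_nonneg_of_ae ?_
    filter_upwards [ae_ne_zero] with x hx
    simp only [Pi.zero_apply]
    rw [hKx x hx, neg_mul, neg_neg]
    positivity
  -- The term with ψ'K is nonnegative and is dropped. The factor (a+2)/2 normalises the coefficient
  -- of the K' term.
  have hSQ : ∀ t, ∫ x, -(psi x * deriv K x * ‖v t x‖ ^ (a + 2)) ≤ (a + 2) / 2 * S t := fun t => by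
    have h1 : 0 ≤ ∫ x, psi₁ x * K x * ‖v t x‖ ^ (a + 2) := by
      refine integral_nonneg_of_ae ?_
      filter_upwards [ae_ne_zero] with x hx
      exact mul_nonneg (mul_nonneg (psi₁_pos x).le (hpos x hx).le) (by positivity)
    simp only [hS]
    rw [virial_nl_eq (H.odd t) ha hC, integral_neg]
    have h2 := mul_nonneg (by positivity : 0 ≤ a / 2) h1
    refine le_of_sub_nonneg (h2.trans_eq ?_)
    field_simp
    ring
  have hS0 : ∀ t, 0 ≤ S t := fun t =>
    nonneg_of_mul_nonneg_right ((hQ0 t).trans (hSQ t)) (by positivity)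
  have hvir := fun α β (h : α ≤ β) => H.integral_virial_le hvM hwM h
  have cV : Continuous fun t => 2 / 3 * A t + S t := by fun_prop
  have hAB : ∀ α β, α ≤ β → ∫ t in α..β, A t ≤ 3 / 2 * (2 * M ^ 2) := fun α β h => by
    refine le_trans ?_ (mul_le_mul_of_nonneg_left (hvir α β h) (by norm_num))
    rw [← intervalIntegral.integral_const_mul]
    refine intervalIntegral.integral_mono_on h (cA.intervalIntegrable _ _)
      ((cV.const_mul (3 / 2)).intervalIntegrable _ _) fun t _ => ?_
    have := hS0 t
    show A t ≤ 3 / 2 * (2 / 3 * A t + S t)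
    linarith
  have hSB : ∀ α β, α ≤ β → ∫ t in α..β, (a + 2) / 2 * S t ≤ (a + 2) / 2 * (2 * M ^ 2) :=
    fun α β h => by
      rw [intervalIntegral.integral_const_mul]
      refine mul_le_mul_of_nonneg_left (le_trans ?_ (hvir α β h)) (by positivity)
      refine intervalIntegral.integral_mono_on h (cS.intervalIntegrable _ _)
        (cV.intervalIntegrable _ _) fun t _ => ?_
      have := hA0 t
      show S t ≤ 2 / 3 * A t + S t
      linarith
  refine ⟨localDecay_of_isNLS H hwM hAB, lt_of_le_of_lt ?_
    (lintegral_ofReal_lt_top (cS.const_mul ((a + 2) / 2))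
      (fun t => mul_nonneg (by positivity) (hS0 t)) hSB)⟩
  refine lintegral_mono fun t => ?_
  refine le_trans (le_of_eq ?_) (ENNReal.ofReal_le_ofReal (hSQ t))
  have hi : Integrable fun x => -(psi x * deriv K x * ‖v t x‖ ^ (a + 2)) :=
    ((H.odd t).integrable_psi_deriv_mul_rpow ha hC).neg
  rw [ofReal_integral_eq_lintegral_ofReal hi]
  · refine lintegral_congr_ae ?_
    filter_upwards [ae_ne_zero] with x hx
    rw [hKx x hx, neg_mul, neg_neg]
    rfl
  · filter_upwards [ae_ne_zero] with x hx
    simp only [Pi.zero_apply]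
    rw [hKx x hx, neg_mul, neg_neg]
    positivity

/-- Small odd solutions remain small in `H¹`. -/
theorem norm_lt_of_small {a b C : ℝ} {K : ℝ → ℝ} {u : ℝ → H1} (cu : Continuous u)
    (H : IsNLS a b C K (fun t => (u t).1.fst) (fun t => (u t).1.snd)) {ε : ℝ} (hε : 0 < ε)
    (hs : C * (4 * ε) ^ a * ((∫ x, nearPow (1 - 2 * b) x) + 1) ≤ 1 / 4) (h0 : ‖u 0‖ ≤ ε) (t : ℝ) :
    ‖u t‖ < 2 * ε := by
  have ha := H.a_pos
  have hC := H.coeff.C_nonneg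
  have hN : 0 ≤ ∫ x, nearPow (1 - 2 * b) x := integral_nonneg fun x => nearPow_nonneg _ x
  have hnl : ∀ (s R : ℝ), ‖u s‖ ≤ R → R ≤ 2 * ε →
      |2 / (a + 2) * (inner ℝ (nl a K (u s).1.fst) (u s).1.fst : ℝ)| ≤ 1 / 4 * R ^ 2 := by
    intro s R hR hRε
    have hR0 : 0 ≤ R := (norm_nonneg _).trans hR
    have h1 := abs_inner_nl_self_le (H.odd s) ha H.coeff ((norm_fst_le _).trans hR)
      ((norm_snd_le _).trans hR)
    have h2 : (2 * R) ^ a ≤ (4 * ε) ^ a := Real.rpow_le_rpow (by positivity) (by linarith) ha.le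
    rw [abs_mul, abs_of_nonneg (by positivity : 0 ≤ 2 / (a + 2))]
    have h3 : 2 / (a + 2) ≤ 1 := (div_le_one (by linarith)).2 (by linarith)
    refine (mul_le_of_le_one_left (abs_nonneg _) h3).trans (h1.trans ?_)
    calc C * (2 * R) ^ a * (((∫ x, nearPow (1 - 2 * b) x) + 1) * R ^ 2)
        ≤ C * (4 * ε) ^ a * (((∫ x, nearPow (1 - 2 * b) x) + 1) * R ^ 2) := by gcongr
      _ = C * (4 * ε) ^ a * ((∫ x, nearPow (1 - 2 * b) x) + 1) * R ^ 2 := by ring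
      _ ≤ _ := by gcongr
  -- A continuity argument. If the norm were 2ε at some time, conservation of mass and energy would
  -- bound its square by ε² + ε²/4 + (2ε)²/4 = 9ε²/4, below 4ε². The value 2ε is never attained, so
  -- by continuity the norm never crosses it.
  have hne : ∀ s, ‖u s‖ ≠ 2 * ε := by
    intro s hs
    have h1 := hnl s (2 * ε) hs.le le_rfl
    have h2 := hnl 0 ε h0 (by linarith)
    have h3 := H.energy_eq 0 s
    have h4 := H.norm_eq 0 s
    have h5 := norm_sq_eq (u s)
    have h6 := norm_sq_eq (u 0)
    have h7 := pow_le_pow_left₀ (norm_nonneg _) h0 2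
    have h8 := (abs_le.1 h1).1
    have h9 := (abs_le.1 h2).2
    beta_reduce at h3 h4
    rw [hs, h4] at h5
    have : 0 < ε ^ 2 := by positivity
    nlinarith
  by_contra hcon
  push Not at hcon
  have hmem : 2 * ε ∈ Set.range fun s => ‖u s‖ :=
    mem_range_of_exists_le_of_exists_ge cu.norm ⟨0, by linarith⟩ ⟨t, hcon⟩
  obtain ⟨s, hs⟩ := hmem
  exact hne s hs

/-- Decay of small solutions with spatially decaying coefficient. -/
theorem exists_localDecay_and_morawetz_of_condK4 {σ b : ℝ} {K : ℝ → ℝ}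
    (hσ : 0 < σ) (hb0 : 0 < b) (hb1 : b < 1) (hKd : ContDiffOn ℝ 1 K {0}ᶜ) (hK : CondK4 b K) :
    ∃ ε : ℝ, 0 < ε ∧ ∀ (u₀ : H1) (u : ℝ → H1), IsGlobalSolution σ K u₀ u → (∀ t, IsOdd (u t)) →
      ‖u₀‖ ≤ ε → LocalDecay u ∧
        morawetz σ (fun x => |x| ^ (-b) * (1 + |x|) ^ (-4 : ℝ)) u < ⊤ := by
  obtain ⟨C, hC0, hK₀, hK₁⟩ := hK.exists_bound
  have hC : CoeffBound b C K := by
    refine ⟨hb0, hb1, hC0, hKd, fun x hx => (hK₀ x hx).trans ?_, fun x hx => (hK₁ x hx).trans ?_⟩ <;>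
    · gcongr
      exact mul_le_of_le_one_right (by positivity) (rinv_le_one 3 x)
  have ha : 0 < 2 * σ := by linarith
  set a := 2 * σ with hadef
  set N := (∫ x, nearPow (1 - 2 * b) x) + 1 with hN
  set κ := 11 * (∫ x, nearPow (-b) x) + 1 with hκ
  have hN0 : 0 ≤ N := add_nonneg (integral_nonneg fun x => nearPow_nonneg _ x) zero_le_one
  have hκ0 : 0 ≤ κ :=
    add_nonneg (mul_nonneg (by norm_num) (integral_nonneg fun x => nearPow_nonneg _ x)) zero_le_one
  -- With (4ε)^a = 1/Q, one choice gives the constant 1/4 needed to keep the solution small and the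
  -- constant 1/3 needed to absorb the nonlinear virial terms. The latter leaves 2/3 − 1/3 = 1/3 of
  -- the local kinetic energy. The summand 1 keeps Q positive even when C = 0.
  set Q := 4 * (C * N + C * κ + 1) with hQ
  have hQ0 : 0 < Q := by positivity
  have hCN : 0 ≤ C * N := by positivity
  have hCκ : 0 ≤ C * κ := by positivity
  refine ⟨Q⁻¹ ^ a⁻¹ / 4, by positivity, fun u₀ u hu ho hu₀ => ?_⟩
  set ε := Q⁻¹ ^ a⁻¹ / 4 with hε
  have hε0 : 0 < ε := by positivity
  have hεa : (4 * ε) ^ a = Q⁻¹ := by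
    rw [hε, mul_div_cancel₀ _ (by norm_num), ← Real.rpow_mul (by positivity),
      inv_mul_cancel₀ ha.ne', Real.rpow_one]
  have hs1 : C * (4 * ε) ^ a * N ≤ 1 / 4 := by
    rw [hεa, mul_right_comm, ← div_eq_mul_inv, div_le_iff₀ hQ0]; linarith
  have hs2 : C * ((4 * ε) ^ a * κ) ≤ 1 / 3 := by
    rw [hεa, mul_comm Q⁻¹, ← mul_assoc, ← div_eq_mul_inv, div_le_iff₀ hQ0]; linarith
  have H := hu.isNLS hσ hC ho
  have hsmall := norm_lt_of_small hu.continuous H hε0 hs1 (by rwa [hu.initial])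
  set v := fun t => (u t).1.fst with hv
  set w := fun t => (u t).1.snd with hw
  have hvM : ∀ t, ‖v t‖ ≤ 2 * ε := fun t => (norm_fst_le _).trans (hsmall t).le
  have hwM : ∀ t, ‖w t‖ ≤ 2 * ε := fun t => (norm_snd_le _).trans (hsmall t).le
  have cA := H.continuous_inner_psi₁
  have cS := H.continuous_virial_nl
  set A := fun t => (inner ℝ (mulL psi₁ (w t)) (w t) : ℝ) with hA
  set S := fun t => (2 * inner ℝ (nl a K (v t)) (mulL psi (w t)) +
    inner ℝ (nl a K (v t)) (mulL psi₁ (v t)) : ℝ) with hS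
  have hA0 : ∀ t, 0 ≤ A t := fun t => IsNLS.inner_psi₁_nonneg _
  have hG : ∀ t, ∫ x, |x| ^ (-b) * rinv 4 x * ‖v t x‖ ^ (a + 2) ≤ (4 * ε) ^ a * κ * A t :=
    fun t => by
      have h := (H.odd t).integral_weight_rinv_four_le ha hb0 hb1 (hvM t) (hwM t)
      rwa [show 2 * (2 * ε) = 4 * ε by ring] at h
  have hSA : ∀ t, |S t| ≤ 1 / 3 * A t := fun t => by
    refine (abs_virial_nl_le (H.odd t) ha hC hC0 hK₀ hK₁).trans
      ((mul_le_mul_of_nonneg_left (hG t) hC0).trans ?_)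
    rw [← mul_assoc]
    exact mul_le_mul_of_nonneg_right hs2 (hA0 t)
  have cV : Continuous fun t => 2 / 3 * A t + S t := by fun_prop
  have hAB : ∀ α β, α ≤ β → ∫ t in α..β, A t ≤ 3 * (2 * (2 * ε) ^ 2) := fun α β h => by
    refine le_trans ?_ (mul_le_mul_of_nonneg_left (H.integral_virial_le hvM hwM h) (by norm_num))
    rw [← intervalIntegral.integral_const_mul]
    refine intervalIntegral.integral_mono_on h (cA.intervalIntegrable _ _)
      ((cV.const_mul 3).intervalIntegrable _ _) fun t _ => ?_
    have := (abs_le.1 (hSA t)).1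
    show A t ≤ 3 * (2 / 3 * A t + S t)
    linarith
  have hc0 : 0 ≤ (4 * ε) ^ a * κ := by positivity
  refine ⟨localDecay_of_isNLS H hwM hAB, lt_of_le_of_lt ?_
    (lintegral_ofReal_lt_top (cA.const_mul ((4 * ε) ^ a * κ))
      (fun t => mul_nonneg hc0 (hA0 t))
      (B := (4 * ε) ^ a * κ * (3 * (2 * (2 * ε) ^ 2))) fun α β h => by
        rw [intervalIntegral.integral_const_mul]
        exact mul_le_mul_of_nonneg_left (hAB α β h) hc0)⟩
  refine lintegral_mono fun t => ?_
  refine le_trans (le_of_eq ?_) (ENNReal.ofReal_le_ofReal (hG t))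
  rw [ofReal_integral_eq_lintegral_ofReal ((H.odd t).integrable_weight_rinv_four ha hb0 hb1)
    (ae_of_all _ fun x => mul_nonneg (mul_nonneg (by positivity) (rinv_pos 4 x).le)
      (by positivity))]
  refine lintegral_congr fun x => ?_
  rw [← one_add_abs_rpow_neg, Nat.cast_ofNat]
  rfl

end INLS

theorem theorem1p2 (σ b : ℝ) (hσ : 0 < σ) (hb0 : 0 < b) (hb1 : b < 1)
    (K : ℝ → ℝ) (hK : INLS.IsCoefficient K) :
    (INLS.CondK1 b K →
      ∀ (u₀ : INLS.H1) (u : ℝ → INLS.H1), INLS.IsGlobalSolution σ K u₀ u →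
        INLS.IsOdd u₀ → (∀ t, INLS.IsOdd (u t)) →
        INLS.LocalDecay u ∧
        INLS.morawetz σ (fun x => |x * deriv K x| / (1 + |x|)) u < ⊤) ∧
    (INLS.CondK4 b K →
      ∃ ε : ℝ, 0 < ε ∧
        ∀ (u₀ : INLS.H1) (u : ℝ → INLS.H1), INLS.IsGlobalSolution σ K u₀ u →
          INLS.IsOdd u₀ → (∀ t, INLS.IsOdd (u t)) → ‖u₀‖ ≤ ε →
          INLS.LocalDecay u ∧
          INLS.morawetz σ (fun x => |x| ^ (-b) * (1 + |x|) ^ (-4 : ℝ)) u < ⊤) := by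
  refine ⟨fun h u₀ u hu _ ho =>
    INLS.localDecay_and_morawetz_of_condK1 hσ hb0 hb1 hK.2 h hu ho, fun h => ?_⟩
  obtain ⟨ε, hε, H⟩ := INLS.exists_localDecay_and_morawetz_of_condK4 hσ hb0 hb1 hK.2 h
  exact ⟨ε, hε, fun u₀ u hu _ ho hu₀ => H u₀ u hu ho hu₀⟩
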